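/- All vector spaces are over $\mathbb{C}$, $V'$ is the algebraic dual of $V$, and $\otimes$ is the algebraic tensor product. An algebra $A$ is non-degenerate if $ab=0$ for all $b$ implies $a=0$, and $ba=0$ for all $b$ implies $a=0$; $M(A)$ is its multiplier algebra. Let $(A,\Delta)$ be an algebraic quantum group: $A$ is a non-degenerate algebra, $\Delta:A\to M(A\otimes A)$ is a non-degenerate coassociative homomorphism such that $a\otimes b\mapsto \Delta(a)(b\otimes 1),\ \Delta(a)(1\otimes b),\ (b\otimes 1)\Delta(a),\ (1\otimes b)\Delta(a)$ are bijections from $A\otimes A$ onto $A\otimes A$, and there is a non-zero functional $\varphi\in A'$ with $(\iota\otimes\varphi)\Delta(a)=\varphi(a)1$ for all $a\in A$. It has a unique counit $\varepsilon$ (a non-zero homomorphism $A\to\mathbb{C}$ with $(\varepsilon\otimes\iota)\Delta=(\iota\otimes\varepsilon)\Delta=\iota$) and a unique antipode $S$ (an anti-automorphism of $A$ with $m(S\otimes\iota)(\Delta(a)(1\otimes b))=\varepsilon(a)b=m(\iota\otimes S)((b\otimes 1)\Delta(a))$, where $m$ is the multiplication map). For $\omega\in A'$ and $a\in A$ define $\omega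 a,\,a\omega\in A'$ by $(\omega a)(x)=\omega(ax)$ and $(a\omega)(x)=\omega(xa)$. Let $\hat A=\{\varphi a\mid a\in A\}\subseteq A'$ with product $(\omega_1\omega_2)(x)=\omega_1((\iota\otimes\omega_2)\Delta(x))$, and let $\hat\Delta:\hat A\to M(\hat A\otimes\hat A)$ be the unique non-degenerate homomorphism such that $\hat\Delta(\omega_1)(1\otimes\omega_2)$ and $(\omega_1\otimes 1)\hat\Delta(\omega_2)$ belong to $\hat A\otimes\hat A\subseteq (A\otimes A)'$ and are given there by $[\hat\Delta(\omega_1)(1\otimes\omega_2)](x\otimes y)=(\omega_1\otimes\omega_2)((x\otimes 1)\Delta(y))$ and $[(\omega_1\otimes 1)\hat\Delta(\omega_2)](x\otimes y)=(\omega_1\otimes\omega_2)(\Delta(x)(1\otimes y))$. The multiplier algebra $M(\hat A)$ is identified with $$\{\theta\in A'\mid (\theta\otimes\iota)\Delta(a)\in A \text{ and } (\iota\otimes\theta)\Delta(a)\in A\ \text{ for all } a\in A\}$$ by the unique linear isomorphism under which $\theta$ acts on $\omega\in\hat A$ by $(\theta\omega)(x)=\theta((\iota\otimes\omega)\Delta(x))$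 and $(\omega\theta)(x)=\theta((\omega\otimes\iota)\Delta(x))$. Let $\hat\varepsilon$ and $\hat S$ be the (unique) counit and antipode of $(\hat A,\hat\Delta)$, extended to $M(\hat A)$ as a homomorphism and as an anti-automorphism. All these objects exist and are unique as stated, and: 1. For every $\omega\in A'$ and $a\in A$, the functionals $\omega a$ and $a\omega$ belong to $M(\hat A)$, and $\hat\varepsilon(\omega a)=\omega(a)$ and $\hat\varepsilon(a\omega)=\omega(a)$. 2. For every $\omega\in M(\hat A)$, $\hat S(\omega)=\omega\circ S$ and $\hat S^{-1}(\omega)=\omega\circ S^{-1}$. -/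

import Mathlib

open scoped TensorProduct

set_option linter.unusedSectionVars false

noncomputable section

namespace QuantumGroup

section Multipliers

variable {A B C : Type*}
variable [NonUnitalRing A] [Module ℂ A] [IsScalarTower ℂ A A] [SMulCommClass ℂ A A]
variable [NonUnitalRing B] [Module ℂ B] [IsScalarTower ℂ B B] [SMulCommClass ℂ B B]
variable [NonUnitalRing C] [Module ℂ C] [IsScalarTower ℂ C C] [SMulCommClass ℂ C C]

/-- A (possibly non-unital) complex algebra is non-degenerate when no non-zero element is
annihilated by all left, or by all right, multiplications. -/
def NondegenerateAlgebra (A : Type*) [NonUnitalRing A] : Prop :=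
  ∀ a : A, ((∀ b, a * b = 0) → a = 0) ∧ ((∀ b, b * a = 0) → a = 0)

/-- The pairs `(L, R)` of linear maps on `A` with `R x * y = x * L y`, as a subalgebra of
`End(A) × End(A)ᵒᵖ`. -/
def multiplierSubalgebra (A : Type*) [NonUnitalRing A] [Module ℂ A] [IsScalarTower ℂ A A]
    [SMulCommClass ℂ A A] : Subalgebra ℂ (Module.End ℂ A × (Module.End ℂ A)ᵐᵒᵖ) where
  carrier := {p | ∀ x y : A, p.2.unop x * y = x * p.1 y}
  mul_mem' := by
    intro p q hp hq x y
    change q.2.unop (p.2.unop x) * y = x * p.1 (q.1 y)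
    rw [hq, hp]
  add_mem' := by
    intro p q hp hq x y
    change (p.2.unop x + q.2.unop x) * y = x * (p.1 y + q.1 y)
    rw [add_mul, mul_add, hp, hq]
  algebraMap_mem' := by
    intro c x y
    simp [Module.algebraMap_end_apply, smul_mul_assoc, mul_smul_comm]

/-- The multiplier algebra `M(A)`: an element `m` is given by its left multiplication
`L y = m y` and its right multiplication `R x = x m`, subject to `(x m) y = x (m y)`.  The product
is such that `L (m n) = L m ∘ L n` and `R (m n) = R n ∘ R m`. -/
def Multiplier (A : Type*) [NonUnitalRing A] [Module ℂ A] [IsScalarTower ℂ A A]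
    [SMulCommClass ℂ A A] : Type _ := ↥(multiplierSubalgebra A)

instance : Ring (Multiplier A) := inferInstanceAs (Ring ↥(multiplierSubalgebra A))

instance : Algebra ℂ (Multiplier A) := inferInstanceAs (Algebra ℂ ↥(multiplierSubalgebra A))

namespace Multiplier

/-- Left multiplication `x ↦ m x`. -/
def L (m : Multiplier A) : A →ₗ[ℂ] A := m.1.1

/-- Right multiplication `x ↦ x m`. -/
def R (m : Multiplier A) : A →ₗ[ℂ] A := m.1.2.unop

theorem balanced (m : Multiplier A) (x y : A) : m.R x * y = x * m.L y := m.2 x y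

/-- Build a multiplier from its left and right multiplications. -/
def mk (l r : A →ₗ[ℂ] A) (h : ∀ x y, r x * y = x * l y) : Multiplier A :=
  ⟨(l, MulOpposite.op r), h⟩

@[simp] theorem L_mk (l r : A →ₗ[ℂ] A) (h) : (mk l r h).L = l := rfl
@[simp] theorem R_mk (l r : A →ₗ[ℂ] A) (h) : (mk l r h).R = r := rfl
@[simp] theorem L_one : (1 : Multiplier A).L = LinearMap.id := rfl
@[simp] theorem R_one : (1 : Multiplier A).R = LinearMap.id := rfl
@[simp] theorem L_mul_apply (m n : Multiplier A) (x : A) : (m * n).L x = m.L (n.L x) := rfl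
@[simp] theorem R_mul_apply (m n : Multiplier A) (x : A) : (m * n).R x = n.R (m.R x) := rfl
@[simp] theorem L_add_apply (m n : Multiplier A) (x : A) : (m + n).L x = m.L x + n.L x := rfl
@[simp] theorem R_add_apply (m n : Multiplier A) (x : A) : (m + n).R x = m.R x + n.R x := rfl
@[simp] theorem L_smul_apply (c : ℂ) (m : Multiplier A) (x : A) : (c • m).L x = c • m.L x := rfl
@[simp] theorem R_smul_apply (c : ℂ) (m : Multiplier A) (x : A) : (c • m).R x = c • m.R x := rfl
@[simp] theorem L_zero_apply (x : A) : (0 : Multiplier A).L x = 0 := rfl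
@[simp] theorem R_zero_apply (x : A) : (0 : Multiplier A).R x = 0 := rfl

theorem ext' {m n : Multiplier A} (hl : ∀ x, m.L x = n.L x) (hr : ∀ x, m.R x = n.R x) :
    m = n :=
  Subtype.ext (Prod.ext (LinearMap.ext hl) (MulOpposite.unop_injective (LinearMap.ext hr)))

/-- The canonical homomorphism `A → M(A)`, injective when `A` is non-degenerate. -/
def incl : A →ₙₐ[ℂ] Multiplier A where
  toFun a := mk (LinearMap.mulLeft ℂ a) (LinearMap.mulRight ℂ a) (by simp [mul_assoc])
  map_smul' c a := ext' (fun x => smul_mul_assoc c a x) (fun x => mul_smul_comm c x a)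
  map_zero' := ext' (fun x => zero_mul x) (fun x => mul_zero x)
  map_add' a b := ext' (fun x => add_mul a b x) (fun x => mul_add x a b)
  map_mul' a b := ext' (fun x => mul_assoc a b x) (fun x => (mul_assoc x a b).symm)

@[simp] theorem L_incl (a x : A) : (incl a).L x = a * x := rfl
@[simp] theorem R_incl (a x : A) : (incl a).R x = x * a := rfl

theorem incl_injective (hA : NondegenerateAlgebra A) :
    Function.Injective (incl : A → Multiplier A) := by
  intro a b h
  refine sub_eq_zero.1 ((hA (a - b)).1 fun x => ?_)
  rw [sub_mul, sub_eq_zero]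
  simpa using congrArg (fun m : Multiplier A => m.L x) h

open Classical in
/-- The inverse of the inclusion `A ⊆ M(A)`: `retr (incl a) = a` when `A` is non-degenerate.
(A linear extension of it to `M(A)` is chosen; it is used only for multipliers in `A`.) -/
def retr (A : Type*) [NonUnitalRing A] [Module ℂ A] [IsScalarTower ℂ A A]
    [SMulCommClass ℂ A A] : Multiplier A →ₗ[ℂ] A :=
  if h : ∃ f : Multiplier A →ₗ[ℂ] A, ∀ a, f (incl a) = a then h.choose else 0

theorem retr_incl (hA : NondegenerateAlgebra A) (a : A) : retr A (incl a) = a := by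
  have h : ∃ f : Multiplier A →ₗ[ℂ] A, ∀ a, f (incl a) = a := by
    obtain ⟨f, hf⟩ := LinearMap.exists_leftInverse_of_injective
      ((incl : A →ₙₐ[ℂ] Multiplier A) : A →ₗ[ℂ] Multiplier A)
      (LinearMap.ker_eq_bot.2 (incl_injective hA))
    exact ⟨f, fun a => LinearMap.congr_fun hf a⟩
  rw [retr, dif_pos h]
  exact h.choose_spec a

/-- The multiplier `m ⊗ n` of `A ⊗ B`, bilinear in `m ∈ M(A)` and `n ∈ M(B)`. -/
def tmul : Multiplier A →ₗ[ℂ] Multiplier B →ₗ[ℂ] Multiplier (A ⊗[ℂ] B) :=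
  LinearMap.mk₂ ℂ
    (fun m n => mk (TensorProduct.map m.L n.L) (TensorProduct.map m.R n.R) (by
      intro x y
      induction x with
      | zero => simp
      | add x x' hx hx' => simp only [map_add, add_mul, hx, hx']
      | tmul a b =>
        induction y with
        | zero => simp
        | add y y' hy hy' => simp only [map_add, mul_add, hy, hy']
        | tmul c d => simp [balanced]))
    (fun m m' n => ext'
      (fun x => by
        induction x with
        | zero => simp
        | add x x' hx hx' => simp only [map_add, hx, hx']
        | tmul a b => simp [TensorProduct.add_tmul])
      (fun x => by
        induction x with
        | zero => simp
        | add x x' hx hx' => simp only [map_add, hx, hx']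
        | tmul a b => simp [TensorProduct.add_tmul]))
    (fun c m n => ext'
      (fun x => by
        induction x with
        | zero => simp
        | add x x' hx hx' => simp only [map_add, hx, hx']
        | tmul a b => simp [TensorProduct.smul_tmul'])
      (fun x => by
        induction x with
        | zero => simp
        | add x x' hx hx' => simp only [map_add, hx, hx']
        | tmul a b => simp [TensorProduct.smul_tmul']))
    (fun m n n' => ext'
      (fun x => by
        induction x with
        | zero => simp
        | add x x' hx hx' => simp only [map_add, hx, hx']
        | tmul a b => simp [TensorProduct.tmul_add])
      (fun x => by
        induction x with
        | zero => simp
        | add x x' hx hx' => simp only [map_add, hx, hx']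
        | tmul a b => simp [TensorProduct.tmul_add]))
    (fun c m n => ext'
      (fun x => by
        induction x with
        | zero => simp
        | add x x' hx hx' => simp only [map_add, hx, hx']
        | tmul a b => simp)
      (fun x => by
        induction x with
        | zero => simp
        | add x x' hx hx' => simp only [map_add, hx, hx']
        | tmul a b => simp))

@[simp] theorem L_tmul (m : Multiplier A) (n : Multiplier B) :
    (tmul m n).L = TensorProduct.map m.L n.L := rfl
@[simp] theorem R_tmul (m : Multiplier A) (n : Multiplier B) :
    (tmul m n).R = TensorProduct.map m.R n.R := rfl

theorem tmul_mul_tmul (m m' : Multiplier A) (n n' : Multiplier B) :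
    tmul m n * tmul m' n' = tmul (m * m') (n * n') := by
  refine ext' (fun x => ?_) (fun x => ?_)
  · induction x with
    | zero => simp
    | add x y hx hy => rw [map_add, map_add, hx, hy]
    | tmul a b => simp
  · induction x with
    | zero => simp
    | add x y hx hy => rw [map_add, map_add, hx, hy]
    | tmul a b => simp

theorem tmul_incl (a : A) (b : B) : tmul (incl a) (incl b) = incl (a ⊗ₜ[ℂ] b) := by
  refine ext' (fun x => ?_) (fun x => ?_)
  · induction x with
    | zero => simp
    | add x y hx hy => rw [map_add, map_add, hx, hy]
    | tmul a b => simp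
  · induction x with
    | zero => simp
    | add x y hx hy => rw [map_add, map_add, hx, hy]
    | tmul a b => simp

theorem mul_incl (m : Multiplier A) (a : A) (hA : NondegenerateAlgebra A) :
    m * incl a = incl (m.L a) := by
  have key : ∀ x, m.L (a * x) = m.L a * x := by
    intro x
    refine sub_eq_zero.1 ((hA _).2 fun b => ?_)
    rw [mul_sub, sub_eq_zero, ← balanced, ← mul_assoc, ← mul_assoc, balanced]
  refine ext' (fun x => ?_) (fun x => ?_)
  · simpa using key x
  · simp [balanced]

theorem incl_mul (m : Multiplier A) (a : A) (hA : NondegenerateAlgebra A) :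
    incl a * m = incl (m.R a) := by
  have key : ∀ x, m.R (x * a) = x * m.R a := by
    intro x
    refine sub_eq_zero.1 ((hA _).1 fun b => ?_)
    rw [sub_mul, sub_eq_zero, balanced, mul_assoc, mul_assoc, balanced]
  refine ext' (fun x => ?_) (fun x => ?_)
  · simp [balanced]
  · simpa using key x

/-- `a ↦ a ⊗ 1`, from `A` to `M(A ⊗ B)`. -/
def leg₁ (A B : Type*) [NonUnitalRing A] [Module ℂ A] [IsScalarTower ℂ A A] [SMulCommClass ℂ A A]
    [NonUnitalRing B] [Module ℂ B] [IsScalarTower ℂ B B] [SMulCommClass ℂ B B] :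
    A →ₗ[ℂ] Multiplier (A ⊗[ℂ] B) :=
  (tmul.flip (1 : Multiplier B)) ∘ₗ ((incl : A →ₙₐ[ℂ] Multiplier A) : A →ₗ[ℂ] Multiplier A)

/-- `b ↦ 1 ⊗ b`, from `B` to `M(A ⊗ B)`. -/
def leg₂ (A B : Type*) [NonUnitalRing A] [Module ℂ A] [IsScalarTower ℂ A A] [SMulCommClass ℂ A A]
    [NonUnitalRing B] [Module ℂ B] [IsScalarTower ℂ B B] [SMulCommClass ℂ B B] :
    B →ₗ[ℂ] Multiplier (A ⊗[ℂ] B) :=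
  (tmul (1 : Multiplier A)) ∘ₗ ((incl : B →ₙₐ[ℂ] Multiplier B) : B →ₗ[ℂ] Multiplier B)

theorem leg₁_apply (a : A) : leg₁ A B a = tmul (incl a) 1 := rfl
theorem leg₂_apply (b : B) : leg₂ A B b = tmul 1 (incl b) := rfl

/-- Transport of multipliers along an isomorphism of algebras. -/
def transport (e : A ≃ₗ[ℂ] B) (he : ∀ x y, e (x * y) = e x * e y) :
    Multiplier A →ₗ[ℂ] Multiplier B where
  toFun m := mk (e.toLinearMap ∘ₗ m.L ∘ₗ e.symm.toLinearMap)
    (e.toLinearMap ∘ₗ m.R ∘ₗ e.symm.toLinearMap) (by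
      intro x y
      have h := congrArg e (balanced m (e.symm x) (e.symm y))
      rw [he, he] at h
      simpa using h)
  map_add' m n := ext' (fun x => by simp) (fun x => by simp)
  map_smul' c m := ext' (fun x => by simp) (fun x => by simp)

theorem assoc_symm_mul (x y : A ⊗[ℂ] (B ⊗[ℂ] C)) :
    (TensorProduct.assoc ℂ A B C).symm (x * y) =
      (TensorProduct.assoc ℂ A B C).symm x * (TensorProduct.assoc ℂ A B C).symm y := by
  induction x with
  | zero => simp
  | add x x' hx hx' => rw [add_mul, map_add, map_add, add_mul, hx, hx']
  | tmul a t =>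
    induction y with
    | zero => simp
    | add y y' hy hy' => rw [mul_add, map_add, map_add, mul_add, hy, hy']
    | tmul a' t' =>
      induction t with
      | zero => simp
      | add t s ht hs =>
        simp only [TensorProduct.tmul_add, add_mul, map_add, ht, hs]
      | tmul b c =>
        induction t' with
        | zero => simp
        | add t s ht hs => simp only [TensorProduct.tmul_add, mul_add, map_add, ht, hs]
        | tmul b' c' => simp

/-- The identification `M(A ⊗ (B ⊗ C)) = M((A ⊗ B) ⊗ C)`. -/
def assocSymm : Multiplier (A ⊗[ℂ] (B ⊗[ℂ] C)) →ₗ[ℂ] Multiplier ((A ⊗[ℂ] B) ⊗[ℂ] C) :=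
  transport (TensorProduct.assoc ℂ A B C).symm assoc_symm_mul

@[simp] theorem L_assocSymm (m : Multiplier (A ⊗[ℂ] (B ⊗[ℂ] C))) (x) : (assocSymm m).L x =
    (TensorProduct.assoc ℂ A B C).symm (m.L (TensorProduct.assoc ℂ A B C x)) := rfl

@[simp] theorem R_assocSymm (m : Multiplier (A ⊗[ℂ] (B ⊗[ℂ] C))) (x) : (assocSymm m).R x =
    (TensorProduct.assoc ℂ A B C).symm (m.R (TensorProduct.assoc ℂ A B C x)) := rfl

end Multiplier

open Multiplier

/-- A linear map `π : A → M(B)` is non-degenerate when `π(A) B = B` and `B π(A) = B`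
(linear spans of products). -/
def NondegenerateMap (π : A →ₗ[ℂ] Multiplier B) : Prop :=
  Submodule.span ℂ {x | ∃ a b, x = (π a).L b} = ⊤ ∧
  Submodule.span ℂ {x | ∃ a b, x = (π a).R b} = ⊤

/-- `X ∈ M(B)` is the value at `T ∈ M(A)` of the multiplicative extension to `M(A)` of
`π : A → M(B)`, that is `X π(a) = π(T a)` and `π(a) X = π(a T)` for all `a`.  For a non-degenerate
multiplicative `π` there is exactly one such `X`, see `existsUnique_extensionValue`. -/
def IsExtensionValue (π : A →ₗ[ℂ] Multiplier B) (T : Multiplier A) (X : Multiplier B) : Prop :=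
  ∀ a, X * π a = π (T.L a) ∧ π a * X = π (T.R a)

theorem existsUnique_extensionValue (hB : NondegenerateAlgebra B) (π : A →ₗ[ℂ] Multiplier B)
    (hmul : ∀ a a', π (a * a') = π a * π a') (hπ : NondegenerateMap π) (T : Multiplier A) :
    ∃! X, IsExtensionValue π T X := by
  have hL : ∀ {f g : B →ₗ[ℂ] B}, (∀ a b, f ((π a).L b) = g ((π a).L b)) → f = g := by
    intro f g h
    refine LinearMap.ext_on hπ.1 ?_
    rintro _ ⟨a, b, rfl⟩
    exact h a b
  have hR : ∀ {f g : B →ₗ[ℂ] B}, (∀ a b, f ((π a).R b) = g ((π a).R b)) → f = g := by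
    intro f g h
    refine LinearMap.ext_on hπ.2 ?_
    rintro _ ⟨a, b, rfl⟩
    exact h a b
  -- the products `a ⊗ b ↦ π(a) b`, `π(T a) b`, `b π(a)`, `b π(a T)`
  let P : A ⊗[ℂ] B →ₗ[ℂ] B := TensorProduct.lift (LinearMap.mk₂ ℂ (fun a b => (π a).L b)
    (by simp) (by simp) (by simp) (by simp))
  let P' : A ⊗[ℂ] B →ₗ[ℂ] B := TensorProduct.lift (LinearMap.mk₂ ℂ (fun a b => (π a).R b)
    (by simp) (by simp) (by simp) (by simp))
  let Q : A ⊗[ℂ] B →ₗ[ℂ] B := TensorProduct.lift (LinearMap.mk₂ ℂ (fun a b => (π (T.L a)).L b)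
    (by simp) (by simp) (by simp) (by simp))
  let Q' : A ⊗[ℂ] B →ₗ[ℂ] B := TensorProduct.lift (LinearMap.mk₂ ℂ (fun a b => (π (T.R a)).R b)
    (by simp) (by simp) (by simp) (by simp))
  have hP : LinearMap.range P = ⊤ := by
    rw [eq_top_iff, ← hπ.1, Submodule.span_le]
    rintro _ ⟨a, b, rfl⟩
    exact ⟨a ⊗ₜ b, by simp [P]⟩
  have hP' : LinearMap.range P' = ⊤ := by
    rw [eq_top_iff, ← hπ.2, Submodule.span_le]
    rintro _ ⟨a, b, rfl⟩
    exact ⟨a ⊗ₜ b, by simp [P']⟩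
  have hbal : ∀ u v, P' u * Q v = Q' u * P v := by
    intro u v
    induction u with
    | zero => simp
    | add u u' hu hu' => simp only [map_add, add_mul, hu, hu']
    | tmul a c =>
      induction v with
      | zero => simp
      | add v v' hv hv' => simp only [map_add, mul_add, hv, hv']
      | tmul a' b =>
        simp only [P, P', Q, Q', TensorProduct.lift.tmul, LinearMap.mk₂_apply, balanced]
        rw [← L_mul_apply, ← L_mul_apply, ← hmul, ← hmul, balanced]
  obtain ⟨s, hs⟩ := P.exists_rightInverse_of_surjective hP
  obtain ⟨s', hs'⟩ := P'.exists_rightInverse_of_surjective hP'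
  have hs1 : ∀ b, P (s b) = b := fun b => LinearMap.congr_fun hs b
  have hs1' : ∀ b, P' (s' b) = b := fun b => LinearMap.congr_fun hs' b
  have hQ : ∀ v, Q (s (P v)) = Q v := by
    intro v
    refine sub_eq_zero.1 ((hB _).2 fun c => ?_)
    rw [← hs1' c, mul_sub, hbal, hbal, hs1, sub_self]
  have hQ' : ∀ u, Q' (s' (P' u)) = Q' u := by
    intro v
    refine sub_eq_zero.1 ((hB _).1 fun c => ?_)
    rw [← hs1 c, sub_mul, ← hbal, ← hbal, hs1', sub_self]
  let X : Multiplier B := mk (Q ∘ₗ s) (Q' ∘ₗ s') (by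
    intro x y
    have h := hbal (s' x) (s y)
    rw [hs1, hs1'] at h
    exact h.symm)
  have hXL : ∀ a b, X.L ((π a).L b) = (π (T.L a)).L b := by
    intro a b
    have h := hQ (a ⊗ₜ b)
    simp only [P, Q, TensorProduct.lift.tmul, LinearMap.mk₂_apply] at h
    exact h
  have hXR : ∀ a b, X.R ((π a).R b) = (π (T.R a)).R b := by
    intro a b
    have h := hQ' (a ⊗ₜ b)
    simp only [P', Q', TensorProduct.lift.tmul, LinearMap.mk₂_apply] at h
    exact h
  refine ⟨X, fun a => ⟨ext' (hXL a) fun c => ?_, ext' (fun b => ?_) (hXR a)⟩, fun Y hY => ?_⟩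
  · refine sub_eq_zero.1 ((hB _).1 fun b => ?_)
    rw [sub_mul, balanced, balanced, L_mul_apply, hXL, sub_self]
  · refine sub_eq_zero.1 ((hB _).2 fun c => ?_)
    rw [mul_sub, ← balanced, ← balanced, R_mul_apply, hXR, sub_self]
  · refine ext' (LinearMap.congr_fun (hL fun a b => ?_)) (LinearMap.congr_fun (hR fun a b => ?_))
    · rw [hXL, ← L_mul_apply, (hY a).1]
    · rw [hXR, ← R_mul_apply, (hY a).2]

/-- The extension to `M(A)` of a non-zero multiplicative linear functional `χ` on `A`:
the value at `m` is `χ(m e)` for any `e` with `χ(e) = 1`. -/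
def extendChar (χ : A →ₙₐ[ℂ] ℂ) (hχ : ∃ e, χ e = 1) : Multiplier A →ₐ[ℂ] ℂ :=
  have h : ∀ (m : Multiplier A) a, χ (m.L a) = χ (m.L hχ.choose) * χ a := by
    intro m a
    have he := hχ.choose_spec
    have h1 : ∀ b, χ (m.L b) = χ (m.R hχ.choose) * χ b := fun b => by
      rw [← map_mul, balanced, map_mul, he, one_mul]
    rw [h1 a, h1 hχ.choose, he, mul_one]
  AlgHom.ofLinearMap
    { toFun := fun m => χ (m.L hχ.choose)
      map_add' := fun m n => by simp
      map_smul' := fun c m => by simp }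
    (by simpa using hχ.choose_spec)
    (fun m n => h m _)

theorem extendChar_mul_apply (χ : A →ₙₐ[ℂ] ℂ) (hχ : ∃ e, χ e = 1) (m : Multiplier A) (a : A) :
    χ (m.L a) = extendChar χ hχ m * χ a ∧ χ (m.R a) = χ a * extendChar χ hχ m := by
  have he := hχ.choose_spec
  have h1 : ∀ a b, χ (m.R a) * χ b = χ a * χ (m.L b) := fun a b => by
    rw [← map_mul, balanced, map_mul]
  have h2 : χ (m.R a) = χ a * χ (m.L hχ.choose) := by rw [← h1, he, mul_one]
  have h3 : χ (m.R hχ.choose) = χ (m.L hχ.choose) := by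
    have := h1 hχ.choose hχ.choose
    rwa [he, mul_one, one_mul] at this
  refine ⟨?_, h2⟩
  change _ = χ (m.L hχ.choose) * χ a
  rw [← h3, h1, he, one_mul]

/-- The extension to `M(A)` of an anti-automorphism `S` of `A`; it is determined by
`S(m) S(a) = S(a m)` and `S(a) S(m) = S(m a)`. -/
def extendAnti (S : A ≃ₗ[ℂ] A) (hS : ∀ a b, S (a * b) = S b * S a) :
    Multiplier A ≃ₗ[ℂ] Multiplier A :=
  have hS' : ∀ a b, S.symm (a * b) = S.symm b * S.symm a := fun a b => by
    apply S.injective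
    simp [hS]
  { toFun := fun m => mk (S.toLinearMap ∘ₗ m.R ∘ₗ S.symm.toLinearMap)
      (S.toLinearMap ∘ₗ m.L ∘ₗ S.symm.toLinearMap) (by
        intro x y
        have h := congrArg S (balanced m (S.symm y) (S.symm x))
        rw [hS, hS] at h
        simpa using h.symm)
    invFun := fun m => mk (S.symm.toLinearMap ∘ₗ m.R ∘ₗ S.toLinearMap)
      (S.symm.toLinearMap ∘ₗ m.L ∘ₗ S.toLinearMap) (by
        intro x y
        have h := congrArg S.symm (balanced m (S y) (S x))
        rw [hS', hS'] at h
        simpa using h.symm)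
    map_add' := fun m n => ext' (fun x => by simp) (fun x => by simp)
    map_smul' := fun c m => ext' (fun x => by simp) (fun x => by simp)
    left_inv := fun m => ext' (fun x => by simp) (fun x => by simp)
    right_inv := fun m => ext' (fun x => by simp) (fun x => by simp) }

/-- The slice map `ω ⊗ ι : A ⊗ B → B`. -/
def sliceFst (ω : Module.Dual ℂ A) : A ⊗[ℂ] B →ₗ[ℂ] B :=
  (TensorProduct.lid ℂ B).toLinearMap ∘ₗ LinearMap.rTensor B ω

/-- The slice map `ι ⊗ ω : A ⊗ B → A`. -/
def sliceSnd (ω : Module.Dual ℂ B) : A ⊗[ℂ] B →ₗ[ℂ] A :=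
  (TensorProduct.rid ℂ A).toLinearMap ∘ₗ LinearMap.lTensor A ω

@[simp] theorem sliceFst_tmul (ω : Module.Dual ℂ A) (a : A) (b : B) :
    sliceFst ω (a ⊗ₜ[ℂ] b) = ω a • b := by simp [sliceFst]

@[simp] theorem sliceSnd_tmul (ω : Module.Dual ℂ B) (a : A) (b : B) :
    sliceSnd ω (a ⊗ₜ[ℂ] b) = ω b • a := by simp [sliceSnd]

theorem tensor_eq_zero_of_left (hA : NondegenerateAlgebra A) (t : A ⊗[ℂ] B)
    (h : ∀ x, TensorProduct.map (LinearMap.mulRight ℂ x) (LinearMap.id : B →ₗ[ℂ] B) t = 0) :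
    t = 0 := by
  classical
  let b := Module.Basis.ofVectorSpace ℂ B
  let e := TensorProduct.equivFinsuppOfBasisRight (M := A) b
  have key : ∀ (x : A) (s : A ⊗[ℂ] B) i,
      e (TensorProduct.map (LinearMap.mulRight ℂ x) LinearMap.id s) i = e s i * x := by
    intro x s i
    induction s with
    | zero => simp
    | add s s' hs hs' => simp only [map_add, Finsupp.add_apply, hs, hs', add_mul]
    | tmul a c =>
      simp [e, smul_mul_assoc]
  apply e.injective
  ext i
  rw [map_zero]
  refine (hA _).1 fun x => ?_
  rw [← key, h, map_zero, Finsupp.zero_apply]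

theorem tensor_eq_zero_of_left' (hA : NondegenerateAlgebra A) (t : A ⊗[ℂ] B)
    (h : ∀ x, TensorProduct.map (LinearMap.mulLeft ℂ x) (LinearMap.id : B →ₗ[ℂ] B) t = 0) :
    t = 0 := by
  classical
  let b := Module.Basis.ofVectorSpace ℂ B
  let e := TensorProduct.equivFinsuppOfBasisRight (M := A) b
  have key : ∀ (x : A) (s : A ⊗[ℂ] B) i,
      e (TensorProduct.map (LinearMap.mulLeft ℂ x) LinearMap.id s) i = x * e s i := by
    intro x s i
    induction s with
    | zero => simp
    | add s s' hs hs' => simp only [map_add, Finsupp.add_apply, hs, hs', mul_add]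
    | tmul a c =>
      simp [e, mul_smul_comm]
  apply e.injective
  ext i
  rw [map_zero]
  refine (hA _).2 fun x => ?_
  rw [← key, h, map_zero, Finsupp.zero_apply]

theorem map_id_comm (f : B →ₗ[ℂ] B) (t : A ⊗[ℂ] B) :
    TensorProduct.map f LinearMap.id (TensorProduct.comm ℂ A B t) =
      TensorProduct.comm ℂ A B (TensorProduct.map LinearMap.id f t) := by
  induction t with
  | zero => simp
  | add s s' hs hs' => simp only [map_add, hs, hs']
  | tmul a c => simp

theorem NondegenerateAlgebra.tensor (hA : NondegenerateAlgebra A) (hB : NondegenerateAlgebra B) :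
    NondegenerateAlgebra (A ⊗[ℂ] B) := by
  intro t
  constructor
  · intro h
    refine tensor_eq_zero_of_left hA t fun x => ?_
    apply (TensorProduct.comm ℂ A B).injective
    rw [map_zero]
    refine tensor_eq_zero_of_left hB _ fun y => ?_
    rw [map_id_comm, ← LinearMap.comp_apply (TensorProduct.map _ _), ← TensorProduct.map_comp]
    have key : ∀ s : A ⊗[ℂ] B, TensorProduct.map (LinearMap.id ∘ₗ LinearMap.mulRight ℂ x)
        (LinearMap.mulRight ℂ y ∘ₗ LinearMap.id) s = s * x ⊗ₜ y := by
      intro s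
      induction s with
      | zero => simp
      | add s s' hs hs' => simp only [map_add, add_mul, hs, hs']
      | tmul a c => simp
    rw [key, h, map_zero]
  · intro h
    refine tensor_eq_zero_of_left' hA t fun x => ?_
    apply (TensorProduct.comm ℂ A B).injective
    rw [map_zero]
    refine tensor_eq_zero_of_left' hB _ fun y => ?_
    rw [map_id_comm, ← LinearMap.comp_apply (TensorProduct.map _ _), ← TensorProduct.map_comp]
    have key : ∀ s : A ⊗[ℂ] B, TensorProduct.map (LinearMap.id ∘ₗ LinearMap.mulLeft ℂ x)
        (LinearMap.mulLeft ℂ y ∘ₗ LinearMap.id) s = x ⊗ₜ y * s := by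
      intro s
      induction s with
      | zero => simp
      | add s s' hs hs' => simp only [map_add, mul_add, hs, hs']
      | tmul a c => simp
    rw [key, h, map_zero]

/-! ### Comultiplications, counits and antipodes -/

/-- `Δ ⊗ ι : A ⊗ A → M(A ⊗ A ⊗ A)`. -/
def comulFst (Δ : A →ₙₐ[ℂ] Multiplier (A ⊗[ℂ] A)) :
    A ⊗[ℂ] A →ₗ[ℂ] Multiplier ((A ⊗[ℂ] A) ⊗[ℂ] A) :=
  TensorProduct.lift (tmul.compl₁₂ (Δ : A →ₗ[ℂ] Multiplier (A ⊗[ℂ] A))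
    ((incl : A →ₙₐ[ℂ] Multiplier A) : A →ₗ[ℂ] Multiplier A))

/-- `ι ⊗ Δ : A ⊗ A → M(A ⊗ A ⊗ A)`. -/
def comulSnd (Δ : A →ₙₐ[ℂ] Multiplier (A ⊗[ℂ] A)) :
    A ⊗[ℂ] A →ₗ[ℂ] Multiplier ((A ⊗[ℂ] A) ⊗[ℂ] A) :=
  assocSymm ∘ₗ TensorProduct.lift (tmul.compl₁₂
    ((incl : A →ₙₐ[ℂ] Multiplier A) : A →ₗ[ℂ] Multiplier A)
    (Δ : A →ₗ[ℂ] Multiplier (A ⊗[ℂ] A)))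

/-- `T₁(a ⊗ b) = Δ(a)(b ⊗ 1)`. -/
def T₁ (Δ : A →ₙₐ[ℂ] Multiplier (A ⊗[ℂ] A)) : A ⊗[ℂ] A →ₗ[ℂ] Multiplier (A ⊗[ℂ] A) :=
  TensorProduct.lift ((LinearMap.mul ℂ (Multiplier (A ⊗[ℂ] A))).compl₁₂
    (Δ : A →ₗ[ℂ] Multiplier (A ⊗[ℂ] A)) (leg₁ A A))

/-- `T₂(a ⊗ b) = Δ(a)(1 ⊗ b)`. -/
def T₂ (Δ : A →ₙₐ[ℂ] Multiplier (A ⊗[ℂ] A)) : A ⊗[ℂ] A →ₗ[ℂ] Multiplier (A ⊗[ℂ] A) :=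
  TensorProduct.lift ((LinearMap.mul ℂ (Multiplier (A ⊗[ℂ] A))).compl₁₂
    (Δ : A →ₗ[ℂ] Multiplier (A ⊗[ℂ] A)) (leg₂ A A))

/-- `T₃(a ⊗ b) = (b ⊗ 1)Δ(a)`. -/
def T₃ (Δ : A →ₙₐ[ℂ] Multiplier (A ⊗[ℂ] A)) : A ⊗[ℂ] A →ₗ[ℂ] Multiplier (A ⊗[ℂ] A) :=
  TensorProduct.lift ((LinearMap.mul ℂ (Multiplier (A ⊗[ℂ] A))).flip.compl₁₂
    (Δ : A →ₗ[ℂ] Multiplier (A ⊗[ℂ] A)) (leg₁ A A))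

/-- `T₄(a ⊗ b) = (1 ⊗ b)Δ(a)`. -/
def T₄ (Δ : A →ₙₐ[ℂ] Multiplier (A ⊗[ℂ] A)) : A ⊗[ℂ] A →ₗ[ℂ] Multiplier (A ⊗[ℂ] A) :=
  TensorProduct.lift ((LinearMap.mul ℂ (Multiplier (A ⊗[ℂ] A))).flip.compl₁₂
    (Δ : A →ₗ[ℂ] Multiplier (A ⊗[ℂ] A)) (leg₂ A A))

@[simp] theorem T₁_tmul (Δ : A →ₙₐ[ℂ] Multiplier (A ⊗[ℂ] A)) (a b : A) :
    T₁ Δ (a ⊗ₜ b) = Δ a * leg₁ A A b := rfl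
@[simp] theorem T₂_tmul (Δ : A →ₙₐ[ℂ] Multiplier (A ⊗[ℂ] A)) (a b : A) :
    T₂ Δ (a ⊗ₜ b) = Δ a * leg₂ A A b := rfl
@[simp] theorem T₃_tmul (Δ : A →ₙₐ[ℂ] Multiplier (A ⊗[ℂ] A)) (a b : A) :
    T₃ Δ (a ⊗ₜ b) = leg₁ A A b * Δ a := rfl
@[simp] theorem T₄_tmul (Δ : A →ₙₐ[ℂ] Multiplier (A ⊗[ℂ] A)) (a b : A) :
    T₄ Δ (a ⊗ₜ b) = leg₂ A A b * Δ a := rfl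

/-- `ε` is a counit for `Δ`: a non-zero homomorphism to `ℂ` with
`(ε ⊗ ι)Δ = ι = (ι ⊗ ε)Δ`, where the slice homomorphisms `A ⊗ A → A ⊆ M(A)` are extended to
`M(A ⊗ A)`. -/
structure IsCounit (Δ : A →ₙₐ[ℂ] Multiplier (A ⊗[ℂ] A)) (ε : A →ₙₐ[ℂ] ℂ) : Prop where
  ne_zero : ε ≠ 0
  left : ∀ a, IsExtensionValue
    (((incl : A →ₙₐ[ℂ] Multiplier A) : A →ₗ[ℂ] Multiplier A) ∘ₗ sliceFst (ε : A →ₗ[ℂ] ℂ))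
    (Δ a) (incl a)
  right : ∀ a, IsExtensionValue
    (((incl : A →ₙₐ[ℂ] Multiplier A) : A →ₗ[ℂ] Multiplier A) ∘ₗ sliceSnd (ε : A →ₗ[ℂ] ℂ))
    (Δ a) (incl a)

theorem IsCounit.exists_eq_one {Δ : A →ₙₐ[ℂ] Multiplier (A ⊗[ℂ] A)} {ε : A →ₙₐ[ℂ] ℂ}
    (h : IsCounit Δ ε) : ∃ e, ε e = 1 := by
  by_contra hne
  apply h.ne_zero
  ext a
  by_contra ha
  exact hne ⟨(ε a)⁻¹ • a, by rw [map_smul, smul_eq_mul, inv_mul_cancel₀ ha]⟩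

/-- `S` is an antipode for `Δ` with counit `ε`: an anti-automorphism of `A` with
`m(S ⊗ ι)(Δ(a)(1 ⊗ b)) = ε(a) b` and `m(ι ⊗ S)((b ⊗ 1)Δ(a)) = ε(a) b`. -/
structure IsAntipode (Δ : A →ₙₐ[ℂ] Multiplier (A ⊗[ℂ] A)) (ε : A →ₙₐ[ℂ] ℂ) (S : A ≃ₗ[ℂ] A) :
    Prop where
  anti_mul : ∀ a b, S (a * b) = S b * S a
  left : ∀ a b, ∃ t : A ⊗[ℂ] A, incl t = Δ a * leg₂ A A b ∧
    LinearMap.mul' ℂ A (TensorProduct.map S.toLinearMap LinearMap.id t) = ε a • b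
  right : ∀ a b, ∃ t : A ⊗[ℂ] A, incl t = leg₁ A A b * Δ a ∧
    LinearMap.mul' ℂ A (TensorProduct.map LinearMap.id S.toLinearMap t) = ε a • b

end Multipliers

open Multiplier

/-- A regular multiplier Hopf algebra structure on the algebra `A`. In `coassoc`, `X` is the common
value at `Δ(a)` of the extensions of `Δ ⊗ ι` and `ι ⊗ Δ` to `M(A ⊗ A)`. -/
structure RegularMultiplierHopfAlgebra (A : Type*) [NonUnitalRing A] [Module ℂ A]
    [IsScalarTower ℂ A A] [SMulCommClass ℂ A A] where
  nondegenerate : NondegenerateAlgebra A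
  Δ : A →ₙₐ[ℂ] Multiplier (A ⊗[ℂ] A)
  nondegenerate_Δ : NondegenerateMap (Δ : A →ₗ[ℂ] Multiplier (A ⊗[ℂ] A))
  coassoc : ∀ a, ∃ X, IsExtensionValue (comulFst Δ) (Δ a) X ∧
    IsExtensionValue (comulSnd Δ) (Δ a) X
  bijOn_T₁ : Set.BijOn (T₁ Δ) Set.univ (Set.range (Multiplier.incl (A := A ⊗[ℂ] A)))
  bijOn_T₂ : Set.BijOn (T₂ Δ) Set.univ (Set.range (Multiplier.incl (A := A ⊗[ℂ] A)))
  bijOn_T₃ : Set.BijOn (T₃ Δ) Set.univ (Set.range (Multiplier.incl (A := A ⊗[ℂ] A)))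
  bijOn_T₄ : Set.BijOn (T₄ Δ) Set.univ (Set.range (Multiplier.incl (A := A ⊗[ℂ] A)))

namespace RegularMultiplierHopfAlgebra

variable {A : Type*} [NonUnitalRing A] [Module ℂ A] [IsScalarTower ℂ A A] [SMulCommClass ℂ A A]
variable (H : RegularMultiplierHopfAlgebra A)

theorem nondeg₂ (H : RegularMultiplierHopfAlgebra A) :
    NondegenerateAlgebra (A ⊗[ℂ] A) := H.nondegenerate.tensor H.nondegenerate

/-- `Δ(a)(b ⊗ 1)` as an element of `A ⊗ A`, linear in `a ⊗ b`; similarly below. -/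
def E₁ : A ⊗[ℂ] A →ₗ[ℂ] A ⊗[ℂ] A := retr (A ⊗[ℂ] A) ∘ₗ T₁ H.Δ
/-- `Δ(a)(1 ⊗ b)` as an element of `A ⊗ A`. -/
def E₂ : A ⊗[ℂ] A →ₗ[ℂ] A ⊗[ℂ] A := retr (A ⊗[ℂ] A) ∘ₗ T₂ H.Δ
/-- `(b ⊗ 1)Δ(a)` as an element of `A ⊗ A`. -/
def E₃ : A ⊗[ℂ] A →ₗ[ℂ] A ⊗[ℂ] A := retr (A ⊗[ℂ] A) ∘ₗ T₃ H.Δ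
/-- `(1 ⊗ b)Δ(a)` as an element of `A ⊗ A`. -/
def E₄ : A ⊗[ℂ] A →ₗ[ℂ] A ⊗[ℂ] A := retr (A ⊗[ℂ] A) ∘ₗ T₄ H.Δ

theorem incl_E₁ (t : A ⊗[ℂ] A) : incl (H.E₁ t) = T₁ H.Δ t := by
  obtain ⟨s, hs⟩ := H.bijOn_T₁.mapsTo (Set.mem_univ t)
  rw [E₁, LinearMap.comp_apply, ← hs, retr_incl H.nondeg₂]
theorem incl_E₂ (t : A ⊗[ℂ] A) : incl (H.E₂ t) = T₂ H.Δ t := by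
  obtain ⟨s, hs⟩ := H.bijOn_T₂.mapsTo (Set.mem_univ t)
  rw [E₂, LinearMap.comp_apply, ← hs, retr_incl H.nondeg₂]
theorem incl_E₃ (t : A ⊗[ℂ] A) : incl (H.E₃ t) = T₃ H.Δ t := by
  obtain ⟨s, hs⟩ := H.bijOn_T₃.mapsTo (Set.mem_univ t)
  rw [E₃, LinearMap.comp_apply, ← hs, retr_incl H.nondeg₂]
theorem incl_E₄ (t : A ⊗[ℂ] A) : incl (H.E₄ t) = T₄ H.Δ t := by
  obtain ⟨s, hs⟩ := H.bijOn_T₄.mapsTo (Set.mem_univ t)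
  rw [E₄, LinearMap.comp_apply, ← hs, retr_incl H.nondeg₂]

theorem E₃_surjective : Function.Surjective H.E₃ := by
  intro s
  obtain ⟨t, -, ht⟩ := H.bijOn_T₃.surjOn ⟨s, rfl⟩
  exact ⟨t, incl_injective H.nondeg₂ (by rw [incl_E₃, ht])⟩

theorem sliceFst_R_leg₂ (ω : Module.Dual ℂ A) (t : A ⊗[ℂ] A) (y : A) :
    sliceFst ω ((leg₂ A A y).R t) = sliceFst ω t * y := by
  rw [leg₂_apply, R_tmul]
  induction t with
  | zero => simp
  | add s s' hs hs' => simp only [map_add, add_mul, hs, hs']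
  | tmul a c => simp [smul_mul_assoc]

theorem sliceFst_L_leg₂ (ω : Module.Dual ℂ A) (t : A ⊗[ℂ] A) (y : A) :
    sliceFst ω ((leg₂ A A y).L t) = y * sliceFst ω t := by
  rw [leg₂_apply, L_tmul]
  induction t with
  | zero => simp
  | add s s' hs hs' => simp only [map_add, mul_add, hs, hs']
  | tmul a c => simp [mul_smul_comm]

theorem sliceSnd_R_leg₁ (ω : Module.Dual ℂ A) (t : A ⊗[ℂ] A) (y : A) :
    sliceSnd ω ((leg₁ A A y).R t) = sliceSnd ω t * y := by
  rw [leg₁_apply, R_tmul]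
  induction t with
  | zero => simp
  | add s s' hs hs' => simp only [map_add, add_mul, hs, hs']
  | tmul a c => simp [smul_mul_assoc]

theorem sliceSnd_L_leg₁ (ω : Module.Dual ℂ A) (t : A ⊗[ℂ] A) (y : A) :
    sliceSnd ω ((leg₁ A A y).L t) = y * sliceSnd ω t := by
  rw [leg₁_apply, L_tmul]
  induction t with
  | zero => simp
  | add s s' hs hs' => simp only [map_add, mul_add, hs, hs']
  | tmul a c => simp [mul_smul_comm]

/-- The multiplier `(ω ⊗ ι)Δ(a)` of `A`:
`[(ω ⊗ ι)Δ(a)] b = (ω ⊗ ι)(Δ(a)(1 ⊗ b))` and `b [(ω ⊗ ι)Δ(a)] = (ω ⊗ ι)((1 ⊗ b)Δ(a))`. -/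
def leftSlice (ω : Module.Dual ℂ A) : A →ₗ[ℂ] Multiplier A where
  toFun a := Multiplier.mk (sliceFst ω ∘ₗ H.E₂ ∘ₗ TensorProduct.mk ℂ A A a)
    (sliceFst ω ∘ₗ H.E₄ ∘ₗ TensorProduct.mk ℂ A A a) (by
      intro x y
      simp only [LinearMap.comp_apply, TensorProduct.mk_apply]
      rw [← sliceFst_R_leg₂, ← sliceFst_L_leg₂]
      congr 1
      apply incl_injective H.nondeg₂
      rw [← incl_mul _ _ H.nondeg₂, ← mul_incl _ _ H.nondeg₂, incl_E₂, incl_E₄, T₂_tmul, T₄_tmul,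
        mul_assoc])
  map_add' a b := ext' (fun x => by simp) (fun x => by simp)
  map_smul' c a := ext' (fun x => by simp) (fun x => by simp)

/-- The multiplier `(ι ⊗ ω)Δ(a)` of `A`:
`[(ι ⊗ ω)Δ(a)] b = (ι ⊗ ω)(Δ(a)(b ⊗ 1))` and `b [(ι ⊗ ω)Δ(a)] = (ι ⊗ ω)((b ⊗ 1)Δ(a))`. -/
def rightSlice (ω : Module.Dual ℂ A) : A →ₗ[ℂ] Multiplier A where
  toFun a := Multiplier.mk (sliceSnd ω ∘ₗ H.E₁ ∘ₗ TensorProduct.mk ℂ A A a)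
    (sliceSnd ω ∘ₗ H.E₃ ∘ₗ TensorProduct.mk ℂ A A a) (by
      intro x y
      simp only [LinearMap.comp_apply, TensorProduct.mk_apply]
      rw [← sliceSnd_R_leg₁, ← sliceSnd_L_leg₁]
      congr 1
      apply incl_injective H.nondeg₂
      rw [← incl_mul _ _ H.nondeg₂, ← mul_incl _ _ H.nondeg₂, incl_E₁, incl_E₃, T₁_tmul, T₃_tmul,
        mul_assoc])
  map_add' a b := ext' (fun x => by simp) (fun x => by simp)
  map_smul' c a := ext' (fun x => by simp) (fun x => by simp)

/-- All the multipliers `(θ ⊗ ι)Δ(a)` and `(ι ⊗ θ)Δ(a)` lie in `A`. -/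
def SlicesInAlgebra (θ : Module.Dual ℂ A) : Prop :=
  ∀ a, H.leftSlice θ a ∈ Set.range (incl (A := A)) ∧
    H.rightSlice θ a ∈ Set.range (incl (A := A))

/-- `a ↦ (θ ⊗ ι)Δ(a) ∈ A`, for `θ` whose slices lie in `A`. -/
def leftConv (θ : Module.Dual ℂ A) : A →ₗ[ℂ] A := retr A ∘ₗ H.leftSlice θ

/-- `a ↦ (ι ⊗ θ)Δ(a) ∈ A`, for `θ` whose slices lie in `A`. -/
def rightConv (θ : Module.Dual ℂ A) : A →ₗ[ℂ] A := retr A ∘ₗ H.rightSlice θ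

end RegularMultiplierHopfAlgebra

section Translates

variable {A : Type*} [NonUnitalRing A] [Module ℂ A] [IsScalarTower ℂ A A] [SMulCommClass ℂ A A]

/-- `rightTranslate ω a` is the functional `ω a : x ↦ ω(a x)`. -/
def rightTranslate (ω : Module.Dual ℂ A) : A →ₗ[ℂ] Module.Dual ℂ A := (LinearMap.mul ℂ A).compr₂ ω

/-- `leftTranslate ω a` is the functional `a ω : x ↦ ω(x a)`. -/
def leftTranslate (ω : Module.Dual ℂ A) : A →ₗ[ℂ] Module.Dual ℂ A :=
  (LinearMap.mul ℂ A).flip.compr₂ ω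

@[simp] theorem rightTranslate_apply (ω : Module.Dual ℂ A) (a x : A) :
    rightTranslate ω a x = ω (a * x) := rfl

@[simp] theorem leftTranslate_apply (ω : Module.Dual ℂ A) (a x : A) :
    leftTranslate ω a x = ω (x * a) := rfl

theorem sliceFst_rightTranslate (ω : Module.Dual ℂ A) (a : A) (t : A ⊗[ℂ] A) :
    sliceFst (rightTranslate ω a) t = sliceFst ω ((leg₁ A A a).L t) := by
  rw [leg₁_apply, L_tmul]
  induction t with
  | zero => simp
  | add s s' hs hs' => simp only [map_add, hs, hs']
  | tmul x y => simp

theorem sliceSnd_rightTranslate (ω : Module.Dual ℂ A) (a : A) (t : A ⊗[ℂ] A) :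
    sliceSnd (rightTranslate ω a) t = sliceSnd ω ((leg₂ A A a).L t) := by
  rw [leg₂_apply, L_tmul]
  induction t with
  | zero => simp
  | add s s' hs hs' => simp only [map_add, hs, hs']
  | tmul x y => simp

theorem sliceFst_leftTranslate (ω : Module.Dual ℂ A) (a : A) (t : A ⊗[ℂ] A) :
    sliceFst (leftTranslate ω a) t = sliceFst ω ((leg₁ A A a).R t) := by
  rw [leg₁_apply, R_tmul]
  induction t with
  | zero => simp
  | add s s' hs hs' => simp only [map_add, hs, hs']
  | tmul x y => simp

theorem sliceSnd_leftTranslate (ω : Module.Dual ℂ A) (a : A) (t : A ⊗[ℂ] A) :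
    sliceSnd (leftTranslate ω a) t = sliceSnd ω ((leg₂ A A a).R t) := by
  rw [leg₂_apply, R_tmul]
  induction t with
  | zero => simp
  | add s s' hs hs' => simp only [map_add, hs, hs']
  | tmul x y => simp

theorem leg₁_mul_leg₂ (a b : A) : leg₁ A A a * leg₂ A A b = incl (a ⊗ₜ[ℂ] b) := by
  rw [leg₁_apply, leg₂_apply, tmul_mul_tmul, mul_one, one_mul, tmul_incl]

theorem leg₂_mul_leg₁ (a b : A) : leg₂ A A b * leg₁ A A a = incl (a ⊗ₜ[ℂ] b) := by
  rw [leg₁_apply, leg₂_apply, tmul_mul_tmul, mul_one, one_mul, tmul_incl]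

end Translates

namespace RegularMultiplierHopfAlgebra

variable {A : Type*} [NonUnitalRing A] [Module ℂ A] [IsScalarTower ℂ A A] [SMulCommClass ℂ A A]
variable (H : RegularMultiplierHopfAlgebra A)

theorem rightSlice_rightTranslate (ω : Module.Dual ℂ A) (a x : A) :
    H.rightSlice (rightTranslate ω a) x = incl (sliceSnd ω (H.E₄ (x ⊗ₜ a))) := by
  have hN := H.nondeg₂
  refine ext' (fun b => ?_) (fun b => ?_)
  · change sliceSnd _ (H.E₁ (x ⊗ₜ b)) = sliceSnd ω (H.E₄ (x ⊗ₜ a)) * b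
    rw [sliceSnd_rightTranslate, ← sliceSnd_R_leg₁]
    congr 1
    apply incl_injective hN
    rw [← mul_incl _ _ hN, ← incl_mul _ _ hN, incl_E₁, incl_E₄, T₁_tmul, T₄_tmul, mul_assoc]
  · change sliceSnd _ (H.E₃ (x ⊗ₜ b)) = b * sliceSnd ω (H.E₄ (x ⊗ₜ a))
    rw [sliceSnd_rightTranslate, ← sliceSnd_L_leg₁]
    congr 1
    apply incl_injective hN
    rw [← mul_incl _ _ hN, ← mul_incl _ _ hN, incl_E₃, incl_E₄, T₃_tmul, T₄_tmul, ← mul_assoc,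
      ← mul_assoc, leg₁_mul_leg₂, leg₂_mul_leg₁]

theorem leftSlice_rightTranslate (ω : Module.Dual ℂ A) (a x : A) :
    H.leftSlice (rightTranslate ω a) x = incl (sliceFst ω (H.E₃ (x ⊗ₜ a))) := by
  have hN := H.nondeg₂
  refine ext' (fun b => ?_) (fun b => ?_)
  · change sliceFst _ (H.E₂ (x ⊗ₜ b)) = sliceFst ω (H.E₃ (x ⊗ₜ a)) * b
    rw [sliceFst_rightTranslate, ← sliceFst_R_leg₂]
    congr 1
    apply incl_injective hN
    rw [← mul_incl _ _ hN, ← incl_mul _ _ hN, incl_E₂, incl_E₃, T₂_tmul, T₃_tmul, mul_assoc]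
  · change sliceFst _ (H.E₄ (x ⊗ₜ b)) = b * sliceFst ω (H.E₃ (x ⊗ₜ a))
    rw [sliceFst_rightTranslate, ← sliceFst_L_leg₂]
    congr 1
    apply incl_injective hN
    rw [← mul_incl _ _ hN, ← mul_incl _ _ hN, incl_E₃, incl_E₄, T₃_tmul, T₄_tmul, ← mul_assoc,
      ← mul_assoc, leg₁_mul_leg₂, leg₂_mul_leg₁]

theorem rightSlice_leftTranslate (ω : Module.Dual ℂ A) (a x : A) :
    H.rightSlice (leftTranslate ω a) x = incl (sliceSnd ω (H.E₂ (x ⊗ₜ a))) := by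
  have hN := H.nondeg₂
  refine ext' (fun b => ?_) (fun b => ?_)
  · change sliceSnd _ (H.E₁ (x ⊗ₜ b)) = sliceSnd ω (H.E₂ (x ⊗ₜ a)) * b
    rw [sliceSnd_leftTranslate, ← sliceSnd_R_leg₁]
    congr 1
    apply incl_injective hN
    rw [← incl_mul _ _ hN, ← incl_mul _ _ hN, incl_E₁, incl_E₂, T₁_tmul, T₂_tmul, mul_assoc,
      mul_assoc, leg₁_mul_leg₂, leg₂_mul_leg₁]
  · change sliceSnd _ (H.E₃ (x ⊗ₜ b)) = b * sliceSnd ω (H.E₂ (x ⊗ₜ a))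
    rw [sliceSnd_leftTranslate, ← sliceSnd_L_leg₁]
    congr 1
    apply incl_injective hN
    rw [← incl_mul _ _ hN, ← mul_incl _ _ hN, incl_E₃, incl_E₂, T₃_tmul, T₂_tmul, mul_assoc]

theorem leftSlice_leftTranslate (ω : Module.Dual ℂ A) (a x : A) :
    H.leftSlice (leftTranslate ω a) x = incl (sliceFst ω (H.E₁ (x ⊗ₜ a))) := by
  have hN := H.nondeg₂
  refine ext' (fun b => ?_) (fun b => ?_)
  · change sliceFst _ (H.E₂ (x ⊗ₜ b)) = sliceFst ω (H.E₁ (x ⊗ₜ a)) * b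
    rw [sliceFst_leftTranslate, ← sliceFst_R_leg₂]
    congr 1
    apply incl_injective hN
    rw [← incl_mul _ _ hN, ← incl_mul _ _ hN, incl_E₁, incl_E₂, T₁_tmul, T₂_tmul, mul_assoc,
      mul_assoc, leg₁_mul_leg₂, leg₂_mul_leg₁]
  · change sliceFst _ (H.E₄ (x ⊗ₜ b)) = b * sliceFst ω (H.E₁ (x ⊗ₜ a))
    rw [sliceFst_leftTranslate, ← sliceFst_L_leg₂]
    congr 1
    apply incl_injective hN
    rw [← incl_mul _ _ hN, ← mul_incl _ _ hN, incl_E₁, incl_E₄, T₁_tmul, T₄_tmul, mul_assoc]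

theorem slicesInAlgebra_rightTranslate (ω : Module.Dual ℂ A) (a : A) :
    H.SlicesInAlgebra (rightTranslate ω a) := fun x =>
  ⟨⟨_, (H.leftSlice_rightTranslate ω a x).symm⟩, ⟨_, (H.rightSlice_rightTranslate ω a x).symm⟩⟩

theorem slicesInAlgebra_leftTranslate (ω : Module.Dual ℂ A) (a : A) :
    H.SlicesInAlgebra (leftTranslate ω a) := fun x =>
  ⟨⟨_, (H.leftSlice_leftTranslate ω a x).symm⟩, ⟨_, (H.rightSlice_leftTranslate ω a x).symm⟩⟩

theorem rightConv_rightTranslate (ω : Module.Dual ℂ A) (a x : A) :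
    H.rightConv (rightTranslate ω a) x = sliceSnd ω (H.E₄ (x ⊗ₜ a)) := by
  rw [rightConv, LinearMap.comp_apply, rightSlice_rightTranslate, retr_incl H.nondegenerate]

theorem leftConv_rightTranslate (ω : Module.Dual ℂ A) (a x : A) :
    H.leftConv (rightTranslate ω a) x = sliceFst ω (H.E₃ (x ⊗ₜ a)) := by
  rw [leftConv, LinearMap.comp_apply, leftSlice_rightTranslate, retr_incl H.nondegenerate]

theorem sliceFst_add (ω ω' : Module.Dual ℂ A) (t : A ⊗[ℂ] A) :
    sliceFst (ω + ω') t = sliceFst ω t + sliceFst ω' t := by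
  simp [sliceFst, LinearMap.rTensor_add]

theorem sliceFst_smul (c : ℂ) (ω : Module.Dual ℂ A) (t : A ⊗[ℂ] A) :
    sliceFst (c • ω) t = c • sliceFst ω t := by
  simp [sliceFst, LinearMap.rTensor_smul]

theorem sliceSnd_add (ω ω' : Module.Dual ℂ A) (t : A ⊗[ℂ] A) :
    sliceSnd (ω + ω') t = sliceSnd ω t + sliceSnd ω' t := by
  simp [sliceSnd, LinearMap.lTensor_add]

theorem sliceSnd_smul (c : ℂ) (ω : Module.Dual ℂ A) (t : A ⊗[ℂ] A) :
    sliceSnd (c • ω) t = c • sliceSnd ω t := by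
  simp [sliceSnd, LinearMap.lTensor_smul]

theorem leftSlice_add (ω ω' : Module.Dual ℂ A) (a : A) :
    H.leftSlice (ω + ω') a = H.leftSlice ω a + H.leftSlice ω' a :=
  ext' (fun _ => sliceFst_add _ _ _) (fun _ => sliceFst_add _ _ _)

theorem leftSlice_smul (c : ℂ) (ω : Module.Dual ℂ A) (a : A) :
    H.leftSlice (c • ω) a = c • H.leftSlice ω a :=
  ext' (fun _ => sliceFst_smul _ _ _) (fun _ => sliceFst_smul _ _ _)

theorem rightSlice_add (ω ω' : Module.Dual ℂ A) (a : A) :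
    H.rightSlice (ω + ω') a = H.rightSlice ω a + H.rightSlice ω' a :=
  ext' (fun _ => sliceSnd_add _ _ _) (fun _ => sliceSnd_add _ _ _)

theorem rightSlice_smul (c : ℂ) (ω : Module.Dual ℂ A) (a : A) :
    H.rightSlice (c • ω) a = c • H.rightSlice ω a :=
  ext' (fun _ => sliceSnd_smul _ _ _) (fun _ => sliceSnd_smul _ _ _)

theorem leftConv_add (ω ω' : Module.Dual ℂ A) :
    H.leftConv (ω + ω') = H.leftConv ω + H.leftConv ω' := by
  ext a; simp [leftConv, leftSlice_add]

theorem leftConv_smul (c : ℂ) (ω : Module.Dual ℂ A) :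
    H.leftConv (c • ω) = c • H.leftConv ω := by
  ext a; simp [leftConv, leftSlice_smul]

theorem rightConv_add (ω ω' : Module.Dual ℂ A) :
    H.rightConv (ω + ω') = H.rightConv ω + H.rightConv ω' := by
  ext a; simp [rightConv, rightSlice_add]

theorem rightConv_smul (c : ℂ) (ω : Module.Dual ℂ A) :
    H.rightConv (c • ω) = c • H.rightConv ω := by
  ext a; simp [rightConv, rightSlice_smul]

/-- The space `{θ ∈ A' | (θ ⊗ ι)Δ(a), (ι ⊗ θ)Δ(a) ∈ A for all a ∈ A}`. -/
def multiplierFunctionals : Submodule ℂ (Module.Dual ℂ A) where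
  carrier := {θ | H.SlicesInAlgebra θ}
  zero_mem' := fun a => by
    have h1 := H.leftSlice_smul 0 0 a
    have h2 := H.rightSlice_smul 0 0 a
    rw [zero_smul, zero_smul] at h1 h2
    rw [h1, h2]
    exact ⟨⟨0, map_zero _⟩, ⟨0, map_zero _⟩⟩
  add_mem' := fun {θ θ'} h h' a => by
    obtain ⟨⟨x, hx⟩, ⟨y, hy⟩⟩ := h a
    obtain ⟨⟨x', hx'⟩, ⟨y', hy'⟩⟩ := h' a
    rw [leftSlice_add, rightSlice_add, ← hx, ← hx', ← hy, ← hy', ← map_add, ← map_add]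
    exact ⟨⟨_, rfl⟩, ⟨_, rfl⟩⟩
  smul_mem' := fun c θ h a => by
    obtain ⟨⟨x, hx⟩, ⟨y, hy⟩⟩ := h a
    rw [leftSlice_smul, rightSlice_smul, ← hx, ← hy, ← map_smul, ← map_smul]
    exact ⟨⟨_, rfl⟩, ⟨_, rfl⟩⟩

/-- `ω a` as an element of `multiplierFunctionals`. -/
def rightTranslateMem (ω : Module.Dual ℂ A) (a : A) : H.multiplierFunctionals :=
  ⟨rightTranslate ω a, H.slicesInAlgebra_rightTranslate ω a⟩

/-- `a ω` as an element of `multiplierFunctionals`. -/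
def leftTranslateMem (ω : Module.Dual ℂ A) (a : A) : H.multiplierFunctionals :=
  ⟨leftTranslate ω a, H.slicesInAlgebra_leftTranslate ω a⟩

/-! ### Coassociativity on slices -/

theorem comulFst_tmul (p q : A) : comulFst H.Δ (p ⊗ₜ q) = tmul (H.Δ p) (incl q) := rfl

theorem comulSnd_tmul (p q : A) :
    comulSnd H.Δ (p ⊗ₜ q) = assocSymm (tmul (incl p) (H.Δ q)) := rfl

theorem assocSymm_mul (m n : Multiplier (A ⊗[ℂ] (A ⊗[ℂ] A))) :
    assocSymm (m * n) = assocSymm m * assocSymm n :=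
  ext' (fun x => by simp) (fun x => by simp)

theorem assocSymm_incl (t : A ⊗[ℂ] (A ⊗[ℂ] A)) :
    assocSymm (incl t) = incl ((TensorProduct.assoc ℂ A A A).symm t) :=
  ext' (fun x => by
      rw [L_assocSymm, L_incl, assoc_symm_mul, L_incl, LinearEquiv.symm_apply_apply])
    (fun x => by
      rw [R_assocSymm, R_incl, assoc_symm_mul, R_incl, LinearEquiv.symm_apply_apply])

theorem assocSymm_tmul_one (a : A) :
    assocSymm (tmul (incl a) (1 : Multiplier (A ⊗[ℂ] A))) = tmul (leg₁ A A a) 1 := by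
  have h : ∀ f g : (A ⊗[ℂ] A) ⊗[ℂ] A →ₗ[ℂ] (A ⊗[ℂ] A) ⊗[ℂ] A,
      (∀ x y z, f (x ⊗ₜ y ⊗ₜ z) = g (x ⊗ₜ y ⊗ₜ z)) → ∀ t, f t = g t := by
    intro f g h t
    rw [TensorProduct.ext_threefold h]
  refine ext' (h _ _ fun x y z => ?_) (h _ _ fun x y z => ?_) <;>
  simp [leg₁_apply]

theorem assocSymm_one_tmul (c : A) :
    assocSymm (tmul (1 : Multiplier A) (leg₂ A A c)) = tmul 1 (incl c) := by
  have h : ∀ f g : (A ⊗[ℂ] A) ⊗[ℂ] A →ₗ[ℂ] (A ⊗[ℂ] A) ⊗[ℂ] A,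
      (∀ x y z, f (x ⊗ₜ y ⊗ₜ z) = g (x ⊗ₜ y ⊗ₜ z)) → ∀ t, f t = g t := by
    intro f g h t
    rw [TensorProduct.ext_threefold h]
  refine ext' (h _ _ fun x y z => ?_) (h _ _ fun x y z => ?_) <;>
  simp [leg₂_apply]

theorem comulFst_mul (s t : A ⊗[ℂ] A) :
    comulFst H.Δ (s * t) = comulFst H.Δ s * comulFst H.Δ t := by
  induction s with
  | zero => simp
  | add s s' hs hs' => simp only [map_add, add_mul, hs, hs']
  | tmul a b =>
    induction t with
    | zero => simp
    | add s s' hs hs' => simp only [map_add, mul_add, hs, hs']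
    | tmul c d => simp [comulFst_tmul, tmul_mul_tmul]

theorem comulSnd_mul (s t : A ⊗[ℂ] A) :
    comulSnd H.Δ (s * t) = comulSnd H.Δ s * comulSnd H.Δ t := by
  induction s with
  | zero => simp
  | add s s' hs hs' => simp only [map_add, add_mul, hs, hs']
  | tmul a b =>
    induction t with
    | zero => simp
    | add s s' hs hs' => simp only [map_add, mul_add, hs, hs']
    | tmul c d => simp [comulSnd_tmul, tmul_mul_tmul, ← assocSymm_mul]

theorem eq_zero_of_R {B : Type*} [NonUnitalRing B] [Module ℂ B] [IsScalarTower ℂ B B]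
    [SMulCommClass ℂ B B] (hB : NondegenerateAlgebra B) (Y : Multiplier B) (h : ∀ x, Y.R x = 0) :
    Y = 0 := by
  refine ext' (fun y => ?_) h
  refine (hB _).2 fun x => ?_
  rw [← balanced, h, zero_mul]

theorem comulFst_cancel (Y : Multiplier ((A ⊗[ℂ] A) ⊗[ℂ] A))
    (h : ∀ t, comulFst H.Δ t * Y = 0) : Y = 0 := by
  have hN := H.nondeg₂
  have hN₃ := hN.tensor H.nondegenerate
  have h1 : ∀ w p q, Y.R ((H.Δ p).R w ⊗ₜ q) = 0 := by
    intro w p q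
    apply incl_injective hN₃
    rw [map_zero, ← incl_mul _ _ hN₃, ← tmul_incl, ← incl_mul _ _ hN, ← one_mul (incl q),
      ← tmul_mul_tmul, mul_assoc, ← comulFst_tmul, h, mul_zero]
  have h2 : ∀ w q, Y.R (w ⊗ₜ q) = 0 := by
    intro w q
    have h3 : Y.R ∘ₗ (TensorProduct.mk ℂ (A ⊗[ℂ] A) A).flip q = 0 := by
      refine LinearMap.ext_on H.nondegenerate_Δ.2 ?_
      rintro _ ⟨a, b, rfl⟩
      exact h1 b a q
    exact LinearMap.congr_fun h3 w
  refine eq_zero_of_R hN₃ Y fun x => ?_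
  induction x with
  | zero => simp
  | add x y hx hy => rw [map_add, hx, hy, add_zero]
  | tmul w q => exact h2 w q

theorem comulSnd_cancel (Y : Multiplier ((A ⊗[ℂ] A) ⊗[ℂ] A))
    (h : ∀ t, comulSnd H.Δ t * Y = 0) : Y = 0 := by
  have hN := H.nondeg₂
  have hN₃ := hN.tensor H.nondegenerate
  let e := (TensorProduct.assoc ℂ A A A).symm
  have h1 : ∀ w p q, Y.R (e (q ⊗ₜ (H.Δ p).R w)) = 0 := by
    intro w p q
    apply incl_injective hN₃
    rw [map_zero, ← incl_mul _ _ hN₃, ← assocSymm_incl, ← tmul_incl, ← incl_mul _ _ hN,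
      ← one_mul (incl q), ← tmul_mul_tmul, assocSymm_mul, mul_assoc, ← comulSnd_tmul, h, mul_zero]
  have h2 : ∀ q w, Y.R (e (q ⊗ₜ w)) = 0 := by
    intro q w
    have h3 : Y.R ∘ₗ e.toLinearMap ∘ₗ (TensorProduct.mk ℂ A (A ⊗[ℂ] A)) q = 0 := by
      refine LinearMap.ext_on H.nondegenerate_Δ.2 ?_
      rintro _ ⟨a, b, rfl⟩
      exact h1 b a q
    exact LinearMap.congr_fun h3 w
  have h3 : ∀ x, Y.R (e x) = 0 := by
    intro x
    induction x with
    | zero => simp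
    | add x y hx hy => rw [map_add, map_add, hx, hy, add_zero]
    | tmul w q => exact h2 w q
  refine eq_zero_of_R hN₃ Y fun x => ?_
  simpa [e] using h3 (e.symm x)

theorem comulFst_R_leg₂ (c : A) (t : A ⊗[ℂ] A) :
    comulFst H.Δ ((leg₂ A A c).R t) = comulFst H.Δ t * tmul 1 (incl c) := by
  rw [leg₂_apply, R_tmul]
  induction t with
  | zero => simp
  | add s s' hs hs' => simp only [map_add, add_mul, hs, hs']
  | tmul p q => simp [comulFst_tmul, tmul_mul_tmul]

theorem comulSnd_R_leg₁ (a : A) (t : A ⊗[ℂ] A) :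
    comulSnd H.Δ ((leg₁ A A a).R t) = comulSnd H.Δ t * tmul (leg₁ A A a) 1 := by
  rw [leg₁_apply, R_tmul, ← leg₁_apply, ← assocSymm_tmul_one]
  induction t with
  | zero => simp
  | add s s' hs hs' => simp only [map_add, add_mul, hs, hs']
  | tmul p q => simp [comulSnd_tmul, tmul_mul_tmul, ← assocSymm_mul]

/-- `(a ⊗ 1 ⊗ 1)(Δ ⊗ ι)((1 ⊗ c)Δ(x)) = (1 ⊗ 1 ⊗ c)(ι ⊗ Δ)((a ⊗ 1)Δ(x))`. -/
theorem coassoc_apply (a c x : A) :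
    TensorProduct.map (H.E₃ ∘ₗ (TensorProduct.mk ℂ A A).flip a) LinearMap.id (H.E₄ (x ⊗ₜ c)) =
      (TensorProduct.assoc ℂ A A A).symm (TensorProduct.map LinearMap.id
        (H.E₄ ∘ₗ (TensorProduct.mk ℂ A A).flip c) (H.E₃ (x ⊗ₜ a))) := by
  have hN := H.nondeg₂
  have hN₃ := hN.tensor H.nondegenerate
  obtain ⟨X, hX, hX'⟩ := H.coassoc x
  have hu : comulFst H.Δ (H.E₄ (x ⊗ₜ c)) = tmul 1 (incl c) * X := by
    refine sub_eq_zero.1 (H.comulFst_cancel _ fun t => ?_)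
    have ht : t * H.E₄ (x ⊗ₜ c) = (H.Δ x).R ((leg₂ A A c).R t) := by
      apply incl_injective hN
      rw [map_mul, incl_E₄, T₄_tmul, ← incl_mul _ _ hN, ← incl_mul _ _ hN, mul_assoc]
    rw [mul_sub, ← comulFst_mul, ht, ← (hX _).2, comulFst_R_leg₂, mul_assoc, sub_self]
  have hv : comulSnd H.Δ (H.E₃ (x ⊗ₜ a)) = tmul (leg₁ A A a) 1 * X := by
    refine sub_eq_zero.1 (H.comulSnd_cancel _ fun t => ?_)
    have ht : t * H.E₃ (x ⊗ₜ a) = (H.Δ x).R ((leg₁ A A a).R t) := by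
      apply incl_injective hN
      rw [map_mul, incl_E₃, T₃_tmul, ← incl_mul _ _ hN, ← incl_mul _ _ hN, mul_assoc]
    rw [mul_sub, ← comulSnd_mul, ht, ← (hX' _).2, comulSnd_R_leg₁, mul_assoc, sub_self]
  have hG : ∀ u, incl (TensorProduct.map (H.E₃ ∘ₗ (TensorProduct.mk ℂ A A).flip a)
      LinearMap.id u) = tmul (leg₁ A A a) 1 * comulFst H.Δ u := by
    intro u
    induction u with
    | zero => simp
    | add s s' hs hs' => simp only [map_add, mul_add, hs, hs']
    | tmul p q =>
      rw [TensorProduct.map_tmul, ← tmul_incl, comulFst_tmul, tmul_mul_tmul, one_mul]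
      congr 2
      exact H.incl_E₃ (p ⊗ₜ a)
  have hK : ∀ v, incl ((TensorProduct.assoc ℂ A A A).symm (TensorProduct.map LinearMap.id
      (H.E₄ ∘ₗ (TensorProduct.mk ℂ A A).flip c) v)) = tmul 1 (incl c) * comulSnd H.Δ v := by
    intro v
    induction v with
    | zero => simp
    | add s s' hs hs' => simp only [map_add, mul_add, hs, hs']
    | tmul p q =>
      rw [TensorProduct.map_tmul, ← assocSymm_incl, ← tmul_incl, comulSnd_tmul,
        ← assocSymm_one_tmul, ← assocSymm_mul, tmul_mul_tmul, one_mul]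
      congr 2
      exact H.incl_E₄ (q ⊗ₜ c)
  apply incl_injective hN₃
  rw [hG, hK, hu, hv, ← mul_assoc, ← mul_assoc, tmul_mul_tmul, tmul_mul_tmul, one_mul, one_mul,
    mul_one, mul_one]

theorem leftConv_rightConv_comm (ω η : Module.Dual ℂ A) (a c x : A) :
    H.leftConv (rightTranslate ω a) (H.rightConv (rightTranslate η c) x) =
      H.rightConv (rightTranslate η c) (H.leftConv (rightTranslate ω a) x) := by
  simp only [rightConv_rightTranslate, leftConv_rightTranslate]
  have h1 : ∀ u : A ⊗[ℂ] A, sliceFst ω (H.E₃ (sliceSnd η u ⊗ₜ a)) = sliceFst ω (sliceSnd η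
      (TensorProduct.map (H.E₃ ∘ₗ (TensorProduct.mk ℂ A A).flip a) LinearMap.id u)) := by
    intro u
    induction u with
    | zero => simp
    | add s s' hs hs' => simp only [map_add, TensorProduct.add_tmul, hs, hs']
    | tmul p q =>
      simp only [sliceSnd_tmul, ← TensorProduct.smul_tmul', map_smul, TensorProduct.map_tmul,
        LinearMap.comp_apply, LinearMap.flip_apply, TensorProduct.mk_apply, LinearMap.id_apply]
  have h2 : ∀ (p : A) (w : A ⊗[ℂ] A), sliceFst ω (sliceSnd η
      ((TensorProduct.assoc ℂ A A A).symm (p ⊗ₜ w))) = ω p • sliceSnd η w := by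
    intro p w
    induction w with
    | zero => simp
    | add s s' hs hs' => simp only [map_add, TensorProduct.tmul_add, smul_add, hs, hs']
    | tmul y z =>
      simp only [TensorProduct.assoc_symm_tmul, sliceSnd_tmul, map_smul, sliceFst_tmul]
      rw [smul_comm]
  have h3 : ∀ v : A ⊗[ℂ] A, sliceSnd η (H.E₄ (sliceFst ω v ⊗ₜ c)) = sliceFst ω (sliceSnd η
      ((TensorProduct.assoc ℂ A A A).symm (TensorProduct.map LinearMap.id
        (H.E₄ ∘ₗ (TensorProduct.mk ℂ A A).flip c) v))) := by
    intro v
    induction v with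
    | zero => simp
    | add s s' hs hs' => simp only [map_add, TensorProduct.add_tmul, hs, hs']
    | tmul p q =>
      rw [TensorProduct.map_tmul, LinearMap.id_apply, h2]
      simp only [sliceFst_tmul, ← TensorProduct.smul_tmul', map_smul, LinearMap.comp_apply,
        LinearMap.flip_apply, TensorProduct.mk_apply]
  rw [h1, h3, coassoc_apply]

end RegularMultiplierHopfAlgebra

/-! ### Algebraic quantum groups and their duals -/

/-- An algebraic quantum group, together with a left Haar functional `φ`. -/
structure AlgebraicQuantumGroup (A : Type*) [NonUnitalRing A] [Module ℂ A]
    [IsScalarTower ℂ A A] [SMulCommClass ℂ A A] extends RegularMultiplierHopfAlgebra A where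
  φ : Module.Dual ℂ A
  φ_ne_zero : φ ≠ 0
  /-- `(ι ⊗ φ)Δ(a) = φ(a) 1`. -/
  left_invariant : ∀ a, toRegularMultiplierHopfAlgebra.rightSlice φ a = φ a • 1

namespace AlgebraicQuantumGroup

variable {A : Type*} [NonUnitalRing A] [Module ℂ A] [IsScalarTower ℂ A A] [SMulCommClass ℂ A A]
variable (G : AlgebraicQuantumGroup A)

open RegularMultiplierHopfAlgebra

/-- The dual `Â = {φ a | a ∈ A} ⊆ A'`. -/
def dual : Submodule ℂ (Module.Dual ℂ A) := LinearMap.range (rightTranslate G.φ)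

theorem E₃_eq (t : A ⊗[ℂ] A) (x : A) :
    G.φ (sliceSnd G.φ ((G.Δ x).R (G.E₃ t))) = G.φ (sliceSnd G.φ t * x) := by
  have hN := G.nondeg₂
  induction t with
  | zero => simp
  | add s s' hs hs' => simp only [map_add, add_mul, hs, hs']
  | tmul p q =>
    have h : (G.Δ x).R (G.E₃ (p ⊗ₜ q)) = G.E₃ ((p * x) ⊗ₜ q) := by
      apply incl_injective hN
      rw [← incl_mul _ _ hN, incl_E₃, incl_E₃, T₃_tmul, T₃_tmul, map_mul, mul_assoc]
    have h' : sliceSnd G.φ (G.E₃ ((p * x) ⊗ₜ q)) = G.φ (p * x) • q := by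
      have := congrArg (fun m : Multiplier A => m.R q) (G.left_invariant (p * x))
      simpa [rightSlice] using this
    rw [h, h']
    simp [smul_mul_assoc, mul_comm]

theorem apply_rightConv (a b x : A) :
    rightTranslate G.φ a (G.rightConv (rightTranslate G.φ b) x) =
      G.φ (sliceSnd G.φ ((G.Δ x).R (a ⊗ₜ b))) := by
  have hN := G.nondeg₂
  rw [rightConv_rightTranslate, rightTranslate_apply, ← sliceSnd_L_leg₁]
  congr 2
  apply incl_injective hN
  rw [← mul_incl _ _ hN, ← incl_mul _ _ hN, incl_E₄, T₄_tmul, ← mul_assoc, leg₁_mul_leg₂]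

theorem apply_leftConv (a b x : A) :
    rightTranslate G.φ b (G.leftConv (rightTranslate G.φ a) x) =
      G.φ (sliceSnd G.φ ((G.Δ x).R (a ⊗ₜ b))) := by
  have hN := G.nondeg₂
  have h : ∀ t : A ⊗[ℂ] A, G.φ (sliceFst G.φ t) = G.φ (sliceSnd G.φ t) := by
    intro t
    induction t with
    | zero => simp
    | add s s' hs hs' => simp only [map_add, hs, hs']
    | tmul p q => simp [mul_comm]
  rw [leftConv_rightTranslate, rightTranslate_apply, ← sliceFst_L_leg₂, h]
  congr 2
  apply incl_injective hN
  rw [← mul_incl _ _ hN, ← incl_mul _ _ hN, incl_E₃, T₃_tmul, ← mul_assoc, leg₂_mul_leg₁]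

theorem mul_mem_dual {ω₁ ω₂ : Module.Dual ℂ A} (h₁ : ω₁ ∈ G.dual) (h₂ : ω₂ ∈ G.dual) :
    ω₁ ∘ₗ G.rightConv ω₂ ∈ G.dual := by
  obtain ⟨a, rfl⟩ := h₁
  obtain ⟨b, rfl⟩ := h₂
  obtain ⟨t, ht⟩ := G.E₃_surjective (a ⊗ₜ b)
  refine ⟨sliceSnd G.φ t, ?_⟩
  ext x
  rw [LinearMap.comp_apply, apply_rightConv, ← ht, E₃_eq, rightTranslate_apply]

theorem apply_conv (ω₁ ω₂ : G.dual) (x : A) :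
    ω₁.1 (G.rightConv ω₂.1 x) = ω₂.1 (G.leftConv ω₁.1 x) := by
  obtain ⟨_, a, rfl⟩ := ω₁
  obtain ⟨_, b, rfl⟩ := ω₂
  rw [apply_rightConv, apply_leftConv]

theorem conv_comm (ω₁ ω₂ : G.dual) (x : A) :
    G.leftConv ω₁.1 (G.rightConv ω₂.1 x) = G.rightConv ω₂.1 (G.leftConv ω₁.1 x) := by
  obtain ⟨_, a, rfl⟩ := ω₁
  obtain ⟨_, b, rfl⟩ := ω₂
  exact G.leftConv_rightConv_comm _ _ _ _ _

/-- The product of `Â`: `(ω₁ ω₂)(x) = ω₁((ι ⊗ ω₂)Δ(x))`. -/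
instance : Mul G.dual := ⟨fun ω₁ ω₂ => ⟨ω₁.1 ∘ₗ G.rightConv ω₂.1, G.mul_mem_dual ω₁.2 ω₂.2⟩⟩

theorem coe_mul (ω₁ ω₂ : G.dual) :
    ((ω₁ * ω₂ : G.dual) : Module.Dual ℂ A) = ω₁.1 ∘ₗ G.rightConv ω₂.1 := rfl

instance : NonUnitalRing G.dual :=
  { (inferInstance : AddCommGroup G.dual), (inferInstance : Mul G.dual) with
    left_distrib := fun a b c => Subtype.ext (by
      simp only [coe_mul, Submodule.coe_add, rightConv_add, LinearMap.comp_add])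
    right_distrib := fun a b c => Subtype.ext (by
      simp only [coe_mul, Submodule.coe_add, LinearMap.add_comp])
    zero_mul := fun a => Subtype.ext (by simp [coe_mul])
    mul_zero := fun a => Subtype.ext (by
      have h := G.rightConv_smul 0 0
      rw [zero_smul, zero_smul] at h
      simp [coe_mul, h])
    mul_assoc := fun a b c => Subtype.ext (LinearMap.ext fun x => by
      simp only [coe_mul, LinearMap.comp_apply]
      rw [apply_conv G a b, conv_comm]
      exact (apply_conv G a ⟨_, G.mul_mem_dual b.2 c.2⟩ x).symm) }

instance : IsScalarTower ℂ G.dual G.dual :=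
  ⟨fun c a b => Subtype.ext (by simp [coe_mul, LinearMap.smul_comp])⟩

instance : SMulCommClass ℂ G.dual G.dual :=
  ⟨fun c a b => Subtype.ext (by simp [coe_mul, rightConv_smul, LinearMap.comp_smul])⟩

/-- `Â ⊗ Â` as functionals on `A ⊗ A`. -/
def pairing : G.dual ⊗[ℂ] G.dual →ₗ[ℂ] Module.Dual ℂ (A ⊗[ℂ] A) :=
  TensorProduct.dualDistrib ℂ A A ∘ₗ TensorProduct.map G.dual.subtype G.dual.subtype

/-- The defining properties of the comultiplication `Δ̂` of `Â`: it is a non-degenerate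
homomorphism, `Δ̂(ω₁)(1 ⊗ ω₂)` is the element `x ⊗ y ↦ (ω₁ ⊗ ω₂)((x ⊗ 1)Δ(y))` of `Â ⊗ Â`, and
`(ω₁ ⊗ 1)Δ̂(ω₂)` is the element `x ⊗ y ↦ (ω₁ ⊗ ω₂)(Δ(x)(1 ⊗ y))` of `Â ⊗ Â`. -/
structure IsDualComul (Δ' : G.dual →ₙₐ[ℂ] Multiplier (G.dual ⊗[ℂ] G.dual)) : Prop where
  nondegenerate : NondegenerateMap (Δ' : G.dual →ₗ[ℂ] Multiplier (G.dual ⊗[ℂ] G.dual))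
  mul_leg₂ : ∀ ω₁ ω₂ : G.dual, ∃ t : G.dual ⊗[ℂ] G.dual,
    incl t = Δ' ω₁ * leg₂ G.dual G.dual ω₂ ∧
    ∀ x y, G.pairing t (x ⊗ₜ y) = G.pairing (ω₁ ⊗ₜ ω₂) (G.E₃ (y ⊗ₜ x))
  leg₁_mul : ∀ ω₁ ω₂ : G.dual, ∃ t : G.dual ⊗[ℂ] G.dual,
    incl t = leg₁ G.dual G.dual ω₁ * Δ' ω₂ ∧
    ∀ x y, G.pairing t (x ⊗ₜ y) = G.pairing (ω₁ ⊗ₜ ω₂) (G.E₂ (x ⊗ₜ y))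

/-- The functional `θ` implements the multiplier `m` of `Â`: for all `ω ∈ Â` and `x ∈ A`,
`(m ω)(x) = θ((ι ⊗ ω)Δ(x))` and `(ω m)(x) = θ((ω ⊗ ι)Δ(x))`. -/
def Implements (θ : Module.Dual ℂ A) (m : Multiplier G.dual) : Prop :=
  ∀ (ω : G.dual) (x : A), (m.L ω).1 x = θ (G.rightConv ω.1 x) ∧
    (m.R ω).1 x = θ (G.leftConv ω.1 x)

end AlgebraicQuantumGroup

end QuantumGroup

end

open scoped TensorProduct
open QuantumGroup

/-!
Elements of the dual are handled through the convolution operators `(θ ⊗ ι)Δ` and `(ι ⊗ θ)Δ` on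
`A`. For translates `ω a` and `a ω` these are slices of the four canonical maps, so that
bijectivity of those maps says that such slices span `A`, and coassociativity says that left and
right convolutions commute. The latter holds as soon as one of the functionals is a translate and
the other belongs to `{θ | (θ ⊗ ι)Δ(a), (ι ⊗ θ)Δ(a) ∈ A}` (`leftConv_rightConv_comm_of_left`,
`leftConv_rightConv_comm_of_right`).

The counit and the antipode of `A` come from inverting the canonical maps (`exists_counit`,
`exists_antipode`). The antipode satisfies strong left invariance
`S((ι ⊗ φ)(Δ(b)(1 ⊗ y))) = (ι ⊗ φ)((1 ⊗ b)Δ(y))` (`antipode_rightConv_φ`). Consequences are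
faithfulness of `φ`, the relation between `S` and `Δ` (`antipode_leftConv`, `antipode_rightConv`),
and right invariance and strong right invariance of `ψ = φ ∘ S`. Combining the two invariances
shows `{φ a} = {a φ} = {ψ a}` (`range_leftTranslate_φ`, `range_rightTranslate_ψ`), which gives two
bijections of `A` onto its dual.

Through the Fourier transform `F(x) = S(x) φ`, multiplication by `θ` on the dual becomes
`θ F(x) = F((ι ⊗ θ)Δ(x))` (`apply_rightConv_leftEquiv`). This identifies the multipliers of the dual
with functionals; the functional of a multiplier is the counit of `A` composed with its action on
`A`. The maps `ω₁ ⊗ ω₂ ↦ Δ̂(ω₁)(1 ⊗ ω₂)` and `ω₁ ⊗ ω₂ ↦ (ω₁ ⊗ 1)Δ̂(ω₂)` become inverses of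
canonical maps of `A`, by left invariance of `φ` and right invariance of `ψ` (`pairing_dualT₂`,
`pairing_dualT₃`), and they define `Δ̂`.

The dual counit is `a φ ↦ φ(a)`. Applied to `θ F(x) = F((ι ⊗ θ)Δ(x))`, it gives
`ε̂(θ) ψ(x) = ψ((ι ⊗ θ)Δ(x))`. By right invariance of `ψ` this is `ω(a) ψ(x)` for `θ = ω a` and for
`θ = a ω`. The dual antipode is `ω ↦ ω ∘ S`; its axioms are the strong invariance properties, and
the formula extends to multipliers since `S` intertwines left and right convolution.
-/

noncomputable section

namespace QuantumGroup

open Multiplier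

/-! ### Slices of tensors -/

section Slices

variable {A : Type*} [NonUnitalRing A] [Module ℂ A] [IsScalarTower ℂ A A] [SMulCommClass ℂ A A]

theorem leg₁_L_eq (a : A) (t : A ⊗[ℂ] A) :
    (leg₁ A A a).L t = LinearMap.rTensor A (LinearMap.mulLeft ℂ a) t := rfl

theorem leg₁_R_eq (a : A) (t : A ⊗[ℂ] A) :
    (leg₁ A A a).R t = LinearMap.rTensor A (LinearMap.mulRight ℂ a) t := rfl

theorem leg₂_L_eq (a : A) (t : A ⊗[ℂ] A) :
    (leg₂ A A a).L t = LinearMap.lTensor A (LinearMap.mulLeft ℂ a) t := rfl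

theorem leg₂_R_eq (a : A) (t : A ⊗[ℂ] A) :
    (leg₂ A A a).R t = LinearMap.lTensor A (LinearMap.mulRight ℂ a) t := rfl

theorem apply_sliceSnd (ω η : Module.Dual ℂ A) (t : A ⊗[ℂ] A) :
    ω (sliceSnd η t) = η (sliceFst ω t) := by
  induction t with
  | zero => simp
  | add s s' hs hs' => simp only [map_add, hs, hs']
  | tmul a b => simp [mul_comm]

theorem sliceFst_lTensor (ω : Module.Dual ℂ A) (f : A →ₗ[ℂ] A) (t : A ⊗[ℂ] A) :
    sliceFst ω (LinearMap.lTensor A f t) = f (sliceFst ω t) := by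
  induction t with
  | zero => simp
  | add s s' hs hs' => simp only [map_add, hs, hs']
  | tmul a b => simp

theorem sliceSnd_rTensor (ω : Module.Dual ℂ A) (f : A →ₗ[ℂ] A) (t : A ⊗[ℂ] A) :
    sliceSnd ω (LinearMap.rTensor A f t) = f (sliceSnd ω t) := by
  induction t with
  | zero => simp
  | add s s' hs hs' => simp only [map_add, hs, hs']
  | tmul a b => simp

theorem sliceFst_rTensor (ω : Module.Dual ℂ A) (f : A →ₗ[ℂ] A) (t : A ⊗[ℂ] A) :
    sliceFst ω (LinearMap.rTensor A f t) = sliceFst (ω ∘ₗ f) t := by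
  induction t with
  | zero => simp
  | add s s' hs hs' => simp only [map_add, hs, hs']
  | tmul a b => simp

theorem sliceSnd_lTensor (ω : Module.Dual ℂ A) (f : A →ₗ[ℂ] A) (t : A ⊗[ℂ] A) :
    sliceSnd ω (LinearMap.lTensor A f t) = sliceSnd (ω ∘ₗ f) t := by
  induction t with
  | zero => simp
  | add s s' hs hs' => simp only [map_add, hs, hs']
  | tmul a b => simp

theorem eq_of_forall_dual {x y : A} (h : ∀ ω : Module.Dual ℂ A, ω x = ω y) : x = y :=
  sub_eq_zero.1 ((Module.forall_dual_apply_eq_zero_iff ℂ _).1 fun ω => by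
    rw [map_sub, h, sub_self])

theorem equivFinsuppOfBasisLeft_eq_sliceFst {ι : Type*} [DecidableEq ι] (b : Module.Basis ι ℂ A)
    (t : A ⊗[ℂ] A) (i : ι) :
    TensorProduct.equivFinsuppOfBasisLeft (N := A) b t i = sliceFst (b.coord i) t := by
  induction t with
  | zero => simp
  | add s s' hs hs' => simp only [map_add, Finsupp.add_apply, hs, hs']
  | tmul a c => simp

theorem eq_of_sliceFst {s t : A ⊗[ℂ] A} (h : ∀ ω, sliceFst ω s = sliceFst ω t) : s = t := by
  classical
  let b := Module.Basis.ofVectorSpace ℂ A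
  apply (TensorProduct.equivFinsuppOfBasisLeft (N := A) b).injective
  ext i
  rw [equivFinsuppOfBasisLeft_eq_sliceFst, equivFinsuppOfBasisLeft_eq_sliceFst, h]

theorem eq_of_sliceSnd {s t : A ⊗[ℂ] A} (h : ∀ ω, sliceSnd ω s = sliceSnd ω t) : s = t :=
  eq_of_sliceFst fun ω => eq_of_forall_dual fun η => by
    rw [← apply_sliceSnd, ← apply_sliceSnd, h]

/-- If `(ι ⊗ f c)t = 0` for all `c`, then `∑ f(x)(y) = 0` where `t = ∑ x ⊗ y`. -/
theorem lift_eq_zero_of_sliceSnd (f : A →ₗ[ℂ] Module.Dual ℂ A) (t : A ⊗[ℂ] A)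
    (h : ∀ c, sliceSnd (f c) t = 0) : TensorProduct.lift f t = 0 := by
  classical
  let b := Module.Basis.ofVectorSpace ℂ A
  let e := TensorProduct.equivFinsuppOfBasisLeft (N := A) b
  have ht : t = (e t).sum fun i y => b i ⊗ₜ[ℂ] y := by
    apply e.injective
    ext j
    simp [e, Finsupp.sum, Finsupp.finsetSum_apply, Finsupp.single_apply]
  rw [ht, Finsupp.sum, map_sum]
  refine Finset.sum_eq_zero fun i _ => ?_
  rw [TensorProduct.lift.tmul, equivFinsuppOfBasisLeft_eq_sliceFst, ← apply_sliceSnd, h, map_zero]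

end Slices

namespace RegularMultiplierHopfAlgebra

variable {A : Type*} [NonUnitalRing A] [Module ℂ A] [IsScalarTower ℂ A A] [SMulCommClass ℂ A A]
variable (H : RegularMultiplierHopfAlgebra A)

/-! ### The four canonical maps -/

theorem E₁_bijective : Function.Bijective H.E₁ := by
  constructor
  · intro s t h
    refine H.bijOn_T₁.injOn (Set.mem_univ s) (Set.mem_univ t) ?_
    rw [← incl_E₁, ← incl_E₁, h]
  · intro s
    obtain ⟨t, -, ht⟩ := H.bijOn_T₁.surjOn ⟨s, rfl⟩
    exact ⟨t, incl_injective H.nondeg₂ (by rw [incl_E₁, ht])⟩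

theorem E₂_bijective : Function.Bijective H.E₂ := by
  constructor
  · intro s t h
    refine H.bijOn_T₂.injOn (Set.mem_univ s) (Set.mem_univ t) ?_
    rw [← incl_E₂, ← incl_E₂, h]
  · intro s
    obtain ⟨t, -, ht⟩ := H.bijOn_T₂.surjOn ⟨s, rfl⟩
    exact ⟨t, incl_injective H.nondeg₂ (by rw [incl_E₂, ht])⟩

theorem E₃_bijective : Function.Bijective H.E₃ := by
  refine ⟨fun s t h => H.bijOn_T₃.injOn (Set.mem_univ s) (Set.mem_univ t) ?_, H.E₃_surjective⟩
  rw [← incl_E₃, ← incl_E₃, h]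

theorem E₄_bijective : Function.Bijective H.E₄ := by
  constructor
  · intro s t h
    refine H.bijOn_T₄.injOn (Set.mem_univ s) (Set.mem_univ t) ?_
    rw [← incl_E₄, ← incl_E₄, h]
  · intro s
    obtain ⟨t, -, ht⟩ := H.bijOn_T₄.surjOn ⟨s, rfl⟩
    exact ⟨t, incl_injective H.nondeg₂ (by rw [incl_E₄, ht])⟩

theorem leg₁_L_E₁ (x c d : A) :
    (leg₁ A A d).L (H.E₁ (x ⊗ₜ c)) = (leg₁ A A c).R (H.E₃ (x ⊗ₜ d)) := by
  have hN := H.nondeg₂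
  apply incl_injective hN
  rw [← mul_incl _ _ hN, ← incl_mul _ _ hN, incl_E₁, incl_E₃, T₁_tmul, T₃_tmul, mul_assoc]

theorem leg₁_L_E₂ (x c d : A) :
    (leg₁ A A d).L (H.E₂ (x ⊗ₜ c)) = (leg₂ A A c).R (H.E₃ (x ⊗ₜ d)) := by
  have hN := H.nondeg₂
  apply incl_injective hN
  rw [← mul_incl _ _ hN, ← incl_mul _ _ hN, incl_E₂, incl_E₃, T₂_tmul, T₃_tmul, mul_assoc]

theorem leg₂_L_E₂ (x c d : A) :
    (leg₂ A A d).L (H.E₂ (x ⊗ₜ c)) = (leg₂ A A c).R (H.E₄ (x ⊗ₜ d)) := by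
  have hN := H.nondeg₂
  apply incl_injective hN
  rw [← mul_incl _ _ hN, ← incl_mul _ _ hN, incl_E₂, incl_E₄, T₂_tmul, T₄_tmul, mul_assoc]

theorem leg₁_L_E₄ (x c d : A) :
    (leg₁ A A c).L (H.E₄ (x ⊗ₜ d)) = (H.Δ x).R (c ⊗ₜ d) := by
  have hN := H.nondeg₂
  apply incl_injective hN
  rw [← mul_incl _ _ hN, ← incl_mul _ _ hN, incl_E₄, T₄_tmul, ← mul_assoc, leg₁_mul_leg₂]

theorem leg₂_L_E₃ (x c d : A) :
    (leg₂ A A d).L (H.E₃ (x ⊗ₜ c)) = (H.Δ x).R (c ⊗ₜ d) := by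
  have hN := H.nondeg₂
  apply incl_injective hN
  rw [← mul_incl _ _ hN, ← incl_mul _ _ hN, incl_E₃, T₃_tmul, ← mul_assoc, leg₂_mul_leg₁]

theorem leg₁_R_E₂ (x c d : A) :
    (leg₁ A A c).R (H.E₂ (x ⊗ₜ d)) = (H.Δ x).L (c ⊗ₜ d) := by
  have hN := H.nondeg₂
  apply incl_injective hN
  rw [← incl_mul _ _ hN, ← mul_incl _ _ hN, incl_E₂, T₂_tmul, mul_assoc, leg₂_mul_leg₁]

theorem leg₂_R_E₁ (x c d : A) :
    (leg₂ A A d).R (H.E₁ (x ⊗ₜ c)) = (H.Δ x).L (c ⊗ₜ d) := by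
  have hN := H.nondeg₂
  apply incl_injective hN
  rw [← incl_mul _ _ hN, ← mul_incl _ _ hN, incl_E₁, T₁_tmul, mul_assoc, leg₁_mul_leg₂]

theorem Δ_R_E₃ (x p q : A) : (H.Δ x).R (H.E₃ (p ⊗ₜ q)) = H.E₃ ((p * x) ⊗ₜ q) := by
  have hN := H.nondeg₂
  apply incl_injective hN
  rw [← incl_mul _ _ hN, incl_E₃, incl_E₃, T₃_tmul, T₃_tmul, map_mul, mul_assoc]

theorem Δ_R_E₄ (x p q : A) : (H.Δ x).R (H.E₄ (p ⊗ₜ q)) = H.E₄ ((p * x) ⊗ₜ q) := by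
  have hN := H.nondeg₂
  apply incl_injective hN
  rw [← incl_mul _ _ hN, incl_E₄, incl_E₄, T₄_tmul, T₄_tmul, map_mul, mul_assoc]

theorem Δ_L_E₁ (x p q : A) : (H.Δ x).L (H.E₁ (p ⊗ₜ q)) = H.E₁ ((x * p) ⊗ₜ q) := by
  have hN := H.nondeg₂
  apply incl_injective hN
  rw [← mul_incl _ _ hN, incl_E₁, incl_E₁, T₁_tmul, T₁_tmul, map_mul, mul_assoc]

theorem Δ_L_E₂ (x p q : A) : (H.Δ x).L (H.E₂ (p ⊗ₜ q)) = H.E₂ ((x * p) ⊗ₜ q) := by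
  have hN := H.nondeg₂
  apply incl_injective hN
  rw [← mul_incl _ _ hN, incl_E₂, incl_E₂, T₂_tmul, T₂_tmul, map_mul, mul_assoc]

theorem E₁_tmul_mul (x a b : A) : H.E₁ (x ⊗ₜ (a * b)) = (leg₁ A A b).R (H.E₁ (x ⊗ₜ a)) := by
  have hN := H.nondeg₂
  apply incl_injective hN
  rw [← incl_mul _ _ hN, incl_E₁, incl_E₁, T₁_tmul, T₁_tmul, mul_assoc, leg₁_apply, leg₁_apply,
    leg₁_apply, tmul_mul_tmul, map_mul, one_mul]

theorem E₃_tmul_mul (x a b : A) : H.E₃ (x ⊗ₜ (a * b)) = (leg₁ A A a).L (H.E₃ (x ⊗ₜ b)) := by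
  have hN := H.nondeg₂
  apply incl_injective hN
  rw [← mul_incl _ _ hN, incl_E₃, incl_E₃, T₃_tmul, T₃_tmul, ← mul_assoc, leg₁_apply, leg₁_apply,
    leg₁_apply, tmul_mul_tmul, map_mul, one_mul]

/-! ### Convolution by functionals -/

variable {H}

theorem SlicesInAlgebra.incl_leftConv {θ : Module.Dual ℂ A} (hθ : H.SlicesInAlgebra θ) (x : A) :
    incl (H.leftConv θ x) = H.leftSlice θ x := by
  obtain ⟨y, hy⟩ := (hθ x).1
  rw [leftConv, LinearMap.comp_apply, ← hy, retr_incl H.nondegenerate]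

theorem SlicesInAlgebra.incl_rightConv {θ : Module.Dual ℂ A} (hθ : H.SlicesInAlgebra θ) (x : A) :
    incl (H.rightConv θ x) = H.rightSlice θ x := by
  obtain ⟨y, hy⟩ := (hθ x).2
  rw [rightConv, LinearMap.comp_apply, ← hy, retr_incl H.nondegenerate]

theorem SlicesInAlgebra.leftConv_mul {θ : Module.Dual ℂ A} (hθ : H.SlicesInAlgebra θ) (x b : A) :
    H.leftConv θ x * b = sliceFst θ (H.E₂ (x ⊗ₜ b)) :=
  congrArg (fun m : Multiplier A => m.L b) (hθ.incl_leftConv x)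

theorem SlicesInAlgebra.mul_leftConv {θ : Module.Dual ℂ A} (hθ : H.SlicesInAlgebra θ) (x b : A) :
    b * H.leftConv θ x = sliceFst θ (H.E₄ (x ⊗ₜ b)) :=
  congrArg (fun m : Multiplier A => m.R b) (hθ.incl_leftConv x)

theorem SlicesInAlgebra.rightConv_mul {θ : Module.Dual ℂ A} (hθ : H.SlicesInAlgebra θ) (x b : A) :
    H.rightConv θ x * b = sliceSnd θ (H.E₁ (x ⊗ₜ b)) :=
  congrArg (fun m : Multiplier A => m.L b) (hθ.incl_rightConv x)

theorem SlicesInAlgebra.mul_rightConv {θ : Module.Dual ℂ A} (hθ : H.SlicesInAlgebra θ) (x b : A) :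
    b * H.rightConv θ x = sliceSnd θ (H.E₃ (x ⊗ₜ b)) :=
  congrArg (fun m : Multiplier A => m.R b) (hθ.incl_rightConv x)

variable (H)

theorem rightConv_leftTranslate (ω : Module.Dual ℂ A) (a x : A) :
    H.rightConv (leftTranslate ω a) x = sliceSnd ω (H.E₂ (x ⊗ₜ a)) := by
  rw [rightConv, LinearMap.comp_apply, rightSlice_leftTranslate, retr_incl H.nondegenerate]

theorem leftConv_leftTranslate (ω : Module.Dual ℂ A) (a x : A) :
    H.leftConv (leftTranslate ω a) x = sliceFst ω (H.E₁ (x ⊗ₜ a)) := by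
  rw [leftConv, LinearMap.comp_apply, leftSlice_leftTranslate, retr_incl H.nondegenerate]

end RegularMultiplierHopfAlgebra

/-- The functionals of the form `ω a` or `a ω`. -/
def IsTranslate {A : Type*} [NonUnitalRing A] [Module ℂ A] [IsScalarTower ℂ A A]
    [SMulCommClass ℂ A A] (α : Module.Dual ℂ A) : Prop :=
  ∃ (ω : Module.Dual ℂ A) (a : A), α = rightTranslate ω a ∨ α = leftTranslate ω a

namespace RegularMultiplierHopfAlgebra

variable {A : Type*} [NonUnitalRing A] [Module ℂ A] [IsScalarTower ℂ A A] [SMulCommClass ℂ A A]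
variable (H : RegularMultiplierHopfAlgebra A)

theorem isTranslate_rightTranslate (ω : Module.Dual ℂ A) (a : A) :
    IsTranslate (rightTranslate ω a) := ⟨ω, a, Or.inl rfl⟩

theorem isTranslate_leftTranslate (ω : Module.Dual ℂ A) (a : A) :
    IsTranslate (leftTranslate ω a) := ⟨ω, a, Or.inr rfl⟩

theorem slicesInAlgebra_of_isTranslate {α : Module.Dual ℂ A} (hα : IsTranslate α) :
    H.SlicesInAlgebra α := by
  obtain ⟨ω, a, rfl | rfl⟩ := hα
  · exact H.slicesInAlgebra_rightTranslate ω a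
  · exact H.slicesInAlgebra_leftTranslate ω a

variable {H}

/-- `(α ⊗ β)Δ(x)`, with either leg evaluated first. -/
theorem apply_rightConv_eq {α β : Module.Dual ℂ A} (hα : IsTranslate α)
    (hβ : H.SlicesInAlgebra β) (x : A) : α (H.rightConv β x) = β (H.leftConv α x) := by
  obtain ⟨ω, a, rfl | rfl⟩ := hα
  · rw [leftConv_rightTranslate, rightTranslate_apply, hβ.mul_rightConv, apply_sliceSnd]
  · rw [leftConv_leftTranslate, leftTranslate_apply, hβ.rightConv_mul, apply_sliceSnd]

/-- `apply_rightConv_eq` when the translate is in the second leg. -/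
theorem apply_rightConv_eq' {α β : Module.Dual ℂ A} (hα : H.SlicesInAlgebra α)
    (hβ : IsTranslate β) (x : A) : α (H.rightConv β x) = β (H.leftConv α x) := by
  obtain ⟨ω, a, rfl | rfl⟩ := hβ
  · rw [rightConv_rightTranslate, rightTranslate_apply, hα.mul_leftConv, apply_sliceSnd]
  · rw [rightConv_leftTranslate, leftTranslate_apply, hα.leftConv_mul, apply_sliceSnd]

variable (H)

/-- The span of the functionals `ω a`. -/
def rightTranslates (A : Type*) [NonUnitalRing A] [Module ℂ A] [IsScalarTower ℂ A A]
    [SMulCommClass ℂ A A] : Submodule ℂ (Module.Dual ℂ A) :=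
  Submodule.span ℂ {α | ∃ ω a, α = rightTranslate ω a}

theorem eq_of_forall_rightTranslate (H : RegularMultiplierHopfAlgebra A) {x y : A}
    (h : ∀ (ω : Module.Dual ℂ A) (a : A), ω (a * x) = ω (a * y)) : x = y := by
  refine sub_eq_zero.1 ((H.nondegenerate _).2 fun a => ?_)
  rw [mul_sub, sub_eq_zero]
  exact eq_of_forall_dual fun ω => h ω a

theorem rightTranslates_le : rightTranslates A ≤ H.multiplierFunctionals := by
  refine Submodule.span_le.2 ?_
  rintro _ ⟨ω, a, rfl⟩
  exact H.slicesInAlgebra_rightTranslate ω a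

theorem apply_rightConv_rightTranslates {α β : Module.Dual ℂ A} (hα : α ∈ rightTranslates A)
    (hβ : H.SlicesInAlgebra β) (x : A) : α (H.rightConv β x) = β (H.leftConv α x) := by
  induction hα using Submodule.span_induction with
  | mem α h =>
    obtain ⟨ω, a, rfl⟩ := h
    exact apply_rightConv_eq (isTranslate_rightTranslate ω a) hβ x
  | zero =>
    have h := H.leftConv_smul 0 0
    rw [zero_smul, zero_smul] at h
    simp [h]
  | add α α' _ _ h h' => rw [leftConv_add, LinearMap.add_apply, LinearMap.add_apply, h, h', map_add]
  | smul c α _ h => rw [leftConv_smul, LinearMap.smul_apply, LinearMap.smul_apply, h, map_smul]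

/-- Since `c ⊗ d` is a sum of elements `(q ⊗ 1)Δ(p)`, the product of two right translates is a
sum of right translates. -/
theorem comp_rightConv_mem (ω η : Module.Dual ℂ A) (c d : A) :
    rightTranslate ω c ∘ₗ H.rightConv (rightTranslate η d) ∈ rightTranslates A := by
  have key : ∀ u : A ⊗[ℂ] A, ∃ α ∈ rightTranslates A, ∀ x,
      α x = ω (sliceSnd η ((H.Δ x).R (H.E₃ u))) := by
    intro u
    induction u with
    | zero => exact ⟨0, Submodule.zero_mem _, by simp⟩
    | add s t hs ht =>
      obtain ⟨α, hα, h⟩ := hs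
      obtain ⟨β, hβ, h'⟩ := ht
      exact ⟨α + β, Submodule.add_mem _ hα hβ, fun x => by simp [h, h']⟩
    | tmul p q =>
      refine ⟨rightTranslate (ω ∘ₗ sliceSnd η ∘ₗ H.E₃ ∘ₗ (TensorProduct.mk ℂ A A).flip q) p,
        Submodule.subset_span ⟨_, _, rfl⟩, fun x => ?_⟩
      rw [Δ_R_E₃]
      rfl
  obtain ⟨u, hu⟩ := H.E₃_surjective (c ⊗ₜ d)
  obtain ⟨α, hα, h⟩ := key u
  convert hα
  ext x
  rw [h, hu, LinearMap.comp_apply, rightConv_rightTranslate, rightTranslate_apply,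
    ← leg₁_L_E₄, sliceSnd_L_leg₁]

/-- `(ι ⊗ α)Δ((ι ⊗ β)Δ(x)) = (ι ⊗ αβ)Δ(x)` for right translates `α` and `β`, where `αβ` is the
functional `(α ⊗ β)Δ`. -/
theorem rightConv_comp_rightTranslate (ω η : Module.Dual ℂ A) (c d x : A) :
    H.rightConv (rightTranslate ω c) (H.rightConv (rightTranslate η d) x) =
      H.rightConv (rightTranslate ω c ∘ₗ H.rightConv (rightTranslate η d)) x := by
  refine H.eq_of_forall_rightTranslate fun κ a => ?_
  have hκ := isTranslate_rightTranslate κ a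
  have hω := H.slicesInAlgebra_of_isTranslate (isTranslate_rightTranslate ω c)
  change rightTranslate κ a _ = rightTranslate κ a _
  rw [apply_rightConv_eq hκ hω,
    apply_rightConv_eq hκ (H.rightTranslates_le (H.comp_rightConv_mem ω η c d)),
    LinearMap.comp_apply, leftConv_rightConv_comm]

theorem leftConv_comp_rightTranslate (ω η : Module.Dual ℂ A) (c d x : A) :
    H.leftConv (rightTranslate ω c ∘ₗ H.rightConv (rightTranslate η d)) x =
      H.leftConv (rightTranslate η d) (H.leftConv (rightTranslate ω c) x) := by
  refine H.eq_of_forall_rightTranslate fun δ b => ?_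
  have h₀ := H.comp_rightConv_mem ω η c d
  have h₁ := H.comp_rightConv_mem η δ d b
  have hδ := isTranslate_rightTranslate δ b
  have hη := isTranslate_rightTranslate η d
  have hω := isTranslate_rightTranslate ω c
  have hR : ∀ {α : Module.Dual ℂ A}, IsTranslate α → H.SlicesInAlgebra α :=
    fun h => H.slicesInAlgebra_of_isTranslate h
  change rightTranslate δ b _ = rightTranslate δ b _
  rw [← apply_rightConv_eq' (H.rightTranslates_le h₀) hδ, ← apply_rightConv_eq' (hR hη) hδ,
    LinearMap.comp_apply, rightConv_comp_rightTranslate,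
    apply_rightConv_eq hω (H.rightTranslates_le h₁), LinearMap.comp_apply]

/-- Coassociativity for a functional `θ` that is not a translate: `θ` commutes with translates
because it associates with their products, which are again sums of translates. -/
theorem leftConv_rightTranslate_comm {θ : Module.Dual ℂ A} (hθ : H.SlicesInAlgebra θ)
    (ω : Module.Dual ℂ A) (c x : A) :
    H.leftConv (rightTranslate ω c) (H.rightConv θ x) =
      H.rightConv θ (H.leftConv (rightTranslate ω c) x) := by
  refine H.eq_of_forall_rightTranslate fun η d => ?_
  have hη := isTranslate_rightTranslate η d
  have hω := isTranslate_rightTranslate ω c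
  change rightTranslate η d _ = rightTranslate η d _
  rw [apply_rightConv_eq hη hθ, ← leftConv_comp_rightTranslate,
    ← apply_rightConv_rightTranslates H (H.comp_rightConv_mem ω η c d) hθ, LinearMap.comp_apply,
    apply_rightConv_eq hω (H.slicesInAlgebra_of_isTranslate hη)]

/-- Coassociativity `(c ⊗ 1)Δ((ι ⊗ θ)Δ(x)) = (ι ⊗ ι ⊗ θ)((c ⊗ 1 ⊗ 1)Δ⁽²⁾(x))`. -/
theorem E₃_rightConv {θ : Module.Dual ℂ A} (hθ : H.SlicesInAlgebra θ) (x c : A) :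
    H.E₃ (H.rightConv θ x ⊗ₜ c) = LinearMap.lTensor A (H.rightConv θ) (H.E₃ (x ⊗ₜ c)) := by
  refine eq_of_sliceFst fun ω => ?_
  rw [sliceFst_lTensor, ← leftConv_rightTranslate, ← leftConv_rightTranslate,
    leftConv_rightTranslate_comm H hθ]

/-- Coassociativity `Δ((ι ⊗ θ)Δ(x))(c ⊗ 1) = (ι ⊗ ι ⊗ θ)(Δ⁽²⁾(x)(c ⊗ 1 ⊗ 1))`. -/
theorem E₁_rightConv {θ : Module.Dual ℂ A} (hθ : H.SlicesInAlgebra θ) (x c : A) :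
    H.E₁ (H.rightConv θ x ⊗ₜ c) = LinearMap.lTensor A (H.rightConv θ) (H.E₁ (x ⊗ₜ c)) := by
  refine eq_of_sliceSnd fun ω => ?_
  have h : ∀ d t, d * sliceSnd ω (LinearMap.lTensor A (H.rightConv θ) t) =
      sliceSnd ω (LinearMap.lTensor A (H.rightConv θ) ((leg₁ A A d).L t)) := fun d t => by
    simp only [sliceSnd_lTensor, sliceSnd_L_leg₁]
  have h' : ∀ d t, sliceSnd ω (LinearMap.lTensor A (H.rightConv θ) t) * d =
      sliceSnd ω (LinearMap.lTensor A (H.rightConv θ) ((leg₁ A A d).R t)) := fun d t => by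
    simp only [sliceSnd_lTensor, sliceSnd_R_leg₁]
  refine sub_eq_zero.1 ((H.nondegenerate _).2 fun d => ?_)
  rw [mul_sub, sub_eq_zero, h, ← sliceSnd_L_leg₁, leg₁_L_E₁, leg₁_L_E₁, ← h', sliceSnd_R_leg₁,
    E₃_rightConv H hθ]

theorem leftConv_rightConv_comm_of_left {α θ : Module.Dual ℂ A} (hα : IsTranslate α)
    (hθ : H.SlicesInAlgebra θ) (x : A) :
    H.leftConv α (H.rightConv θ x) = H.rightConv θ (H.leftConv α x) := by
  obtain ⟨ω, a, rfl | rfl⟩ := hα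
  · exact H.leftConv_rightTranslate_comm hθ ω a x
  · rw [leftConv_leftTranslate, leftConv_leftTranslate, E₁_rightConv H hθ, sliceFst_lTensor]

theorem apply_rightConv_rightTranslates' {α β : Module.Dual ℂ A} (hα : H.SlicesInAlgebra α)
    (hβ : β ∈ rightTranslates A) (x : A) : α (H.rightConv β x) = β (H.leftConv α x) := by
  induction hβ using Submodule.span_induction with
  | mem β h =>
    obtain ⟨ω, a, rfl⟩ := h
    exact apply_rightConv_eq' hα (isTranslate_rightTranslate ω a) x
  | zero =>
    have h := H.rightConv_smul 0 0
    rw [zero_smul, zero_smul] at h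
    simp [h]
  | add β β' _ _ h h' =>
    rw [rightConv_add, LinearMap.add_apply, LinearMap.add_apply, map_add, h, h']
  | smul c β _ h => rw [rightConv_smul, LinearMap.smul_apply, LinearMap.smul_apply, map_smul, h]

theorem rightConv_rightTranslate_comm {θ : Module.Dual ℂ A} (hθ : H.SlicesInAlgebra θ)
    (ω : Module.Dual ℂ A) (c x : A) :
    H.leftConv θ (H.rightConv (rightTranslate ω c) x) =
      H.rightConv (rightTranslate ω c) (H.leftConv θ x) := by
  refine H.eq_of_forall_rightTranslate fun η d => ?_
  have hη := isTranslate_rightTranslate η d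
  have hω := H.slicesInAlgebra_of_isTranslate (isTranslate_rightTranslate ω c)
  change rightTranslate η d _ = rightTranslate η d _
  rw [← apply_rightConv_eq' hθ hη, rightConv_comp_rightTranslate,
    apply_rightConv_rightTranslates' H hθ (H.comp_rightConv_mem η ω d c), LinearMap.comp_apply]

/-- Coassociativity `(1 ⊗ c)Δ((θ ⊗ ι)Δ(x)) = (θ ⊗ ι ⊗ ι)((1 ⊗ 1 ⊗ c)Δ⁽²⁾(x))`. -/
theorem E₄_leftConv {θ : Module.Dual ℂ A} (hθ : H.SlicesInAlgebra θ) (x c : A) :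
    H.E₄ (H.leftConv θ x ⊗ₜ c) = LinearMap.rTensor A (H.leftConv θ) (H.E₄ (x ⊗ₜ c)) := by
  refine eq_of_sliceSnd fun ω => ?_
  rw [sliceSnd_rTensor, ← rightConv_rightTranslate, ← rightConv_rightTranslate,
    rightConv_rightTranslate_comm H hθ]

/-- Coassociativity `Δ((θ ⊗ ι)Δ(x))(1 ⊗ c) = (θ ⊗ ι ⊗ ι)(Δ⁽²⁾(x)(1 ⊗ 1 ⊗ c))`. -/
theorem E₂_leftConv {θ : Module.Dual ℂ A} (hθ : H.SlicesInAlgebra θ) (x c : A) :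
    H.E₂ (H.leftConv θ x ⊗ₜ c) = LinearMap.rTensor A (H.leftConv θ) (H.E₂ (x ⊗ₜ c)) := by
  refine eq_of_sliceFst fun ω => ?_
  have h : ∀ d t, d * sliceFst ω (LinearMap.rTensor A (H.leftConv θ) t) =
      sliceFst ω (LinearMap.rTensor A (H.leftConv θ) ((leg₂ A A d).L t)) := fun d t => by
    simp only [sliceFst_rTensor, sliceFst_L_leg₂]
  have h' : ∀ d t, sliceFst ω (LinearMap.rTensor A (H.leftConv θ) t) * d =
      sliceFst ω (LinearMap.rTensor A (H.leftConv θ) ((leg₂ A A d).R t)) := fun d t => by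
    simp only [sliceFst_rTensor, sliceFst_R_leg₂]
  refine sub_eq_zero.1 ((H.nondegenerate _).2 fun d => ?_)
  rw [mul_sub, sub_eq_zero, h, ← sliceFst_L_leg₂, leg₂_L_E₂, leg₂_L_E₂, ← h', sliceFst_R_leg₂,
    E₄_leftConv H hθ]

theorem leftConv_rightConv_comm_of_right {α θ : Module.Dual ℂ A} (hα : IsTranslate α)
    (hθ : H.SlicesInAlgebra θ) (x : A) :
    H.leftConv θ (H.rightConv α x) = H.rightConv α (H.leftConv θ x) := by
  obtain ⟨ω, a, rfl | rfl⟩ := hα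
  · exact H.rightConv_rightTranslate_comm hθ ω a x
  · rw [rightConv_leftTranslate, rightConv_leftTranslate, E₂_leftConv H hθ, sliceSnd_rTensor]

/-! ### The algebra is spanned by slices -/

theorem sliceFst_surjective {ω : Module.Dual ℂ A} (hω : ω ≠ 0) (y : A) :
    ∃ t : A ⊗[ℂ] A, sliceFst ω t = y := by
  obtain ⟨e, he⟩ : ∃ e, ω e ≠ 0 := by
    by_contra! h
    exact hω (LinearMap.ext h)
  exact ⟨((ω e)⁻¹ • e) ⊗ₜ y, by simp [he]⟩

theorem sliceSnd_surjective {ω : Module.Dual ℂ A} (hω : ω ≠ 0) (y : A) :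
    ∃ t : A ⊗[ℂ] A, sliceSnd ω t = y := by
  obtain ⟨e, he⟩ : ∃ e, ω e ≠ 0 := by
    by_contra! h
    exact hω (LinearMap.ext h)
  exact ⟨y ⊗ₜ ((ω e)⁻¹ • e), by simp [he]⟩

/-- The elements `(ω c ⊗ ι)Δ(x)` span `A`, because the elements `(c ⊗ 1)Δ(x)` span `A ⊗ A`. -/
theorem induction_leftConv_rightTranslate {ω : Module.Dual ℂ A} (hω : ω ≠ 0) {P : A → Prop}
    (h0 : P 0) (hadd : ∀ x y, P x → P y → P (x + y))
    (h : ∀ c x, P (H.leftConv (rightTranslate ω c) x)) (y : A) : P y := by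
  obtain ⟨t, rfl⟩ := sliceFst_surjective hω y
  obtain ⟨u, rfl⟩ := H.E₃_surjective t
  induction u with
  | zero => simpa using h0
  | add s s' hs hs' => simpa using hadd _ _ hs hs'
  | tmul p q => simpa only [leftConv_rightTranslate] using h q p

/-- The elements `(ι ⊗ ω c)Δ(x)` span `A`, because the elements `(1 ⊗ c)Δ(x)` span `A ⊗ A`. -/
theorem induction_rightConv_rightTranslate {ω : Module.Dual ℂ A} (hω : ω ≠ 0) {P : A → Prop}
    (h0 : P 0) (hadd : ∀ x y, P x → P y → P (x + y))
    (h : ∀ c x, P (H.rightConv (rightTranslate ω c) x)) (y : A) : P y := by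
  obtain ⟨t, rfl⟩ := sliceSnd_surjective hω y
  obtain ⟨u, rfl⟩ := H.E₄_bijective.2 t
  induction u with
  | zero => simpa using h0
  | add s s' hs hs' => simpa using hadd _ _ hs hs'
  | tmul p q => simpa only [rightConv_rightTranslate] using h q p

/-- The elements `(ι ⊗ c ω)Δ(x)` span `A`, because the elements `Δ(x)(1 ⊗ c)` span `A ⊗ A`. -/
theorem induction_rightConv_leftTranslate {ω : Module.Dual ℂ A} (hω : ω ≠ 0) {P : A → Prop}
    (h0 : P 0) (hadd : ∀ x y, P x → P y → P (x + y))
    (h : ∀ c x, P (H.rightConv (leftTranslate ω c) x)) (y : A) : P y := by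
  obtain ⟨t, rfl⟩ := sliceSnd_surjective hω y
  obtain ⟨u, rfl⟩ := H.E₂_bijective.2 t
  induction u with
  | zero => simpa using h0
  | add s s' hs hs' => simpa using hadd _ _ hs hs'
  | tmul p q => simpa only [rightConv_leftTranslate] using h q p

end RegularMultiplierHopfAlgebra

/-! ### Counits and antipodes: uniqueness and criteria -/

section Criteria

variable {A : Type*} [NonUnitalRing A] [Module ℂ A] [IsScalarTower ℂ A A] [SMulCommClass ℂ A A]

theorem sliceFst_mul (χ : A →ₙₐ[ℂ] ℂ) (s t : A ⊗[ℂ] A) :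
    sliceFst (χ : A →ₗ[ℂ] ℂ) (s * t) =
      sliceFst (χ : A →ₗ[ℂ] ℂ) s * sliceFst (χ : A →ₗ[ℂ] ℂ) t := by
  induction s with
  | zero => simp
  | add s s' hs hs' => simp only [map_add, add_mul, hs, hs']
  | tmul a b =>
    induction t with
    | zero => simp
    | add s s' hs hs' => simp only [map_add, mul_add, hs, hs']
    | tmul c d => simp [smul_mul_smul_comm]

theorem sliceSnd_mul (χ : A →ₙₐ[ℂ] ℂ) (s t : A ⊗[ℂ] A) :
    sliceSnd (χ : A →ₗ[ℂ] ℂ) (s * t) =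
      sliceSnd (χ : A →ₗ[ℂ] ℂ) s * sliceSnd (χ : A →ₗ[ℂ] ℂ) t := by
  induction s with
  | zero => simp
  | add s s' hs hs' => simp only [map_add, add_mul, hs, hs']
  | tmul a b =>
    induction t with
    | zero => simp
    | add s s' hs hs' => simp only [map_add, mul_add, hs, hs']
    | tmul c d => simp [smul_mul_smul_comm]

theorem sliceFst_leg₁_R (χ : A →ₙₐ[ℂ] ℂ) (c : A) (t : A ⊗[ℂ] A) :
    sliceFst (χ : A →ₗ[ℂ] ℂ) ((leg₁ A A c).R t) = χ c • sliceFst (χ : A →ₗ[ℂ] ℂ) t := by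
  rw [leg₁_R_eq]
  induction t with
  | zero => simp
  | add s s' hs hs' => simp only [map_add, smul_add, hs, hs']
  | tmul a b => simp [mul_comm, mul_smul]

/-- A character `ε` with `(ε ⊗ ι)(Δ(a)(1 ⊗ b)) = a b` and `(ι ⊗ ε)(Δ(a)(1 ⊗ b)) = ε(b) a` is a
counit. -/
theorem isCounit_of_slices (hA : NondegenerateAlgebra A) (Δ : A →ₙₐ[ℂ] Multiplier (A ⊗[ℂ] A))
    (ε : A →ₙₐ[ℂ] ℂ) (hε : ε ≠ 0)
    (h : ∀ a b, ∃ t : A ⊗[ℂ] A, incl t = Δ a * leg₂ A A b ∧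
      sliceFst (ε : A →ₗ[ℂ] ℂ) t = a * b ∧ sliceSnd (ε : A →ₗ[ℂ] ℂ) t = ε b • a) :
    IsCounit Δ ε := by
  have hN := hA.tensor hA
  obtain ⟨e, he⟩ : ∃ e, ε e = 1 := by
    by_contra hne
    apply hε
    ext a
    by_contra ha
    exact hne ⟨(ε a)⁻¹ • a, by rw [map_smul, smul_eq_mul, inv_mul_cancel₀ ha]⟩
  have hL : ∀ a p q, ∃ t : A ⊗[ℂ] A, (Δ a).L (p ⊗ₜ q) = (leg₁ A A p).R t ∧
      sliceFst (ε : A →ₗ[ℂ] ℂ) t = a * q ∧ sliceSnd (ε : A →ₗ[ℂ] ℂ) t = ε q • a := by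
    intro a p q
    obtain ⟨t, ht, h1, h2⟩ := h a q
    refine ⟨t, incl_injective hN ?_, h1, h2⟩
    rw [← mul_incl _ _ hN, ← incl_mul _ _ hN, ht, mul_assoc, leg₂_mul_leg₁]
  have hL1 : ∀ a t, sliceFst (ε : A →ₗ[ℂ] ℂ) ((Δ a).L t) = a * sliceFst (ε : A →ₗ[ℂ] ℂ) t := by
    intro a t
    induction t with
    | zero => simp
    | add s s' hs hs' => simp only [map_add, mul_add, hs, hs']
    | tmul p q =>
      obtain ⟨t, ht, h1, -⟩ := hL a p q
      rw [ht, sliceFst_leg₁_R, h1, sliceFst_tmul, mul_smul_comm]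
      rfl
  have hL2 : ∀ a t, sliceSnd (ε : A →ₗ[ℂ] ℂ) ((Δ a).L t) = a * sliceSnd (ε : A →ₗ[ℂ] ℂ) t := by
    intro a t
    induction t with
    | zero => simp
    | add s s' hs hs' => simp only [map_add, mul_add, hs, hs']
    | tmul p q =>
      obtain ⟨t, ht, -, h2⟩ := hL a p q
      rw [ht, RegularMultiplierHopfAlgebra.sliceSnd_R_leg₁, h2, sliceSnd_tmul, mul_smul_comm,
        smul_mul_assoc]
      rfl
  refine ⟨hε, fun a t => ⟨?_, ?_⟩, fun a t => ⟨?_, ?_⟩⟩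
  · exact (map_mul incl _ _).symm.trans (congrArg incl (hL1 a t).symm)
  · refine (map_mul incl _ _).symm.trans (congrArg incl ?_)
    refine sub_eq_zero.1 ((hA _).1 fun b => ?_)
    have hb : sliceFst (ε : A →ₗ[ℂ] ℂ) (e ⊗ₜ[ℂ] b) = b := by simp [he]
    rw [sub_mul, sub_eq_zero]
    nth_rw 1 [← hb]
    nth_rw 2 [← hb]
    rw [← sliceFst_mul, balanced, sliceFst_mul, hL1, mul_assoc]
  · exact (map_mul incl _ _).symm.trans (congrArg incl (hL2 a t).symm)
  · refine (map_mul incl _ _).symm.trans (congrArg incl ?_)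
    refine sub_eq_zero.1 ((hA _).1 fun b => ?_)
    have hb : sliceSnd (ε : A →ₗ[ℂ] ℂ) (b ⊗ₜ[ℂ] e) = b := by simp [he]
    rw [sub_mul, sub_eq_zero]
    nth_rw 1 [← hb]
    nth_rw 2 [← hb]
    rw [← sliceSnd_mul, balanced, sliceSnd_mul, hL2, mul_assoc]

theorem IsCounit.sliceFst_L (hA : NondegenerateAlgebra A) {Δ : A →ₙₐ[ℂ] Multiplier (A ⊗[ℂ] A)}
    {ε : A →ₙₐ[ℂ] ℂ} (h : IsCounit Δ ε) (a : A) (t : A ⊗[ℂ] A) :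
    sliceFst (ε : A →ₗ[ℂ] ℂ) ((Δ a).L t) = a * sliceFst (ε : A →ₗ[ℂ] ℂ) t :=
  incl_injective hA (by rw [map_mul]; exact ((h.left a t).1).symm)

theorem IsCounit.sliceSnd_L (hA : NondegenerateAlgebra A) {Δ : A →ₙₐ[ℂ] Multiplier (A ⊗[ℂ] A)}
    {ε : A →ₙₐ[ℂ] ℂ} (h : IsCounit Δ ε) (a : A) (t : A ⊗[ℂ] A) :
    sliceSnd (ε : A →ₗ[ℂ] ℂ) ((Δ a).L t) = a * sliceSnd (ε : A →ₗ[ℂ] ℂ) t :=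
  incl_injective hA (by rw [map_mul]; exact ((h.right a t).1).symm)

/-- Two counits agree: both are read off from `(ε ⊗ ε')(Δ(a)(e ⊗ e'))`. -/
theorem IsCounit.unique (hA : NondegenerateAlgebra A) {Δ : A →ₙₐ[ℂ] Multiplier (A ⊗[ℂ] A)}
    {ε ε' : A →ₙₐ[ℂ] ℂ} (h : IsCounit Δ ε) (h' : IsCounit Δ ε') : ε = ε' := by
  obtain ⟨e, he⟩ := h.exists_eq_one
  obtain ⟨e', he'⟩ := h'.exists_eq_one
  ext a
  have h1 := congrArg ε' (h.sliceFst_L hA a (e ⊗ₜ e'))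
  have h2 := congrArg ε (h'.sliceSnd_L hA a (e ⊗ₜ e'))
  have h3 := apply_sliceSnd (ε : A →ₗ[ℂ] ℂ) (ε' : A →ₗ[ℂ] ℂ) ((Δ a).L (e ⊗ₜ e'))
  have h4 := (h2.symm.trans h3).trans h1
  simpa [he, he'] using h4

/-- Two antipodes agree when the elements `Δ(a)(1 ⊗ b)` span `A ⊗ A`. -/
theorem IsAntipode.unique (hA : NondegenerateAlgebra A) {Δ : A →ₙₐ[ℂ] Multiplier (A ⊗[ℂ] A)}
    {ε : A →ₙₐ[ℂ] ℂ} {S S' : A ≃ₗ[ℂ] A} (E : A ⊗[ℂ] A →ₗ[ℂ] A ⊗[ℂ] A)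
    (hE : Function.Surjective E) (hE' : ∀ a b, incl (E (a ⊗ₜ b)) = Δ a * leg₂ A A b)
    (h : IsAntipode Δ ε S) (h' : IsAntipode Δ ε S') : S = S' := by
  have hN := hA.tensor hA
  have key : ∀ t : A ⊗[ℂ] A, LinearMap.mul' ℂ A (TensorProduct.map S.toLinearMap LinearMap.id t) =
      LinearMap.mul' ℂ A (TensorProduct.map S'.toLinearMap LinearMap.id t) := by
    intro t
    obtain ⟨u, rfl⟩ := hE t
    induction u with
    | zero => simp
    | add s s' hs hs' => simp only [map_add, hs, hs']
    | tmul a b =>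
      obtain ⟨s, hs, h1⟩ := h.left a b
      obtain ⟨s', hs', h1'⟩ := h'.left a b
      have e : s = E (a ⊗ₜ b) := incl_injective hN (by rw [hs, hE'])
      have e' : s' = E (a ⊗ₜ b) := incl_injective hN (by rw [hs', hE'])
      rw [e] at h1
      rw [e'] at h1'
      rw [h1, h1']
  ext a
  refine sub_eq_zero.1 ((hA _).1 fun b => ?_)
  rw [sub_mul, sub_eq_zero]
  simpa using key (a ⊗ₜ b)

end Criteria

/-! ### The counit of a regular multiplier Hopf algebra -/

namespace RegularMultiplierHopfAlgebra

variable {A : Type*} [NonUnitalRing A] [Module ℂ A] [IsScalarTower ℂ A A] [SMulCommClass ℂ A A]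
variable (H : RegularMultiplierHopfAlgebra A)

theorem E₂_rTensor_leftConv {θ : Module.Dual ℂ A} (hθ : H.SlicesInAlgebra θ) (u : A ⊗[ℂ] A) :
    H.E₂ (LinearMap.rTensor A (H.leftConv θ) u) =
      LinearMap.rTensor A (H.leftConv θ) (H.E₂ u) := by
  induction u with
  | zero => simp
  | add s s' hs hs' => simp only [map_add, hs, hs']
  | tmul a b => rw [LinearMap.rTensor_tmul, E₂_leftConv H hθ]

theorem E₁_rTensor_rightConv {θ : Module.Dual ℂ A} (hθ : H.SlicesInAlgebra θ) (u : A ⊗[ℂ] A) :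
    H.E₁ (LinearMap.rTensor A (H.rightConv θ) u) =
      LinearMap.lTensor A (H.rightConv θ) (H.E₁ u) := by
  induction u with
  | zero => simp
  | add s s' hs hs' => simp only [map_add, hs, hs']
  | tmul a b => rw [LinearMap.rTensor_tmul, E₁_rightConv H hθ]

theorem E₃_rTensor_rightConv {θ : Module.Dual ℂ A} (hθ : H.SlicesInAlgebra θ) (u : A ⊗[ℂ] A) :
    H.E₃ (LinearMap.rTensor A (H.rightConv θ) u) =
      LinearMap.lTensor A (H.rightConv θ) (H.E₃ u) := by
  induction u with
  | zero => simp
  | add s s' hs hs' => simp only [map_add, hs, hs']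
  | tmul a b => rw [LinearMap.rTensor_tmul, E₃_rightConv H hθ]

/-- If `Δ(p)(1 ⊗ q)` sums to `(α ⊗ ι)Δ(a) ⊗ b`, then `p q` sums to `α(a) b`. -/
theorem mul'_eq_of_E₂_eq {α : Module.Dual ℂ A} (hα : H.SlicesInAlgebra α) (a b : A)
    (v : A ⊗[ℂ] A) (hv : H.E₂ v = H.leftConv α a ⊗ₜ b) : LinearMap.mul' ℂ A v = α a • b := by
  obtain ⟨u, hu⟩ := H.E₂_bijective.2 (a ⊗ₜ b)
  have h : v = LinearMap.rTensor A (H.leftConv α) u := by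
    apply H.E₂_bijective.1
    rw [hv, E₂_rTensor_leftConv H hα, hu, LinearMap.rTensor_tmul]
  rw [h, ← sliceFst_tmul, ← hu]
  clear h hv hu
  induction u with
  | zero => simp
  | add s s' hs hs' => simp only [map_add, hs, hs']
  | tmul p q => rw [LinearMap.rTensor_tmul, LinearMap.mul'_apply, hα.leftConv_mul]

/-- The counit is defined by `m(u) = ε(a) b` where `a ⊗ b = ∑ Δ(p)(1 ⊗ q)` and `u = ∑ p ⊗ q`. It is
enough to see this when `a = (α ⊗ ι)Δ(x)`, where `m(u) = α(x) b`; slices of this form span `A`. -/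
theorem exists_counit [Nontrivial A] : ∃ ε : A →ₙₐ[ℂ] ℂ, IsCounit H.Δ ε := by
  obtain ⟨b₀, hb₀⟩ := exists_ne (0 : A)
  obtain ⟨ω₀, hω₀⟩ : ∃ ω : Module.Dual ℂ A, ω b₀ = 1 := by
    obtain ⟨ω, hω⟩ : ∃ ω : Module.Dual ℂ A, ω b₀ ≠ 0 := by
      by_contra! h
      exact hb₀ ((Module.forall_dual_apply_eq_zero_iff ℂ _).1 h)
    exact ⟨(ω b₀)⁻¹ • ω, by simp [hω]⟩
  have hω₀' : ω₀ ≠ 0 := fun h => by simp [h] at hω₀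
  let e := LinearEquiv.ofBijective H.E₂ H.E₂_bijective
  have he : ∀ t, H.E₂ (e.symm t) = t := fun t => e.apply_symm_apply t
  -- `D (a ⊗ b)` is to be `ε(a) b`
  let D : A ⊗[ℂ] A →ₗ[ℂ] A := LinearMap.mul' ℂ A ∘ₗ e.symm.toLinearMap
  have hD : ∀ {α : Module.Dual ℂ A}, H.SlicesInAlgebra α → ∀ a b,
      D (H.leftConv α a ⊗ₜ b) = α a • b := fun hα a b =>
    H.mul'_eq_of_E₂_eq hα a b _ (he _)
  have hs : ∀ a, ∃ s : ℂ, ∀ b, D (a ⊗ₜ b) = s • b := by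
    refine H.induction_leftConv_rightTranslate hω₀' ⟨0, by simp⟩ ?_ fun c x => ?_
    · rintro x y ⟨s, hs⟩ ⟨s', hs'⟩
      exact ⟨s + s', fun b => by rw [TensorProduct.add_tmul, map_add, hs, hs', add_smul]⟩
    · exact ⟨_, fun b => hD (H.slicesInAlgebra_rightTranslate ω₀ c) x b⟩
  let ε₀ : Module.Dual ℂ A := ω₀ ∘ₗ D ∘ₗ (TensorProduct.mk ℂ A A).flip b₀
  have hε₀ : ∀ a b, D (a ⊗ₜ b) = ε₀ a • b := by
    intro a b
    obtain ⟨s, hs⟩ := hs a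
    have : ε₀ a = s := by simp [ε₀, hs, hω₀]
    rw [this, hs]
  have hε₁ : ∀ t, D t = sliceFst ε₀ t := by
    intro t
    induction t with
    | zero => simp
    | add s s' hs hs' => simp only [map_add, hs, hs']
    | tmul a b => rw [hε₀, sliceFst_tmul]
  have hE₂ : ∀ t, sliceFst ε₀ (H.E₂ t) = LinearMap.mul' ℂ A t := fun t => by
    rw [← hε₁]
    change LinearMap.mul' ℂ A (e.symm (e t)) = _
    rw [e.symm_apply_apply]
  have hε₂ : ∀ {α : Module.Dual ℂ A}, H.SlicesInAlgebra α → ∀ a, ε₀ (H.leftConv α a) = α a :=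
    fun hα a => by simp [ε₀, hD hα, hω₀]
  have hL : ∀ a t, sliceFst ε₀ ((H.Δ a).L t) = a * sliceFst ε₀ t := by
    intro a t
    obtain ⟨u, rfl⟩ := H.E₂_bijective.2 t
    rw [hE₂]
    induction u with
    | zero => simp
    | add s s' hs hs' => simp only [map_add, mul_add, hs, hs']
    | tmul p q => rw [Δ_L_E₂, hE₂, LinearMap.mul'_apply, LinearMap.mul'_apply, mul_assoc]
  -- multiplicativity: `(ε ⊗ ι)(v (p ⊗ 1)) = ε(p) (ε ⊗ ι)(v)`, checked on `v = Δ(a)(1 ⊗ q)`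
  have hmul₁ : ∀ p v, sliceFst ε₀ ((leg₁ A A p).R v) = ε₀ p • sliceFst ε₀ v := by
    intro p v
    obtain ⟨u, rfl⟩ := H.E₂_bijective.2 v
    induction u with
    | zero => simp
    | add s s' hs hs' => simp only [map_add, smul_add, hs, hs']
    | tmul a q => rw [leg₁_R_E₂, hL, hE₂, sliceFst_tmul, mul_smul_comm, LinearMap.mul'_apply]
  have hmul : ∀ x p, ε₀ (x * p) = ε₀ x * ε₀ p := by
    intro x p
    have := congrArg ω₀ (hmul₁ p (x ⊗ₜ b₀))
    rw [leg₁_R_eq] at this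
    simpa [hω₀, mul_comm] using this
  let ε : A →ₙₐ[ℂ] ℂ :=
    { toFun := ε₀, map_smul' := fun c x => map_smul ε₀ c x, map_zero' := map_zero ε₀,
      map_add' := map_add ε₀, map_mul' := hmul }
  have hε : (ε : A →ₗ[ℂ] ℂ) = ε₀ := rfl
  have hE₃ : ∀ a c, sliceSnd ε₀ (H.E₃ (a ⊗ₜ c)) = c * a := fun a c =>
    eq_of_forall_dual fun ω => by
      rw [apply_sliceSnd, ← leftConv_rightTranslate, hε₂ (H.slicesInAlgebra_rightTranslate ω c),
        rightTranslate_apply]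
  have hne : ε₀ ≠ 0 := by
    intro h0
    apply hω₀'
    have hz : ∀ (ω : Module.Dual ℂ A) (c x : A), ω (c * x) = 0 := fun ω c x => by
      rw [← rightTranslate_apply, ← hε₂ (H.slicesInAlgebra_rightTranslate ω c), h0,
        LinearMap.zero_apply]
    have : b₀ = 0 := H.eq_of_forall_rightTranslate fun ω c => by rw [hz, mul_zero, map_zero]
    exact absurd this hb₀
  refine ⟨ε, isCounit_of_slices H.nondegenerate _ ε (fun h => hne (by rw [← hε, h]; rfl)) ?_⟩
  intro a b
  refine ⟨H.E₂ (a ⊗ₜ b), by rw [incl_E₂, T₂_tmul], by rw [hε, hE₂, LinearMap.mul'_apply], ?_⟩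
  refine sub_eq_zero.1 ((H.nondegenerate _).2 fun c => ?_)
  have hR : ∀ t, sliceSnd ε₀ ((leg₂ A A b).R t) = ε₀ b • sliceSnd ε₀ t := by
    intro t
    rw [leg₂_R_eq]
    induction t with
    | zero => simp
    | add s s' hs hs' => simp only [map_add, smul_add, hs, hs']
    | tmul p q => simp [hmul, mul_comm, mul_smul]
  rw [hε, mul_sub, sub_eq_zero, ← sliceSnd_L_leg₁, leg₁_L_E₂, hR, hE₃, mul_smul_comm]
  rfl

theorem sliceFst_coe_tmul (χ : A →ₙₐ[ℂ] ℂ) (a b : A) :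
    sliceFst (χ : A →ₗ[ℂ] ℂ) (a ⊗ₜ[ℂ] b) = χ a • b := sliceFst_tmul _ _ _

variable {H} {ε : A →ₙₐ[ℂ] ℂ}

theorem sliceSnd_leg₂_R (χ : A →ₙₐ[ℂ] ℂ) (c : A) (t : A ⊗[ℂ] A) :
    sliceSnd (χ : A →ₗ[ℂ] ℂ) ((leg₂ A A c).R t) = χ c • sliceSnd (χ : A →ₗ[ℂ] ℂ) t := by
  rw [leg₂_R_eq]
  induction t with
  | zero => simp
  | add s s' hs hs' => simp only [map_add, smul_add, hs, hs']
  | tmul a b => simp [mul_comm, mul_smul]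

theorem sliceFst_counit_E₁ (hε : IsCounit H.Δ ε) (a p : A) :
    sliceFst (ε : A →ₗ[ℂ] ℂ) (H.E₁ (a ⊗ₜ p)) = ε p • a := by
  refine sub_eq_zero.1 ((H.nondegenerate _).1 fun b => ?_)
  have h := hε.sliceFst_L H.nondegenerate a (p ⊗ₜ b)
  rw [← leg₂_R_E₁, sliceFst_R_leg₂] at h
  rw [sub_mul, h, sliceFst_tmul, sub_eq_zero, mul_smul_comm, smul_mul_assoc]
  rfl

theorem sliceSnd_counit_E₂ (hε : IsCounit H.Δ ε) (a b : A) :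
    sliceSnd (ε : A →ₗ[ℂ] ℂ) (H.E₂ (a ⊗ₜ b)) = ε b • a := by
  refine sub_eq_zero.1 ((H.nondegenerate _).1 fun p => ?_)
  have h := hε.sliceSnd_L H.nondegenerate a (p ⊗ₜ b)
  rw [← leg₁_R_E₂, sliceSnd_R_leg₁] at h
  rw [sub_mul, h, sliceSnd_tmul, sub_eq_zero, mul_smul_comm, smul_mul_assoc]
  rfl

theorem sliceSnd_counit_E₃ (hε : IsCounit H.Δ ε) (a c : A) :
    sliceSnd (ε : A →ₗ[ℂ] ℂ) (H.E₃ (a ⊗ₜ c)) = c * a := by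
  obtain ⟨e, he⟩ := hε.exists_eq_one
  have h := congrArg (sliceSnd (ε : A →ₗ[ℂ] ℂ)) (H.leg₁_L_E₂ a e c)
  rw [sliceSnd_L_leg₁, sliceSnd_counit_E₂ hε, sliceSnd_leg₂_R, he, one_smul, one_smul] at h
  exact h.symm

theorem counit_leftConv (hε : IsCounit H.Δ ε) {α : Module.Dual ℂ A} (hα : H.SlicesInAlgebra α)
    (x : A) : ε (H.leftConv α x) = α x := by
  obtain ⟨e, he⟩ := hε.exists_eq_one
  have h := congrArg ε (hα.leftConv_mul x e)
  rw [map_mul, he, mul_one] at h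
  rw [h]
  refine (apply_sliceSnd α (ε : A →ₗ[ℂ] ℂ) _).symm.trans ?_
  rw [sliceSnd_counit_E₂ hε, he, one_smul]

theorem counit_rightConv (hε : IsCounit H.Δ ε) {α : Module.Dual ℂ A} (hα : H.SlicesInAlgebra α)
    (x : A) : ε (H.rightConv α x) = α x := by
  obtain ⟨e, he⟩ := hε.exists_eq_one
  have h := congrArg ε (hα.rightConv_mul x e)
  rw [map_mul, he, mul_one] at h
  rw [h]
  refine (apply_sliceSnd (ε : A →ₗ[ℂ] ℂ) α _).trans ?_
  rw [sliceFst_counit_E₁ hε, he, one_smul]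

end RegularMultiplierHopfAlgebra

namespace AlgebraicQuantumGroup

open RegularMultiplierHopfAlgebra

variable {A : Type*} [NonUnitalRing A] [Module ℂ A] [IsScalarTower ℂ A A] [SMulCommClass ℂ A A]
variable (G : AlgebraicQuantumGroup A)

/-! ### The antipode of an algebraic quantum group -/

theorem sliceSnd_φ_E₁ (x b : A) : sliceSnd G.φ (G.E₁ (x ⊗ₜ b)) = G.φ x • b :=
  congrArg (fun m : Multiplier A => m.L b) (G.left_invariant x)

theorem sliceSnd_φ_E₃ (x b : A) : sliceSnd G.φ (G.E₃ (x ⊗ₜ b)) = G.φ x • b :=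
  congrArg (fun m : Multiplier A => m.R b) (G.left_invariant x)

theorem nontrivial (G : AlgebraicQuantumGroup A) : Nontrivial A := by
  by_contra h
  rw [not_nontrivial_iff_subsingleton] at h
  exact G.φ_ne_zero (LinearMap.ext fun x => by rw [Subsingleton.elim x 0, map_zero, map_zero])

/-- Write `x ⊗ b = ∑ (q ⊗ 1)Δ(p)`. By coassociativity `v = ∑ (ι ⊗ φ)(Δ(p)(1 ⊗ y)) ⊗ q`, so the
left side is `∑ φ(p y) q`, which is `(ι ⊗ φ)((x ⊗ b)Δ(y))` by left invariance. -/
theorem sliceFst_counit_of_E₃_eq {ε : A →ₙₐ[ℂ] ℂ} (hε : IsCounit G.Δ ε) (b x y : A)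
    (v : A ⊗[ℂ] A) (hv : G.E₃ v = x ⊗ₜ G.rightConv (leftTranslate G.φ y) b) :
    sliceFst (ε : A →ₗ[ℂ] ℂ) v = x * G.rightConv (rightTranslate G.φ b) y := by
  have hy := G.slicesInAlgebra_leftTranslate G.φ y
  obtain ⟨u, hu⟩ := G.E₃_surjective (x ⊗ₜ b)
  have h : v = LinearMap.rTensor A (G.rightConv (leftTranslate G.φ y)) u := by
    apply G.E₃_bijective.1
    rw [hv, E₃_rTensor_rightConv _ hy, hu, LinearMap.lTensor_tmul]
  have h' : ∀ u, sliceFst (ε : A →ₗ[ℂ] ℂ)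
      (LinearMap.rTensor A (G.rightConv (leftTranslate G.φ y)) u) =
      sliceSnd G.φ ((G.Δ y).R (G.E₃ u)) := by
    intro u
    induction u with
    | zero => simp
    | add s s' hs hs' => simp only [map_add, hs, hs']
    | tmul p q =>
      rw [LinearMap.rTensor_tmul, Δ_R_E₃, sliceSnd_φ_E₃, sliceFst_coe_tmul,
        counit_rightConv hε hy, leftTranslate_apply]
  rw [h, h', hu, rightConv_rightTranslate, ← leg₁_L_E₄, sliceSnd_L_leg₁]

/-- Write `x ⊗ y = ∑ Δ(p)(q ⊗ 1)`. By coassociativity `v = ∑ (ι ⊗ φ)((1 ⊗ b)Δ(p)) ⊗ q`, so the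
left side is `∑ φ(b p) q`, which is `(ι ⊗ φ)(Δ(b)(x ⊗ y))` by left invariance. -/
theorem sliceFst_counit_of_E₁_eq {ε : A →ₙₐ[ℂ] ℂ} (hε : IsCounit G.Δ ε) (b x y : A)
    (v : A ⊗[ℂ] A) (hv : G.E₁ v = x ⊗ₜ G.rightConv (rightTranslate G.φ b) y) :
    sliceFst (ε : A →ₗ[ℂ] ℂ) v = G.rightConv (leftTranslate G.φ y) b * x := by
  have hb := G.slicesInAlgebra_rightTranslate G.φ b
  obtain ⟨u, hu⟩ := G.E₁_bijective.2 (x ⊗ₜ y)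
  have h : v = LinearMap.rTensor A (G.rightConv (rightTranslate G.φ b)) u := by
    apply G.E₁_bijective.1
    rw [hv, E₁_rTensor_rightConv _ hb, hu, LinearMap.lTensor_tmul]
  have h' : ∀ u, sliceFst (ε : A →ₗ[ℂ] ℂ)
      (LinearMap.rTensor A (G.rightConv (rightTranslate G.φ b)) u) =
      sliceSnd G.φ ((G.Δ b).L (G.E₁ u)) := by
    intro u
    induction u with
    | zero => simp
    | add s s' hs hs' => simp only [map_add, hs, hs']
    | tmul p q =>
      rw [LinearMap.rTensor_tmul, Δ_L_E₁, sliceSnd_φ_E₁, sliceFst_coe_tmul,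
        counit_rightConv hε hb, rightTranslate_apply]
  rw [h, h', hu, rightConv_leftTranslate, ← leg₁_R_E₂, sliceSnd_R_leg₁]

/-- The antipode is characterized by `x S(a) = ε(p) q` (summed) where `x ⊗ a = ∑ (q ⊗ 1)Δ(p)`, and
its inverse by `S⁻¹(a) x = ε(p) q` where `x ⊗ a = ∑ Δ(p)(q ⊗ 1)`. That these are values of maps on
`A` need only be seen for `a = (ι ⊗ φ)(Δ(b)(1 ⊗ y))` and `a = (ι ⊗ φ)((1 ⊗ b)Δ(y))`, which span
`A` and which `S` interchanges. -/
theorem exists_antipode {ε : A →ₙₐ[ℂ] ℂ} (hε : IsCounit G.Δ ε) :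
    ∃ S : A ≃ₗ[ℂ] A, IsAntipode G.Δ ε S := by
  have hnd := G.nondegenerate
  let e₃ := LinearEquiv.ofBijective G.E₃ G.E₃_bijective
  let e₁ := LinearEquiv.ofBijective G.E₁ G.E₁_bijective
  have he₃ : ∀ t, G.E₃ (e₃.symm t) = t := fun t => e₃.apply_symm_apply t
  have he₁ : ∀ t, G.E₁ (e₁.symm t) = t := fun t => e₁.apply_symm_apply t
  -- `P (x ⊗ a) = x S(a)` and `P' (x ⊗ a) = S⁻¹(a) x`
  let P : A ⊗[ℂ] A →ₗ[ℂ] A := sliceFst (ε : A →ₗ[ℂ] ℂ) ∘ₗ e₃.symm.toLinearMap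
  let P' : A ⊗[ℂ] A →ₗ[ℂ] A := sliceFst (ε : A →ₗ[ℂ] ℂ) ∘ₗ e₁.symm.toLinearMap
  have hP : ∀ x b y, P (x ⊗ₜ G.rightConv (leftTranslate G.φ y) b) =
      x * G.rightConv (rightTranslate G.φ b) y := fun x b y =>
    G.sliceFst_counit_of_E₃_eq hε b x y _ (he₃ _)
  have hP' : ∀ x b y, P' (x ⊗ₜ G.rightConv (rightTranslate G.φ b) y) =
      G.rightConv (leftTranslate G.φ y) b * x := fun x b y =>
    G.sliceFst_counit_of_E₁_eq hε b x y _ (he₁ _)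
  have hPE : ∀ u, P (G.E₃ u) = sliceFst (ε : A →ₗ[ℂ] ℂ) u := fun u => by
    change sliceFst (ε : A →ₗ[ℂ] ℂ) (e₃.symm (e₃ u)) = _
    rw [e₃.symm_apply_apply]
  have hex : ∀ a, ∃ s, ∀ x, P (x ⊗ₜ a) = x * s := by
    refine G.induction_rightConv_leftTranslate G.φ_ne_zero ⟨0, by simp⟩ ?_ fun c x => ?_
    · rintro x y ⟨s, hs⟩ ⟨s', hs'⟩
      exact ⟨s + s', fun b => by rw [TensorProduct.tmul_add, map_add, hs, hs', mul_add]⟩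
    · exact ⟨_, fun b => hP b x c⟩
  choose S₀ hS₀ using hex
  have hcancel : ∀ {a b : A}, (∀ x, x * a = x * b) → a = b := fun h =>
    sub_eq_zero.1 ((hnd _).2 fun x => by rw [mul_sub, h, sub_self])
  let S₁ : A →ₗ[ℂ] A :=
    { toFun := S₀
      map_add' := fun a b => hcancel fun x => by
        rw [← hS₀, TensorProduct.tmul_add, map_add, hS₀, hS₀, mul_add]
      map_smul' := fun c a => hcancel fun x => by
        rw [← hS₀, TensorProduct.tmul_smul, map_smul, hS₀, RingHom.id_apply, mul_smul_comm] }
  have hS : ∀ x a, P (x ⊗ₜ a) = x * S₁ a := fun x a => hS₀ a x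
  have hSI : ∀ y b, S₁ (G.rightConv (leftTranslate G.φ y) b) =
      G.rightConv (rightTranslate G.φ b) y := fun y b => hcancel fun x => by rw [← hS, hP]
  have hsurj : Function.Surjective S₁ := by
    refine G.induction_rightConv_rightTranslate G.φ_ne_zero ⟨0, map_zero _⟩ ?_ fun c x =>
      ⟨_, hSI x c⟩
    rintro _ _ ⟨a, rfl⟩ ⟨b, rfl⟩
    exact ⟨a + b, map_add _ _ _⟩
  have hinj : Function.Injective S₁ := by
    have key : ∀ a x, P' (x ⊗ₜ S₁ a) = a * x := by
      intro a x
      revert a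
      refine G.induction_rightConv_leftTranslate G.φ_ne_zero (by simp) (fun a b ha hb => ?_)
        fun c y => ?_
      · rw [map_add, TensorProduct.tmul_add, map_add, ha, hb, add_mul]
      · rw [hSI, hP']
    intro a b h
    refine sub_eq_zero.1 ((hnd _).1 fun x => ?_)
    rw [sub_mul, ← key, ← key, h, sub_self]
  let S := LinearEquiv.ofBijective S₁ ⟨hinj, hsurj⟩
  have hSc : S.toLinearMap = S₁ := rfl
  -- `M (x ⊗ y) = x S(y)`
  let M : A ⊗[ℂ] A →ₗ[ℂ] A := LinearMap.mul' ℂ A ∘ₗ TensorProduct.map LinearMap.id S₁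
  have hM : ∀ t, M t = P t := by
    intro t
    induction t with
    | zero => simp
    | add s s' hs hs' => simp only [map_add, hs, hs']
    | tmul x y => simp [M, hS]
  have hΔ : ∀ c v, M ((G.Δ c).R v) = ε c • M v := by
    intro c v
    obtain ⟨u, rfl⟩ := G.E₃_surjective v
    induction u with
    | zero => simp
    | add s s' hs hs' => simp only [map_add, smul_add, hs, hs']
    | tmul a b =>
      rw [Δ_R_E₃, hM, hM, hPE, hPE, sliceFst_coe_tmul, sliceFst_coe_tmul,
        map_mul, mul_comm, mul_smul]
  have hleg : ∀ q v, M ((leg₂ A A q).L v) = M v * S₁ q := by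
    intro q v
    obtain ⟨u, rfl⟩ := G.E₃_surjective v
    induction u with
    | zero => simp
    | add s s' hs hs' => simp only [map_add, add_mul, hs, hs']
    | tmul c p =>
      rw [leg₂_L_E₃, hΔ, hM (G.E₃ _), hPE, sliceFst_tmul, smul_mul_assoc]
      simp [M]
  refine ⟨S, fun a b => hcancel fun x => ?_, fun a b => ⟨G.E₂ (a ⊗ₜ b), ?_, ?_⟩,
    fun a b => ⟨G.E₃ (a ⊗ₜ b), ?_, ?_⟩⟩
  · have h := hleg a (x ⊗ₜ b)
    rw [leg₂_L_eq] at h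
    change x * S₁ (a * b) = x * (S₁ b * S₁ a)
    simpa [M, mul_assoc] using h
  · rw [incl_E₂, T₂_tmul]
  · refine hcancel fun c => ?_
    obtain ⟨u, hu⟩ := G.E₃_surjective (c ⊗ₜ a)
    -- `∑ c S(a₁) ⊗ a₂ b = ∑ q ⊗ p b`, compared by slicing the second leg
    have h1 : LinearMap.rTensor A (P ∘ₗ TensorProduct.mk ℂ A A c) (G.E₂ (a ⊗ₜ b)) =
        LinearMap.lTensor A (LinearMap.mulRight ℂ b) (TensorProduct.comm ℂ A A u) := by
      refine eq_of_sliceSnd fun θ => ?_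
      have hθ := G.slicesInAlgebra_leftTranslate θ b
      have h2 : c ⊗ₜ G.rightConv (leftTranslate θ b) a =
          G.E₃ (LinearMap.rTensor A (G.rightConv (leftTranslate θ b)) u) := by
        rw [E₃_rTensor_rightConv _ hθ, hu, LinearMap.lTensor_tmul]
      rw [sliceSnd_rTensor, ← rightConv_leftTranslate, LinearMap.comp_apply,
        TensorProduct.mk_apply, h2, hPE]
      clear hu h2
      induction u with
      | zero => simp
      | add s s' hs hs' => simp only [map_add, hs, hs']
      | tmul p q =>
        rw [LinearMap.rTensor_tmul, sliceFst_coe_tmul,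
          counit_rightConv hε hθ]
        simp
    have h3 : ∀ t, c * LinearMap.mul' ℂ A (TensorProduct.map S.toLinearMap LinearMap.id t) =
        LinearMap.mul' ℂ A (LinearMap.rTensor A (P ∘ₗ TensorProduct.mk ℂ A A c) t) := by
      intro t
      induction t with
      | zero => simp
      | add s s' hs hs' => simp only [map_add, mul_add, hs, hs']
      | tmul x y => simp [hSc, hS, mul_assoc]
    have h4 : ∀ t, LinearMap.mul' ℂ A (LinearMap.lTensor A (LinearMap.mulRight ℂ b)
        (TensorProduct.comm ℂ A A t)) = sliceSnd (ε : A →ₗ[ℂ] ℂ) (G.E₃ t) * b := by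
      intro t
      induction t with
      | zero => simp
      | add s s' hs hs' => simp only [map_add, add_mul, hs, hs']
      | tmul x y => simp [sliceSnd_counit_E₃ hε, mul_assoc]
    rw [h3, h1, h4, hu, sliceSnd_tmul, smul_mul_assoc, mul_smul_comm]
    rfl
  · rw [incl_E₃, T₃_tmul]
  · change M _ = _
    rw [hM, hPE, sliceFst_tmul]
    rfl

end AlgebraicQuantumGroup

/-! ### Functionals composed with the antipode -/

section Antipode

variable {A : Type*} [NonUnitalRing A] [Module ℂ A] [IsScalarTower ℂ A A] [SMulCommClass ℂ A A]
variable {Δ : A →ₙₐ[ℂ] Multiplier (A ⊗[ℂ] A)} {ε : A →ₙₐ[ℂ] ℂ} {S : A ≃ₗ[ℂ] A}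

theorem IsAntipode.symm_anti_mul (hS : IsAntipode Δ ε S) (a b : A) :
    S.symm (a * b) = S.symm b * S.symm a :=
  S.injective (by simp [hS.anti_mul])

theorem IsAntipode.rightTranslate_comp (hS : IsAntipode Δ ε S) (ω : Module.Dual ℂ A) (a : A) :
    rightTranslate ω (S a) ∘ₗ S.toLinearMap = leftTranslate (ω ∘ₗ S.toLinearMap) a := by
  ext x
  simp [hS.anti_mul]

theorem IsAntipode.leftTranslate_comp (hS : IsAntipode Δ ε S) (ω : Module.Dual ℂ A) (a : A) :
    leftTranslate ω (S a) ∘ₗ S.toLinearMap = rightTranslate (ω ∘ₗ S.toLinearMap) a := by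
  ext x
  simp [hS.anti_mul]

theorem IsAntipode.rightTranslate_comp_symm (hS : IsAntipode Δ ε S) (ω : Module.Dual ℂ A) (a : A) :
    rightTranslate ω a ∘ₗ S.symm.toLinearMap = leftTranslate (ω ∘ₗ S.symm.toLinearMap) (S a) := by
  ext x
  simp [hS.symm_anti_mul]

theorem IsAntipode.leftTranslate_comp_symm (hS : IsAntipode Δ ε S) (ω : Module.Dual ℂ A) (a : A) :
    leftTranslate ω a ∘ₗ S.symm.toLinearMap = rightTranslate (ω ∘ₗ S.symm.toLinearMap) (S a) := by
  ext x
  simp [hS.symm_anti_mul]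

theorem IsTranslate.comp_antipode (hS : IsAntipode Δ ε S) {α : Module.Dual ℂ A}
    (hα : IsTranslate α) : IsTranslate (α ∘ₗ S.toLinearMap) := by
  obtain ⟨ω, a, rfl | rfl⟩ := hα <;> obtain ⟨a, rfl⟩ := S.surjective a
  · exact ⟨_, _, Or.inr (hS.rightTranslate_comp ω a)⟩
  · exact ⟨_, _, Or.inl (hS.leftTranslate_comp ω a)⟩

theorem IsTranslate.comp_antipode_symm (hS : IsAntipode Δ ε S) {α : Module.Dual ℂ A}
    (hα : IsTranslate α) : IsTranslate (α ∘ₗ S.symm.toLinearMap) := by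
  obtain ⟨ω, a, rfl | rfl⟩ := hα
  · exact ⟨_, _, Or.inr (hS.rightTranslate_comp_symm ω a)⟩
  · exact ⟨_, _, Or.inl (hS.leftTranslate_comp_symm ω a)⟩

end Antipode

namespace AlgebraicQuantumGroup

open RegularMultiplierHopfAlgebra

variable {A : Type*} [NonUnitalRing A] [Module ℂ A] [IsScalarTower ℂ A A] [SMulCommClass ℂ A A]
variable {G : AlgebraicQuantumGroup A} {ε : A →ₙₐ[ℂ] ℂ} {S : A ≃ₗ[ℂ] A}

/-! ### Strong left invariance and faithfulness -/

theorem mul'_antipode_E₃ (hS : IsAntipode G.Δ ε S) (a b : A) :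
    LinearMap.mul' ℂ A (TensorProduct.map LinearMap.id S.toLinearMap (G.E₃ (a ⊗ₜ b))) =
      ε a • b := by
  obtain ⟨t, ht, h⟩ := hS.right a b
  rwa [show G.E₃ (a ⊗ₜ b) = t from incl_injective G.nondeg₂ (by rw [incl_E₃, T₃_tmul, ht])]

theorem mul'_antipode_E₂ (hS : IsAntipode G.Δ ε S) (a b : A) :
    LinearMap.mul' ℂ A (TensorProduct.map S.toLinearMap LinearMap.id (G.E₂ (a ⊗ₜ b))) =
      ε a • b := by
  obtain ⟨t, ht, h⟩ := hS.left a b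
  rwa [show G.E₂ (a ⊗ₜ b) = t from incl_injective G.nondeg₂ (by rw [incl_E₂, T₂_tmul, ht])]

/-- Strong left invariance: `S((ι ⊗ φ)(Δ(b)(1 ⊗ y))) = (ι ⊗ φ)((1 ⊗ b)Δ(y))`. -/
theorem antipode_rightConv_φ (hε : IsCounit G.Δ ε) (hS : IsAntipode G.Δ ε S) (y b : A) :
    S (G.rightConv (leftTranslate G.φ y) b) = G.rightConv (rightTranslate G.φ b) y := by
  refine sub_eq_zero.1 ((G.nondegenerate _).2 fun x => ?_)
  have hM : ∀ u, LinearMap.mul' ℂ A (TensorProduct.map LinearMap.id S.toLinearMap (G.E₃ u)) =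
      sliceFst (ε : A →ₗ[ℂ] ℂ) u := by
    intro u
    induction u with
    | zero => simp
    | add s s' hs hs' => simp only [map_add, hs, hs']
    | tmul p q => rw [mul'_antipode_E₃ hS, sliceFst_coe_tmul]
  obtain ⟨v, hv⟩ := G.E₃_surjective (x ⊗ₜ G.rightConv (leftTranslate G.φ y) b)
  have h := hM v
  rw [hv, G.sliceFst_counit_of_E₃_eq hε b x y v hv] at h
  rw [mul_sub, ← h, sub_eq_zero]
  simp

theorem antipode_symm_rightConv_φ (hε : IsCounit G.Δ ε) (hS : IsAntipode G.Δ ε S) (y b : A) :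
    S.symm (G.rightConv (rightTranslate G.φ b) y) = G.rightConv (leftTranslate G.φ y) b := by
  rw [← antipode_rightConv_φ hε hS, S.symm_apply_apply]

/-- The left Haar functional is faithful. The elements `n` with `φ(A n) = 0` form a space `N`
stable under the maps `(α ⊗ ι)Δ`, and `φ(S(n₁ c) n₂) = ε(n) φ(S(c))` shows that `ε` vanishes on
`N`; since `ε((α ⊗ ι)Δ(n)) = α(n)`, all functionals `α` vanish at `n`. -/
theorem φ_faithful (hε : IsCounit G.Δ ε) (hS : IsAntipode G.Δ ε S) {n : A}
    (hn : leftTranslate G.φ n = 0) : n = 0 := by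
  have hR : ∀ n, leftTranslate G.φ n = 0 → ∀ b, G.rightConv (rightTranslate G.φ b) n = 0 := by
    intro n hn b
    have h := G.rightConv_smul 0 0
    rw [zero_smul, zero_smul] at h
    rw [← antipode_rightConv_φ hε hS, hn, h, LinearMap.zero_apply, map_zero]
  have hconv : ∀ {α : Module.Dual ℂ A}, IsTranslate α → leftTranslate G.φ (G.leftConv α n) = 0 := by
    intro α hα
    ext b
    change rightTranslate G.φ b (G.leftConv α n) = 0
    rw [← apply_rightConv_eq' (G.slicesInAlgebra_of_isTranslate hα)
      (isTranslate_rightTranslate G.φ b), hR n hn, map_zero]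
  have hε0 : ∀ n, leftTranslate G.φ n = 0 → ε n = 0 := by
    intro n hn
    have h1 : ∀ t c, LinearMap.mul' ℂ A (TensorProduct.map S.toLinearMap LinearMap.id
        ((leg₁ A A c).R t)) = S c * LinearMap.mul' ℂ A
        (TensorProduct.map S.toLinearMap LinearMap.id t) := by
      intro t c
      rw [leg₁_R_eq]
      induction t with
      | zero => simp
      | add s s' hs hs' => simp only [map_add, mul_add, hs, hs']
      | tmul x y => simp [hS.anti_mul, mul_assoc]
    have h2 : ∀ t b, LinearMap.mul' ℂ A (TensorProduct.map S.toLinearMap LinearMap.id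
        ((leg₂ A A b).R t)) = LinearMap.mul' ℂ A
        (TensorProduct.map S.toLinearMap LinearMap.id t) * b := by
      intro t b
      rw [leg₂_R_eq]
      induction t with
      | zero => simp
      | add s s' hs hs' => simp only [map_add, add_mul, hs, hs']
      | tmul x y => simp [mul_assoc]
    have h3 : ∀ c, LinearMap.mul' ℂ A (TensorProduct.map S.toLinearMap LinearMap.id
        (G.E₁ (n ⊗ₜ c))) = ε n • S c := fun c =>
      sub_eq_zero.1 ((G.nondegenerate _).1 fun b => by
        rw [sub_mul, ← h2, leg₂_R_E₁, ← leg₁_R_E₂, h1, mul'_antipode_E₂ hS, mul_smul_comm,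
          smul_mul_assoc, sub_self])
    have h4 : ∀ t, G.φ (LinearMap.mul' ℂ A (TensorProduct.map S.toLinearMap LinearMap.id t)) =
        TensorProduct.lift (rightTranslate G.φ ∘ₗ S.toLinearMap) t := by
      intro t
      induction t with
      | zero => simp
      | add s s' hs hs' => simp only [map_add, hs, hs']
      | tmul x y => simp
    by_contra hne
    apply G.φ_ne_zero
    ext c
    have h5 := congrArg G.φ (h3 (S.symm c))
    rw [h4, lift_eq_zero_of_sliceSnd, S.apply_symm_apply, map_smul, smul_eq_mul] at h5
    · simpa [hne] using h5.symm
    · intro b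
      rw [LinearMap.comp_apply, ← (G.slicesInAlgebra_rightTranslate _ _).rightConv_mul, hR n hn,
        zero_mul]
  refine G.eq_of_forall_rightTranslate fun ω a => ?_
  have hα := isTranslate_rightTranslate ω a
  rw [mul_zero, map_zero, ← rightTranslate_apply,
    ← counit_leftConv hε (G.slicesInAlgebra_of_isTranslate hα), hε0 _ (hconv hα)]

theorem leftTranslate_φ_injective (hε : IsCounit G.Δ ε) (hS : IsAntipode G.Δ ε S) :
    Function.Injective (leftTranslate G.φ) :=
  (injective_iff_map_eq_zero _).2 fun _ h => φ_faithful hε hS h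

/-! ### The antipode reverses the comultiplication -/

/-- `(ηS ⊗ ι)Δ(a) = S⁻¹((ι ⊗ η)Δ(S(a)))`: on `a = (ι ⊗ φ)(Δ(b)(1 ⊗ y))` both sides are computed
by strong left invariance. -/
theorem antipode_leftConv (hε : IsCounit G.Δ ε) (hS : IsAntipode G.Δ ε S) {η : Module.Dual ℂ A}
    (hη : IsTranslate η) (a : A) :
    S (G.leftConv (η ∘ₗ S.toLinearMap) a) = G.rightConv η (S a) := by
  revert a
  have hηS := hη.comp_antipode hS
  refine G.induction_rightConv_leftTranslate G.φ_ne_zero (by simp)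
    (fun x y hx hy => by simp only [map_add, hx, hy]) fun y b => ?_
  have hR : ∀ {α : Module.Dual ℂ A}, IsTranslate α → G.SlicesInAlgebra α :=
    fun h => G.slicesInAlgebra_of_isTranslate h
  refine G.eq_of_forall_rightTranslate fun ω c => ?_
  have hω := isTranslate_rightTranslate ω c
  change rightTranslate ω c _ = rightTranslate ω c _
  rw [leftConv_rightConv_comm_of_left _ hηS (G.slicesInAlgebra_leftTranslate _ _),
    antipode_rightConv_φ hε hS, antipode_rightConv_φ hε hS, apply_rightConv_eq hω (hR hη),
    apply_rightConv_eq hω (G.slicesInAlgebra_rightTranslate _ _),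
    leftConv_rightConv_comm_of_left _ hω (G.slicesInAlgebra_rightTranslate _ _),
    ← antipode_rightConv_φ hε hS, rightTranslate_apply]
  change _ = (η ∘ₗ S.toLinearMap) _
  rw [apply_rightConv_eq hηS (G.slicesInAlgebra_leftTranslate _ _), leftTranslate_apply]

/-- `(ι ⊗ ηS)Δ(a) = S⁻¹((η ⊗ ι)Δ(S(a)))`. -/
theorem antipode_rightConv (hε : IsCounit G.Δ ε) (hS : IsAntipode G.Δ ε S) {η : Module.Dual ℂ A}
    (hη : IsTranslate η) (a : A) :
    S (G.rightConv (η ∘ₗ S.toLinearMap) a) = G.leftConv η (S a) := by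
  refine G.eq_of_forall_rightTranslate fun ω c => ?_
  have hω := isTranslate_rightTranslate ω c
  change rightTranslate ω c _ = rightTranslate ω c _
  rw [← apply_rightConv_eq' (G.slicesInAlgebra_of_isTranslate hη) hω, ← antipode_leftConv hε hS hω]
  change (rightTranslate ω c ∘ₗ S.toLinearMap) _ = (η ∘ₗ S.toLinearMap) _
  rw [apply_rightConv_eq (hω.comp_antipode hS)
    (G.slicesInAlgebra_of_isTranslate (hη.comp_antipode hS))]

/-! ### The right Haar functional `φ ∘ S` -/

theorem φ_leftConv_rightTranslate (ω : Module.Dual ℂ A) (a x : A) :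
    G.φ (G.leftConv (rightTranslate ω a) x) = G.φ x * ω a := by
  rw [leftConv_rightTranslate, ← apply_sliceSnd, sliceSnd_φ_E₃, map_smul, smul_eq_mul]

theorem φ_leftConv_leftTranslate (ω : Module.Dual ℂ A) (a x : A) :
    G.φ (G.leftConv (leftTranslate ω a) x) = G.φ x * ω a := by
  rw [leftConv_leftTranslate, ← apply_sliceSnd, sliceSnd_φ_E₁, map_smul, smul_eq_mul]

theorem comp_symm_comp (ω : Module.Dual ℂ A) (S : A ≃ₗ[ℂ] A) :
    (ω ∘ₗ S.symm.toLinearMap) ∘ₗ S.toLinearMap = ω := by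
  ext x; simp

/-- Right invariance of `ψ = φ ∘ S`, evaluated at the functional `ω a`. -/
theorem ψ_rightConv_rightTranslate (hε : IsCounit G.Δ ε) (hS : IsAntipode G.Δ ε S)
    (ω : Module.Dual ℂ A) (a x : A) :
    G.φ (S (G.rightConv (rightTranslate ω a) x)) = G.φ (S x) * ω a := by
  have h := antipode_rightConv hε hS ((isTranslate_rightTranslate ω a).comp_antipode_symm hS) x
  rw [comp_symm_comp] at h
  rw [h, hS.rightTranslate_comp_symm, φ_leftConv_leftTranslate]
  simp

/-- Right invariance of `ψ = φ ∘ S`, evaluated at the functional `a ω`. -/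
theorem ψ_rightConv_leftTranslate (hε : IsCounit G.Δ ε) (hS : IsAntipode G.Δ ε S)
    (ω : Module.Dual ℂ A) (a x : A) :
    G.φ (S (G.rightConv (leftTranslate ω a) x)) = G.φ (S x) * ω a := by
  have h := antipode_rightConv hε hS ((isTranslate_leftTranslate ω a).comp_antipode_symm hS) x
  rw [comp_symm_comp] at h
  rw [h, hS.leftTranslate_comp_symm, φ_leftConv_rightTranslate]
  simp

/-- Strong right invariance: `S((ψ ⊗ ι)((x ⊗ 1)Δ(b))) = (ψ ⊗ ι)(Δ(x)(b ⊗ 1))` for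
`ψ = φ ∘ S`. -/
theorem antipode_leftConv_ψ (hε : IsCounit G.Δ ε) (hS : IsAntipode G.Δ ε S) (x b : A) :
    S (G.leftConv (rightTranslate (G.φ ∘ₗ S.toLinearMap) x) b) =
      G.leftConv (leftTranslate (G.φ ∘ₗ S.toLinearMap) b) x := by
  apply S.injective
  rw [← hS.leftTranslate_comp, ← hS.rightTranslate_comp,
    antipode_leftConv hε hS (isTranslate_leftTranslate _ _),
    antipode_leftConv hε hS (isTranslate_rightTranslate _ _), antipode_rightConv_φ hε hS]


/-! ### The four descriptions of the dual -/

theorem comp_antipode_ne_zero {ω : Module.Dual ℂ A} (hω : ω ≠ 0) (S : A ≃ₗ[ℂ] A) :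
    ω ∘ₗ S.toLinearMap ≠ 0 := fun h => hω (by
  ext x
  simpa using LinearMap.congr_fun h (S.symm x))

theorem exists_φ_antipode_ne_zero (G : AlgebraicQuantumGroup A) (S : A ≃ₗ[ℂ] A) :
    ∃ x, G.φ (S x) ≠ 0 := by
  by_contra! h
  exact comp_antipode_ne_zero G.φ_ne_zero S (LinearMap.ext h)

/-- Both sides are `x ↦ (ψ ⊗ φ)((1 ⊗ a)Δ(x)(b ⊗ 1))` with `ψ = φ ∘ S`, `a = S(a')`, `b = S(b')`,
computed by strong left and by strong right invariance. -/
theorem leftTranslate_ψ_eq_rightTranslate_φ (hε : IsCounit G.Δ ε) (hS : IsAntipode G.Δ ε S)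
    (a b : A) :
    leftTranslate (G.φ ∘ₗ S.toLinearMap) (G.rightConv (leftTranslate (G.φ ∘ₗ S.toLinearMap) a)
      (S b)) =
    rightTranslate G.φ (G.leftConv
      (rightTranslate ((G.φ ∘ₗ S.toLinearMap) ∘ₗ S.toLinearMap) b) (S a)) := by
  have hR : ∀ {α : Module.Dual ℂ A}, IsTranslate α → G.SlicesInAlgebra α :=
    fun h => G.slicesInAlgebra_of_isTranslate h
  ext x
  rw [← hS.rightTranslate_comp G.φ a, ← hS.leftTranslate_comp (G.φ ∘ₗ S.toLinearMap) b]
  have h1 := isTranslate_leftTranslate (G.φ ∘ₗ S.toLinearMap) (S b)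
  have h2 := isTranslate_rightTranslate G.φ (S a)
  change rightTranslate (G.φ ∘ₗ S.toLinearMap) x _ = leftTranslate G.φ x _
  rw [apply_rightConv_eq (isTranslate_rightTranslate _ _) (hR (h2.comp_antipode hS)),
    LinearMap.comp_apply, LinearEquiv.coe_coe, antipode_leftConv_ψ hε hS,
    ← apply_rightConv_eq h1 (hR h2), ← antipode_rightConv_φ hε hS]
  exact apply_rightConv_eq (h1.comp_antipode hS) (G.slicesInAlgebra_leftTranslate _ _) _

/-- Both sides are `x ↦ (ψ ⊗ φ)((b ⊗ 1)Δ(x)(1 ⊗ a))` with `ψ = φ ∘ S`. -/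
theorem rightTranslate_ψ_eq_leftTranslate_φ (hε : IsCounit G.Δ ε) (hS : IsAntipode G.Δ ε S)
    (a b : A) :
    rightTranslate (G.φ ∘ₗ S.toLinearMap)
      (G.rightConv (leftTranslate G.φ a ∘ₗ S.symm.toLinearMap) b) =
    leftTranslate G.φ
      (G.leftConv (rightTranslate (G.φ ∘ₗ S.toLinearMap) b ∘ₗ S.symm.toLinearMap) a) := by
  have hR : ∀ {α : Module.Dual ℂ A}, IsTranslate α → G.SlicesInAlgebra α :=
    fun h => G.slicesInAlgebra_of_isTranslate h
  ext x
  have h1 := isTranslate_rightTranslate (G.φ ∘ₗ S.toLinearMap) b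
  have h2 := isTranslate_leftTranslate G.φ a
  change leftTranslate (G.φ ∘ₗ S.toLinearMap) x _ = rightTranslate G.φ x _
  rw [apply_rightConv_eq (isTranslate_leftTranslate _ _) (hR (h2.comp_antipode_symm hS)),
    ← antipode_leftConv_ψ hε hS, LinearMap.comp_apply, LinearEquiv.coe_coe, S.symm_apply_apply,
    ← apply_rightConv_eq h1 (hR h2), ← antipode_symm_rightConv_φ hε hS]
  exact apply_rightConv_eq (h1.comp_antipode_symm hS) (G.slicesInAlgebra_rightTranslate _ _) _

theorem range_leftTranslate_ψ_le (hε : IsCounit G.Δ ε) (hS : IsAntipode G.Δ ε S) :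
    LinearMap.range (leftTranslate (G.φ ∘ₗ S.toLinearMap)) ≤ G.dual := by
  rintro _ ⟨d, rfl⟩
  revert d
  refine G.induction_rightConv_leftTranslate (comp_antipode_ne_zero G.φ_ne_zero S)
    (by simp) (fun x y hx hy => ?_) fun a b => ?_
  · rw [map_add]
    exact add_mem hx hy
  · obtain ⟨b, rfl⟩ := S.surjective b
    rw [leftTranslate_ψ_eq_rightTranslate_φ hε hS]
    exact ⟨_, rfl⟩

theorem range_rightTranslate_ψ_le (hε : IsCounit G.Δ ε) (hS : IsAntipode G.Δ ε S) :
    LinearMap.range (rightTranslate (G.φ ∘ₗ S.toLinearMap)) ≤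
      LinearMap.range (leftTranslate G.φ) := by
  rintro _ ⟨d, rfl⟩
  revert d
  refine G.induction_rightConv_rightTranslate (comp_antipode_ne_zero G.φ_ne_zero S.symm)
    (by simp) (fun x y hx hy => ?_) fun a b => ?_
  · rw [map_add]
    exact add_mem hx hy
  · obtain ⟨a, rfl⟩ := S.surjective a
    rw [← hS.leftTranslate_comp_symm, rightTranslate_ψ_eq_leftTranslate_φ hε hS]
    exact ⟨_, rfl⟩

/-- `ψ(x) φ(a y) = (ψ ⊗ φ)((x ⊗ 1)Δ(a y))` by left invariance, and strong right invariance moves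
the comultiplication to `x`. -/
theorem range_rightTranslate_φ_le (hε : IsCounit G.Δ ε) (hS : IsAntipode G.Δ ε S) :
    LinearMap.range (rightTranslate G.φ) ≤
      LinearMap.range (rightTranslate (G.φ ∘ₗ S.toLinearMap)) := by
  rintro _ ⟨a, rfl⟩
  obtain ⟨x, hx⟩ := exists_φ_antipode_ne_zero G S
  refine ⟨(G.φ (S x))⁻¹ • sliceSnd (G.φ ∘ₗ S.symm.toLinearMap) (G.E₁ (x ⊗ₜ a)), ?_⟩
  ext y
  rw [map_smul, LinearMap.smul_apply, smul_eq_mul, inv_mul_eq_iff_eq_mul₀ hx,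
    rightTranslate_apply, rightTranslate_apply, ← sliceSnd_R_leg₁, ← E₁_tmul_mul,
    apply_sliceSnd, ← leftConv_leftTranslate, ← antipode_leftConv_ψ hε hS]
  simp only [LinearMap.comp_apply, LinearEquiv.coe_coe, S.symm_apply_apply]
  rw [φ_leftConv_rightTranslate, mul_comm]
  rfl

/-- `ψ(x) φ(y a) = (ψ ⊗ φ)(Δ(y a)(x ⊗ 1))` by left invariance, and strong right invariance moves
the comultiplication to `x`. -/
theorem range_leftTranslate_φ_le (hε : IsCounit G.Δ ε) (hS : IsAntipode G.Δ ε S) :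
    LinearMap.range (leftTranslate G.φ) ≤
      LinearMap.range (leftTranslate (G.φ ∘ₗ S.toLinearMap)) := by
  rintro _ ⟨a, rfl⟩
  obtain ⟨x, hx⟩ := exists_φ_antipode_ne_zero G S
  refine ⟨(G.φ (S x))⁻¹ • sliceSnd (G.φ ∘ₗ S.toLinearMap) (G.E₃ (x ⊗ₜ a)), ?_⟩
  ext y
  rw [map_smul, LinearMap.smul_apply, smul_eq_mul, inv_mul_eq_iff_eq_mul₀ hx,
    leftTranslate_apply, leftTranslate_apply, ← sliceSnd_L_leg₁, ← E₃_tmul_mul,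
    apply_sliceSnd, ← leftConv_rightTranslate, LinearMap.comp_apply, LinearEquiv.coe_coe,
    antipode_leftConv_ψ hε hS, φ_leftConv_leftTranslate, mul_comm]
  rfl

theorem range_leftTranslate_φ (hε : IsCounit G.Δ ε) (hS : IsAntipode G.Δ ε S) :
    LinearMap.range (leftTranslate G.φ) = G.dual :=
  le_antisymm ((range_leftTranslate_φ_le hε hS).trans (range_leftTranslate_ψ_le hε hS))
    ((range_rightTranslate_φ_le hε hS).trans (range_rightTranslate_ψ_le hε hS))

theorem range_rightTranslate_ψ (hε : IsCounit G.Δ ε) (hS : IsAntipode G.Δ ε S) :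
    LinearMap.range (rightTranslate (G.φ ∘ₗ S.toLinearMap)) = G.dual :=
  le_antisymm ((range_rightTranslate_ψ_le hε hS).trans (range_leftTranslate_φ hε hS).le)
    (range_rightTranslate_φ_le hε hS)

end AlgebraicQuantumGroup

theorem Multiplier.L_mul {B : Type*} [NonUnitalRing B] [Module ℂ B] [IsScalarTower ℂ B B]
    [SMulCommClass ℂ B B] (hB : NondegenerateAlgebra B) (m : Multiplier B) (a b : B) :
    m.L (a * b) = m.L a * b :=
  congrArg (fun n : Multiplier B => n.L b) (mul_incl m a hB)

namespace AlgebraicQuantumGroup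

open RegularMultiplierHopfAlgebra

variable {A : Type*} [NonUnitalRing A] [Module ℂ A] [IsScalarTower ℂ A A] [SMulCommClass ℂ A A]
variable {G : AlgebraicQuantumGroup A} {ε : A →ₙₐ[ℂ] ℂ} {S : A ≃ₗ[ℂ] A}

/-! ### The dual algebra -/

theorem isTranslate_coe (ω : G.dual) : IsTranslate ω.1 := by
  obtain ⟨_, a, rfl⟩ := ω
  exact isTranslate_rightTranslate _ a

theorem slicesInAlgebra_coe (ω : G.dual) : G.SlicesInAlgebra ω.1 :=
  G.slicesInAlgebra_of_isTranslate (isTranslate_coe ω)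

theorem mul_apply (ω₁ ω₂ : G.dual) (x : A) : (ω₁ * ω₂).1 x = ω₁.1 (G.rightConv ω₂.1 x) := rfl

theorem mul_apply' (ω₁ ω₂ : G.dual) (x : A) : (ω₁ * ω₂).1 x = ω₂.1 (G.leftConv ω₁.1 x) :=
  G.apply_conv ω₁ ω₂ x

theorem eq_of_apply_rightConv {θ θ' : Module.Dual ℂ A}
    (h : ∀ (ω : G.dual) x, θ (G.rightConv ω.1 x) = θ' (G.rightConv ω.1 x)) : θ = θ' := by
  ext y
  revert y
  refine G.induction_rightConv_rightTranslate G.φ_ne_zero (by simp)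
    (fun x y hx hy => by rw [map_add, map_add, hx, hy]) fun c x => h ⟨_, c, rfl⟩ x

theorem eq_of_apply_leftConv {θ θ' : Module.Dual ℂ A}
    (h : ∀ (ω : G.dual) x, θ (G.leftConv ω.1 x) = θ' (G.leftConv ω.1 x)) : θ = θ' := by
  ext y
  revert y
  refine G.induction_leftConv_rightTranslate G.φ_ne_zero (by simp)
    (fun x y hx hy => by rw [map_add, map_add, hx, hy]) fun c x => h ⟨_, c, rfl⟩ x

theorem nondegenerate_dual (G : AlgebraicQuantumGroup A) : NondegenerateAlgebra G.dual := by
  refine fun ω => ⟨fun h => Subtype.ext (eq_of_apply_rightConv (G := G) fun η x => ?_),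
    fun h => Subtype.ext (eq_of_apply_leftConv (G := G) fun η x => ?_)⟩
  · rw [← mul_apply, h]
    rfl
  · rw [← mul_apply', h]
    rfl

/-- The isomorphism `a ↦ a φ` of `A` onto its dual. -/
def leftEquiv (hε : IsCounit G.Δ ε) (hS : IsAntipode G.Δ ε S) : A ≃ₗ[ℂ] G.dual :=
  (LinearEquiv.ofInjective _ (leftTranslate_φ_injective hε hS)).trans
    (LinearEquiv.ofEq _ _ (range_leftTranslate_φ hε hS))

theorem coe_leftEquiv (hε : IsCounit G.Δ ε) (hS : IsAntipode G.Δ ε S) (a : A) :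
    (leftEquiv hε hS a : Module.Dual ℂ A) = leftTranslate G.φ a := rfl

theorem rightTranslate_ψ_injective (hε : IsCounit G.Δ ε) (hS : IsAntipode G.Δ ε S) :
    Function.Injective (rightTranslate (G.φ ∘ₗ S.toLinearMap)) := by
  refine (injective_iff_map_eq_zero _).2 fun a h => ?_
  have h' : leftTranslate G.φ (S a) = 0 := by
    ext x
    simpa [hS.anti_mul] using LinearMap.congr_fun h (S.symm x)
  simpa using φ_faithful hε hS h'

/-- The isomorphism `a ↦ ψ a` of `A` onto its dual, where `ψ = φ ∘ S`. -/
def rightEquiv (hε : IsCounit G.Δ ε) (hS : IsAntipode G.Δ ε S) : A ≃ₗ[ℂ] G.dual :=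
  (LinearEquiv.ofInjective _ (rightTranslate_ψ_injective hε hS)).trans
    (LinearEquiv.ofEq _ _ (range_rightTranslate_ψ hε hS))

theorem coe_rightEquiv (hε : IsCounit G.Δ ε) (hS : IsAntipode G.Δ ε S) (a : A) :
    (rightEquiv hε hS a : Module.Dual ℂ A) = rightTranslate (G.φ ∘ₗ S.toLinearMap) a := rfl

/-- Up to the Fourier transform `x ↦ S(x) φ`, left convolution by `θ` on the dual is
`x ↦ (ι ⊗ θ)Δ(x)`. -/
theorem apply_rightConv_leftEquiv (hε : IsCounit G.Δ ε) (hS : IsAntipode G.Δ ε S)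
    {θ : Module.Dual ℂ A} (hθ : G.SlicesInAlgebra θ) (x y : A) :
    θ (G.rightConv (leftEquiv hε hS (S x)).1 y) =
      (leftEquiv hε hS (S (G.rightConv θ x))).1 y := by
  have h := isTranslate_rightTranslate G.φ y
  have h' : G.rightConv (leftTranslate G.φ (S x)) y =
      G.leftConv (rightTranslate G.φ y ∘ₗ S.toLinearMap) x :=
    S.injective (by rw [antipode_rightConv_φ hε hS, antipode_leftConv hε hS h])
  rw [coe_leftEquiv, coe_leftEquiv, h', ← apply_rightConv_eq (h.comp_antipode hS) hθ]
  rfl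

/-- Up to `x ↦ ψ S(x)`, right convolution by `θ` on the dual is `x ↦ (θ ⊗ ι)Δ(x)`. -/
theorem apply_leftConv_rightEquiv (hε : IsCounit G.Δ ε) (hS : IsAntipode G.Δ ε S)
    {θ : Module.Dual ℂ A} (hθ : G.SlicesInAlgebra θ) (x y : A) :
    θ (G.leftConv (rightEquiv hε hS (S x)).1 y) =
      (rightEquiv hε hS (S (G.leftConv θ x))).1 y := by
  have h := isTranslate_leftTranslate (G.φ ∘ₗ S.toLinearMap) y
  have h' : G.leftConv (rightTranslate (G.φ ∘ₗ S.toLinearMap) (S x)) y =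
      G.rightConv (leftTranslate (G.φ ∘ₗ S.toLinearMap) y ∘ₗ S.toLinearMap) x :=
    S.injective (by rw [antipode_leftConv_ψ hε hS, antipode_rightConv hε hS h])
  rw [coe_rightEquiv, coe_rightEquiv, h', apply_rightConv_eq' hθ (h.comp_antipode hS)]
  rfl

theorem mul_leftEquiv (hε : IsCounit G.Δ ε) (hS : IsAntipode G.Δ ε S) (ω : G.dual) (x : A) :
    ω * leftEquiv hε hS (S x) = leftEquiv hε hS (S (G.rightConv ω.1 x)) :=
  Subtype.ext (LinearMap.ext fun y =>
    apply_rightConv_leftEquiv hε hS (slicesInAlgebra_coe ω) x y)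

/-! ### The multiplier algebra of the dual -/

theorem Implements.eq_multiplier {θ : Module.Dual ℂ A} {m m' : Multiplier G.dual}
    (h : G.Implements θ m) (h' : G.Implements θ m') : m = m' :=
  ext' (fun ω => Subtype.ext (LinearMap.ext fun x => by rw [(h ω x).1, (h' ω x).1]))
    (fun ω => Subtype.ext (LinearMap.ext fun x => by rw [(h ω x).2, (h' ω x).2]))

theorem Implements.eq_functional {θ θ' : Module.Dual ℂ A} {m : Multiplier G.dual}
    (h : G.Implements θ m) (h' : G.Implements θ' m) : θ = θ' :=
  eq_of_apply_rightConv fun ω x => by rw [← (h ω x).1, ← (h' ω x).1]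

/-- The functional `θ` acts on the dual by `S(x) φ ↦ S((ι ⊗ θ)Δ(x)) φ` from the left and by
`ψ S(x) ↦ ψ S((θ ⊗ ι)Δ(x))` from the right. -/
theorem exists_implements (hε : IsCounit G.Δ ε) (hS : IsAntipode G.Δ ε S)
    {θ : Module.Dual ℂ A} (hθ : G.SlicesInAlgebra θ) : ∃ m, G.Implements θ m := by
  let F := S.trans (leftEquiv hε hS)
  let F' := S.trans (rightEquiv hε hS)
  let l : G.dual →ₗ[ℂ] G.dual := F.toLinearMap ∘ₗ G.rightConv θ ∘ₗ F.symm.toLinearMap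
  let r : G.dual →ₗ[ℂ] G.dual := F'.toLinearMap ∘ₗ G.leftConv θ ∘ₗ F'.symm.toLinearMap
  have hl : ∀ ω x, (l ω).1 x = θ (G.rightConv ω.1 x) := by
    intro ω x
    obtain ⟨y, rfl⟩ := F.surjective ω
    simp only [l, LinearMap.comp_apply, LinearEquiv.coe_coe, F.symm_apply_apply]
    exact (apply_rightConv_leftEquiv hε hS hθ y x).symm
  have hr : ∀ ω x, (r ω).1 x = θ (G.leftConv ω.1 x) := by
    intro ω x
    obtain ⟨y, rfl⟩ := F'.surjective ω
    simp only [r, LinearMap.comp_apply, LinearEquiv.coe_coe, F'.symm_apply_apply]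
    exact (apply_leftConv_rightEquiv hε hS hθ y x).symm
  refine ⟨Multiplier.mk l r fun α β => Subtype.ext (LinearMap.ext fun x => ?_), fun ω x =>
    ⟨hl ω x, hr ω x⟩⟩
  rw [mul_apply, hr, mul_apply', hl, leftConv_rightConv_comm_of_left _ (isTranslate_coe α)
    (slicesInAlgebra_coe β)]

/-- A multiplier `m` acts on `A` through `x ↦ S(x) φ`, and it is implemented by the counit of this
action. Its slices lie in `A` because those of `m ω` and `ω m` do. -/
theorem exists_functional (hε : IsCounit G.Δ ε) (hS : IsAntipode G.Δ ε S)
    (m : Multiplier G.dual) : ∃ θ, G.SlicesInAlgebra θ ∧ G.Implements θ m := by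
  let F := S.trans (leftEquiv hε hS)
  -- `m` acts on `A` through the Fourier transform, and `θ` is the counit of this action
  let θ : Module.Dual ℂ A :=
    (ε : A →ₗ[ℂ] ℂ) ∘ₗ F.symm.toLinearMap ∘ₗ m.L ∘ₗ F.toLinearMap
  have hL : ∀ (ω : G.dual) x, θ (G.rightConv ω.1 x) = (m.L ω).1 x := by
    intro ω x
    have h1 : F (G.rightConv ω.1 x) = ω * F x := (mul_leftEquiv hε hS ω x).symm
    have h2 : F (G.rightConv (m.L ω).1 x) = m.L ω * F x := (mul_leftEquiv hε hS _ x).symm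
    simp only [θ, LinearMap.comp_apply, LinearEquiv.coe_coe]
    rw [h1, Multiplier.L_mul (nondegenerate_dual G), ← h2, F.symm_apply_apply]
    exact counit_rightConv hε (slicesInAlgebra_coe _) x
  have hR : ∀ (ω : G.dual) x, θ (G.leftConv ω.1 x) = (m.R ω).1 x := by
    intro ω x
    have h : θ ∘ₗ G.leftConv ω.1 = (m.R ω).1 := eq_of_apply_rightConv fun η y => by
      rw [LinearMap.comp_apply, leftConv_rightConv_comm_of_left _ (isTranslate_coe ω)
        (slicesInAlgebra_coe η), hL, ← mul_apply, balanced, mul_apply']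
    exact LinearMap.congr_fun h x
  refine ⟨θ, ?_, fun ω x => ⟨(hL ω x).symm, (hR ω x).symm⟩⟩
  have hl : ∀ x, G.leftSlice θ x ∈ Set.range (incl (A := A)) := by
    refine G.induction_leftConv_rightTranslate G.φ_ne_zero ⟨0, by simp⟩ ?_ fun c x => ?_
    · rintro x y ⟨a, ha⟩ ⟨b, hb⟩
      exact ⟨a + b, by rw [map_add, map_add, ha, hb]⟩
    · let ω : G.dual := ⟨rightTranslate G.φ c, c, rfl⟩
      have hω := slicesInAlgebra_coe ω
      have h : θ ∘ₗ G.leftConv ω.1 = (m.R ω).1 := LinearMap.ext (hR ω)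
      refine ⟨G.leftConv (m.R ω).1 x, ext' (fun b => ?_) fun b => ?_⟩
      · change _ * b = sliceFst θ (G.E₂ (G.leftConv ω.1 x ⊗ₜ b))
        rw [E₂_leftConv _ hω, sliceFst_rTensor, h, (slicesInAlgebra_coe _).leftConv_mul]
      · change b * _ = sliceFst θ (G.E₄ (G.leftConv ω.1 x ⊗ₜ b))
        rw [E₄_leftConv _ hω, sliceFst_rTensor, h, (slicesInAlgebra_coe _).mul_leftConv]
  have hr : ∀ x, G.rightSlice θ x ∈ Set.range (incl (A := A)) := by
    refine G.induction_rightConv_rightTranslate G.φ_ne_zero ⟨0, by simp⟩ ?_ fun c x => ?_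
    · rintro x y ⟨a, ha⟩ ⟨b, hb⟩
      exact ⟨a + b, by rw [map_add, map_add, ha, hb]⟩
    · let ω : G.dual := ⟨rightTranslate G.φ c, c, rfl⟩
      have hω := slicesInAlgebra_coe ω
      have h : θ ∘ₗ G.rightConv ω.1 = (m.L ω).1 := LinearMap.ext (hL ω)
      refine ⟨G.rightConv (m.L ω).1 x, ext' (fun b => ?_) fun b => ?_⟩
      · change _ * b = sliceSnd θ (G.E₁ (G.rightConv ω.1 x ⊗ₜ b))
        rw [E₁_rightConv _ hω, sliceSnd_lTensor, h, (slicesInAlgebra_coe _).rightConv_mul]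
      · change b * _ = sliceSnd θ (G.E₃ (G.rightConv ω.1 x ⊗ₜ b))
        rw [E₃_rightConv _ hω, sliceSnd_lTensor, h, (slicesInAlgebra_coe _).mul_rightConv]
  exact fun x => ⟨hl x, hr x⟩

theorem existsUnique_multiplierEquiv (hε : IsCounit G.Δ ε) (hS : IsAntipode G.Δ ε S) :
    ∃! F : G.multiplierFunctionals ≃ₗ[ℂ] Multiplier G.dual, ∀ θ, G.Implements θ.1 (F θ) := by
  choose f hf using fun θ : G.multiplierFunctionals => exists_implements hε hS θ.2
  let F₀ : G.multiplierFunctionals →ₗ[ℂ] Multiplier G.dual :=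
    { toFun := f
      map_add' := fun θ θ' => Implements.eq_multiplier (hf _) fun ω x =>
        ⟨congrArg₂ (· + ·) ((hf θ) ω x).1 ((hf θ') ω x).1,
          congrArg₂ (· + ·) ((hf θ) ω x).2 ((hf θ') ω x).2⟩
      map_smul' := fun c θ => Implements.eq_multiplier (hf _) fun ω x =>
        ⟨congrArg (c * ·) ((hf θ) ω x).1, congrArg (c * ·) ((hf θ) ω x).2⟩ }
  have hinj : Function.Injective F₀ := fun θ θ' h =>
    Subtype.ext (Implements.eq_functional (hf θ) (by
      have h' : f θ = f θ' := h
      rw [h']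
      exact hf θ'))
  have hsurj : Function.Surjective F₀ := fun m => by
    obtain ⟨θ, hθ, h⟩ := exists_functional hε hS m
    exact ⟨⟨θ, hθ⟩, Implements.eq_multiplier (hf _) h⟩
  exact ⟨LinearEquiv.ofBijective F₀ ⟨hinj, hsurj⟩, hf, fun F hF =>
    LinearEquiv.ext fun θ => Implements.eq_multiplier (hF θ) (hf θ)⟩


/-! ### Tensors over the dual as functionals -/

theorem pairing_tmul (ω₁ ω₂ : G.dual) (t : A ⊗[ℂ] A) :
    G.pairing (ω₁ ⊗ₜ ω₂) t = ω₁.1 (sliceSnd ω₂.1 t) := by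
  induction t with
  | zero => simp
  | add s s' hs hs' => simp only [map_add, hs, hs']
  | tmul x y => simp [pairing, mul_comm]

/-- Evaluation at `x` of the elements of the dual. -/
def evalAt (G : AlgebraicQuantumGroup A) (x : A) : Module.Dual ℂ G.dual :=
  LinearMap.applyₗ x ∘ₗ G.dual.subtype

@[simp] theorem evalAt_apply (x : A) (ω : G.dual) : G.evalAt x ω = ω.1 x := rfl

theorem sliceFst_evalAt (x y : A) (t : G.dual ⊗[ℂ] G.dual) :
    (sliceFst (G.evalAt x) t).1 y = G.pairing t (x ⊗ₜ y) := by
  induction t with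
  | zero => simp
  | add s s' hs hs' =>
    simp only [map_add, Submodule.coe_add, LinearMap.add_apply, hs, hs']
  | tmul α β => simp [pairing_tmul, mul_comm]

theorem eq_of_pairing {s t : G.dual ⊗[ℂ] G.dual}
    (h : ∀ x y, G.pairing s (x ⊗ₜ y) = G.pairing t (x ⊗ₜ y)) : s = t := by
  refine eq_of_sliceSnd fun η => Subtype.ext (LinearMap.ext fun x => ?_)
  rw [← evalAt_apply, ← evalAt_apply, apply_sliceSnd, apply_sliceSnd]
  congr 1
  exact Subtype.ext (LinearMap.ext fun y => by rw [sliceFst_evalAt, sliceFst_evalAt, h])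

theorem pairing_leg₁_R (β : G.dual) (t : G.dual ⊗[ℂ] G.dual) (x y : A) :
    G.pairing ((leg₁ G.dual G.dual β).R t) (x ⊗ₜ y) =
      G.pairing t (G.rightConv β.1 x ⊗ₜ y) := by
  rw [leg₁_R_eq]
  induction t with
  | zero => simp
  | add s s' hs hs' => simp only [map_add, LinearMap.add_apply, hs, hs']
  | tmul α γ => simp [pairing_tmul, mul_apply]

theorem pairing_leg₂_R (β : G.dual) (t : G.dual ⊗[ℂ] G.dual) (x y : A) :
    G.pairing ((leg₂ G.dual G.dual β).R t) (x ⊗ₜ y) =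
      G.pairing t (x ⊗ₜ G.rightConv β.1 y) := by
  rw [leg₂_R_eq]
  induction t with
  | zero => simp
  | add s s' hs hs' => simp only [map_add, LinearMap.add_apply, hs, hs']
  | tmul α γ => simp [pairing_tmul, mul_apply]

theorem pairing_leg₁_L (α : G.dual) (t : G.dual ⊗[ℂ] G.dual) (x y : A) :
    G.pairing ((leg₁ G.dual G.dual α).L t) (x ⊗ₜ y) =
      G.pairing t (G.leftConv α.1 x ⊗ₜ y) := by
  rw [leg₁_L_eq]
  induction t with
  | zero => simp
  | add s s' hs hs' => simp only [map_add, LinearMap.add_apply, hs, hs']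
  | tmul β γ => simp [pairing_tmul, mul_apply']

theorem pairing_leg₂_L (α : G.dual) (t : G.dual ⊗[ℂ] G.dual) (x y : A) :
    G.pairing ((leg₂ G.dual G.dual α).L t) (x ⊗ₜ y) =
      G.pairing t (x ⊗ₜ G.leftConv α.1 y) := by
  rw [leg₂_L_eq]
  induction t with
  | zero => simp
  | add s s' hs hs' => simp only [map_add, LinearMap.add_apply, hs, hs']
  | tmul β γ => simp [pairing_tmul, mul_apply']

theorem mul_tmul_eq {B : Type*} [NonUnitalRing B] [Module ℂ B] [IsScalarTower ℂ B B]
    [SMulCommClass ℂ B B] (t : B ⊗[ℂ] B) (a b : B) :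
    t * a ⊗ₜ b = (leg₁ B B a).R ((leg₂ B B b).R t) := by
  rw [leg₁_R_eq, leg₂_R_eq]
  induction t with
  | zero => simp
  | add s s' hs hs' => simp only [map_add, add_mul, hs, hs']
  | tmul c d => simp

theorem tmul_mul_eq {B : Type*} [NonUnitalRing B] [Module ℂ B] [IsScalarTower ℂ B B]
    [SMulCommClass ℂ B B] (t : B ⊗[ℂ] B) (a b : B) :
    a ⊗ₜ b * t = (leg₁ B B a).L ((leg₂ B B b).L t) := by
  rw [leg₁_L_eq, leg₂_L_eq]
  induction t with
  | zero => simp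
  | add s s' hs hs' => simp only [map_add, mul_add, hs, hs']
  | tmul c d => simp

/-! ### The canonical maps of the dual -/

/-- `ω₁ ⊗ ω₂ ↦ Δ̂(ω₁)(1 ⊗ ω₂)`. It sends `a φ ⊗ b φ`, where `a ⊗ b = ∑ Δ(p)(q ⊗ 1)`, to
`∑ q φ ⊗ p φ`. -/
def dualT₂ (hε : IsCounit G.Δ ε) (hS : IsAntipode G.Δ ε S) :
    G.dual ⊗[ℂ] G.dual ≃ₗ[ℂ] G.dual ⊗[ℂ] G.dual :=
  (TensorProduct.congr (leftEquiv hε hS) (leftEquiv hε hS)).symm ≪≫ₗ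
    (LinearEquiv.ofBijective G.E₁ G.E₁_bijective).symm ≪≫ₗ TensorProduct.comm ℂ A A ≪≫ₗ
    TensorProduct.congr (leftEquiv hε hS) (leftEquiv hε hS)

/-- `ω₁ ⊗ ω₂ ↦ (ω₁ ⊗ 1)Δ̂(ω₂)`. With `ψ = φ ∘ S`, it sends `ψ a ⊗ ψ b`, where
`a ⊗ b = ∑ (1 ⊗ q)Δ(p)`, to `∑ ψ p ⊗ ψ q`. -/
def dualT₃ (hε : IsCounit G.Δ ε) (hS : IsAntipode G.Δ ε S) :
    G.dual ⊗[ℂ] G.dual ≃ₗ[ℂ] G.dual ⊗[ℂ] G.dual :=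
  (TensorProduct.congr (rightEquiv hε hS) (rightEquiv hε hS)).symm ≪≫ₗ
    (LinearEquiv.ofBijective G.E₄ G.E₄_bijective).symm ≪≫ₗ
    TensorProduct.congr (rightEquiv hε hS) (rightEquiv hε hS)

theorem dualT₂_apply (hε : IsCounit G.Δ ε) (hS : IsAntipode G.Δ ε S) (u : A ⊗[ℂ] A) :
    dualT₂ hε hS (TensorProduct.congr (leftEquiv hε hS) (leftEquiv hε hS) (G.E₁ u)) =
      TensorProduct.congr (leftEquiv hε hS) (leftEquiv hε hS) (TensorProduct.comm ℂ A A u) := by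
  have h : (LinearEquiv.ofBijective G.E₁ G.E₁_bijective).symm (G.E₁ u) = u :=
    (LinearEquiv.ofBijective G.E₁ G.E₁_bijective).symm_apply_apply u
  simp [dualT₂, h]

theorem dualT₃_apply (hε : IsCounit G.Δ ε) (hS : IsAntipode G.Δ ε S) (u : A ⊗[ℂ] A) :
    dualT₃ hε hS (TensorProduct.congr (rightEquiv hε hS) (rightEquiv hε hS) (G.E₄ u)) =
      TensorProduct.congr (rightEquiv hε hS) (rightEquiv hε hS) u := by
  have h : (LinearEquiv.ofBijective G.E₄ G.E₄_bijective).symm (G.E₄ u) = u :=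
    (LinearEquiv.ofBijective G.E₄ G.E₄_bijective).symm_apply_apply u
  simp [dualT₃, h]

theorem pairing_congr_leftEquiv (hε : IsCounit G.Δ ε) (hS : IsAntipode G.Δ ε S)
    (s t : A ⊗[ℂ] A) :
    G.pairing (TensorProduct.congr (leftEquiv hε hS) (leftEquiv hε hS) t) s =
      G.φ (sliceSnd G.φ (s * t)) := by
  induction t with
  | zero => simp
  | add t t' ht ht' => simp only [map_add, LinearMap.add_apply, mul_add, ht, ht']
  | tmul p q =>
    induction s with
    | zero => simp
    | add s s' hs hs' => simp only [map_add, add_mul, hs, hs']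
    | tmul x y => simp [pairing_tmul, coe_leftEquiv]

theorem pairing_congr_rightEquiv (hε : IsCounit G.Δ ε) (hS : IsAntipode G.Δ ε S)
    (s t : A ⊗[ℂ] A) :
    G.pairing (TensorProduct.congr (rightEquiv hε hS) (rightEquiv hε hS) t) s =
      G.φ (S (sliceFst (G.φ ∘ₗ S.toLinearMap) (t * s))) := by
  induction t with
  | zero => simp
  | add t t' ht ht' => simp only [map_add, LinearMap.add_apply, add_mul, ht, ht']
  | tmul p q =>
    induction s with
    | zero => simp
    | add s s' hs hs' => simp only [map_add, mul_add, hs, hs']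
    | tmul x y => simp [pairing_tmul, coe_rightEquiv, mul_comm]

theorem sliceFst_ψ_E₄ (hε : IsCounit G.Δ ε) (hS : IsAntipode G.Δ ε S) (x b : A) :
    sliceFst (G.φ ∘ₗ S.toLinearMap) (G.E₄ (x ⊗ₜ b)) = G.φ (S x) • b :=
  eq_of_forall_dual fun ω => by
    rw [← apply_sliceSnd, ← rightConv_rightTranslate, LinearMap.comp_apply, LinearEquiv.coe_coe,
      ψ_rightConv_rightTranslate hε hS, map_smul, smul_eq_mul]

/-- `dualT₂` is dual to `x ⊗ y ↦ (x ⊗ 1)Δ(y)`: for `w = ∑ a φ ⊗ b φ` with `∑ a ⊗ b = Δ(p)(q ⊗ 1)`,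
left invariance gives `w((x ⊗ 1)Δ(y)) = (φ ⊗ φ)((x ⊗ 1)Δ(y p)(q ⊗ 1)) = φ(x q) φ(y p)`. -/
theorem pairing_dualT₂ (hε : IsCounit G.Δ ε) (hS : IsAntipode G.Δ ε S)
    (w : G.dual ⊗[ℂ] G.dual) (x y : A) :
    G.pairing (dualT₂ hε hS w) (x ⊗ₜ y) = G.pairing w (G.E₃ (y ⊗ₜ x)) := by
  obtain ⟨t, rfl⟩ := (TensorProduct.congr (leftEquiv hε hS) (leftEquiv hε hS)).surjective w
  obtain ⟨u, rfl⟩ := G.E₁_bijective.2 t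
  have hN := G.nondeg₂
  rw [dualT₂_apply, pairing_congr_leftEquiv, pairing_congr_leftEquiv]
  have h : ∀ t, G.E₃ (y ⊗ₜ x) * t = (leg₁ A A x).L ((G.Δ y).L t) := fun t => by
    apply incl_injective hN
    rw [map_mul, incl_E₃, T₃_tmul, ← mul_incl _ _ hN, ← mul_incl _ _ hN, mul_assoc]
  rw [h, sliceSnd_L_leg₁]
  induction u with
  | zero => simp
  | add s s' hs hs' => simp only [map_add, mul_add, hs, hs']
  | tmul p q =>
    rw [Δ_L_E₁, sliceSnd_φ_E₁]
    simp [mul_smul_comm]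

/-- `dualT₃` is dual to `x ⊗ y ↦ Δ(x)(1 ⊗ y)`, by right invariance of `ψ`. -/
theorem pairing_dualT₃ (hε : IsCounit G.Δ ε) (hS : IsAntipode G.Δ ε S)
    (w : G.dual ⊗[ℂ] G.dual) (x y : A) :
    G.pairing (dualT₃ hε hS w) (x ⊗ₜ y) = G.pairing w (G.E₂ (x ⊗ₜ y)) := by
  obtain ⟨t, rfl⟩ := (TensorProduct.congr (rightEquiv hε hS) (rightEquiv hε hS)).surjective w
  obtain ⟨u, rfl⟩ := G.E₄_bijective.2 t
  have hN := G.nondeg₂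
  rw [dualT₃_apply, pairing_congr_rightEquiv, pairing_congr_rightEquiv]
  have h : ∀ t, t * G.E₂ (x ⊗ₜ y) = (leg₂ A A y).R ((G.Δ x).R t) := fun t => by
    apply incl_injective hN
    rw [map_mul, incl_E₂, T₂_tmul, ← incl_mul _ _ hN, ← incl_mul _ _ hN, mul_assoc]
  rw [h, sliceFst_R_leg₂]
  induction u with
  | zero => simp
  | add s s' hs hs' => simp only [map_add, add_mul, hs, hs']
  | tmul p q =>
    rw [Δ_R_E₄, sliceFst_ψ_E₄ hε hS]
    simp [smul_mul_assoc]

theorem pairing_dualT₂_tmul (hε : IsCounit G.Δ ε) (hS : IsAntipode G.Δ ε S)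
    (ω₁ ω₂ : G.dual) (x y : A) :
    G.pairing (dualT₂ hε hS (ω₁ ⊗ₜ ω₂)) (x ⊗ₜ y) = ω₁.1 (x * G.rightConv ω₂.1 y) := by
  rw [pairing_dualT₂, pairing_tmul, (slicesInAlgebra_coe ω₂).mul_rightConv]

theorem pairing_dualT₃_tmul (hε : IsCounit G.Δ ε) (hS : IsAntipode G.Δ ε S)
    (ω₁ ω₂ : G.dual) (x y : A) :
    G.pairing (dualT₃ hε hS (ω₁ ⊗ₜ ω₂)) (x ⊗ₜ y) = ω₂.1 (G.leftConv ω₁.1 x * y) := by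
  rw [pairing_dualT₃, pairing_tmul, (slicesInAlgebra_coe ω₁).leftConv_mul, apply_sliceSnd]

/-! ### The comultiplication of the dual -/

/-- Left multiplication by `Δ̂(ω)`. -/
def dualL (hε : IsCounit G.Δ ε) (hS : IsAntipode G.Δ ε S) (ω : G.dual) :
    G.dual ⊗[ℂ] G.dual →ₗ[ℂ] G.dual ⊗[ℂ] G.dual :=
  TensorProduct.lift (LinearMap.mk₂ ℂ
    (fun β₁ β₂ => (leg₁ G.dual G.dual β₁).R (dualT₂ hε hS (ω ⊗ₜ β₂)))
    (by simp) (by simp) (by simp [TensorProduct.tmul_add]) (by simp))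

/-- Right multiplication by `Δ̂(ω)`. -/
def dualR (hε : IsCounit G.Δ ε) (hS : IsAntipode G.Δ ε S) (ω : G.dual) :
    G.dual ⊗[ℂ] G.dual →ₗ[ℂ] G.dual ⊗[ℂ] G.dual :=
  TensorProduct.lift (LinearMap.mk₂ ℂ
    (fun α₁ α₂ => (leg₂ G.dual G.dual α₂).L (dualT₃ hε hS (α₁ ⊗ₜ ω)))
    (by simp [TensorProduct.add_tmul]) (by simp [← TensorProduct.smul_tmul']) (by simp) (by simp))

theorem dualL_tmul (hε : IsCounit G.Δ ε) (hS : IsAntipode G.Δ ε S) (ω β₁ β₂ : G.dual) :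
    dualL hε hS ω (β₁ ⊗ₜ β₂) = (leg₁ G.dual G.dual β₁).R (dualT₂ hε hS (ω ⊗ₜ β₂)) := rfl

theorem dualR_tmul (hε : IsCounit G.Δ ε) (hS : IsAntipode G.Δ ε S) (ω α₁ α₂ : G.dual) :
    dualR hε hS ω (α₁ ⊗ₜ α₂) = (leg₂ G.dual G.dual α₂).L (dualT₃ hε hS (α₁ ⊗ₜ ω)) := rfl

/-- `Δ̂(ω)(β₁ ⊗ β₂)` is `x ⊗ y ↦ ω(x₁ y₁) β₁(x₂) β₂(y₂)`. -/
theorem pairing_dualL (hε : IsCounit G.Δ ε) (hS : IsAntipode G.Δ ε S) (ω β₁ β₂ : G.dual)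
    (x y : A) : G.pairing (dualL hε hS ω (β₁ ⊗ₜ β₂)) (x ⊗ₜ y) =
      ω.1 (G.rightConv β₁.1 x * G.rightConv β₂.1 y) := by
  rw [dualL_tmul, pairing_leg₁_R, pairing_dualT₂_tmul]

theorem pairing_dualR (hε : IsCounit G.Δ ε) (hS : IsAntipode G.Δ ε S) (ω α₁ α₂ : G.dual)
    (x y : A) : G.pairing (dualR hε hS ω (α₁ ⊗ₜ α₂)) (x ⊗ₜ y) =
      ω.1 (G.leftConv α₁.1 x * G.leftConv α₂.1 y) := by
  rw [dualR_tmul, pairing_leg₂_L, pairing_dualT₃_tmul]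

/-- `dualL` and `dualR` are the two sides of a multiplier: both expressions are the functional
`x ⊗ y ↦ ω(x₂ y₂) (α₁ ⊗ α₂)(x₁ ⊗ y₁) (β₁ ⊗ β₂)(x₃ ⊗ y₃)`. -/
theorem dualR_mul (hε : IsCounit G.Δ ε) (hS : IsAntipode G.Δ ε S) (ω : G.dual)
    (s t : G.dual ⊗[ℂ] G.dual) : dualR hε hS ω s * t = s * dualL hε hS ω t := by
  induction s with
  | zero => simp
  | add s s' hs hs' => simp only [map_add, add_mul, hs, hs']
  | tmul α₁ α₂ =>
    induction t with
    | zero => simp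
    | add s s' hs hs' => simp only [map_add, mul_add, hs, hs']
    | tmul β₁ β₂ =>
      refine eq_of_pairing fun x y => ?_
      rw [mul_tmul_eq, tmul_mul_eq, pairing_leg₁_R, pairing_leg₂_R, pairing_dualR,
        pairing_leg₁_L, pairing_leg₂_L, pairing_dualL]
      rw [leftConv_rightConv_comm_of_left _ (isTranslate_coe α₁) (slicesInAlgebra_coe β₁),
        leftConv_rightConv_comm_of_left _ (isTranslate_coe α₂) (slicesInAlgebra_coe β₂)]

/-- The bilinear extension of `β₁ ⊗ β₂ ↦ (ι ⊗ β₁)Δ(x) (ι ⊗ β₂)Δ(y)`. -/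
def convMul (G : AlgebraicQuantumGroup A) (x y : A) : G.dual ⊗[ℂ] G.dual →ₗ[ℂ] A :=
  TensorProduct.lift (LinearMap.mk₂ ℂ (fun β₁ β₂ => G.rightConv β₁.1 x * G.rightConv β₂.1 y)
    (by simp [rightConv_add, add_mul]) (by simp [rightConv_smul, smul_mul_assoc])
    (by simp [rightConv_add, mul_add]) (by simp [rightConv_smul, mul_smul_comm]))

theorem apply_convMul (hε : IsCounit G.Δ ε) (hS : IsAntipode G.Δ ε S) (ω : G.dual)
    (t : G.dual ⊗[ℂ] G.dual) (x y : A) :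
    ω.1 (convMul G x y t) = G.pairing (dualL hε hS ω t) (x ⊗ₜ y) := by
  induction t with
  | zero => simp
  | add s s' hs hs' => simp only [map_add, LinearMap.add_apply, hs, hs']
  | tmul β₁ β₂ =>
    rw [pairing_dualL]
    rfl

theorem sliceSnd_leftComm (f : Module.Dual ℂ (A ⊗[ℂ] A)) (q : A) (v : A ⊗[ℂ] A) :
    sliceSnd f (TensorProduct.leftComm ℂ A A A (q ⊗ₜ v)) =
      sliceSnd (f ∘ₗ TensorProduct.mk ℂ A A q) v := by
  induction v with
  | zero => simp
  | add s s' hs hs' => simp only [map_add, TensorProduct.tmul_add, hs, hs']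
  | tmul r s => simp

/-- `(c ⊗ 1 ⊗ 1)Δ(x)₁₂Δ(y)₁₃` as a linear function of `(c ⊗ 1)Δ(x)`. -/
def mulΔ₁₃ (G : AlgebraicQuantumGroup A) (y : A) : A ⊗[ℂ] A →ₗ[ℂ] A ⊗[ℂ] (A ⊗[ℂ] A) :=
  (TensorProduct.leftComm ℂ A A A).toLinearMap ∘ₗ
    LinearMap.lTensor A (G.E₃ ∘ₗ TensorProduct.mk ℂ A A y) ∘ₗ
    (TensorProduct.comm ℂ A A).toLinearMap

theorem sliceSnd_mulΔ₁₃ (f : Module.Dual ℂ (A ⊗[ℂ] A)) (p q y : A) :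
    sliceSnd f (mulΔ₁₃ G y (p ⊗ₜ q)) =
      sliceSnd (f ∘ₗ TensorProduct.mk ℂ A A q) (G.E₃ (y ⊗ₜ p)) :=
  sliceSnd_leftComm f q _

/-- `c ∑ (ι ⊗ t₁)Δ(x) (ι ⊗ t₂)Δ(y)` depends only on `t` as a functional on `A ⊗ A`. -/
theorem mul_convMul (c x y : A) (t : G.dual ⊗[ℂ] G.dual) :
    c * convMul G x y t = sliceSnd (G.pairing t) (mulΔ₁₃ G y (G.E₃ (x ⊗ₜ c))) := by
  induction t with
  | zero => simp [sliceSnd]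
  | add t t' ht ht' => rw [map_add, mul_add, ht, ht']; simp [sliceSnd, LinearMap.lTensor_add]
  | tmul β₁ β₂ =>
    have h1 : c * convMul G x y (β₁ ⊗ₜ β₂) =
        c * G.rightConv β₁.1 x * G.rightConv β₂.1 y := (mul_assoc _ _ _).symm
    rw [h1, (slicesInAlgebra_coe β₁).mul_rightConv]
    generalize G.E₃ (x ⊗ₜ c) = s
    induction s with
    | zero => simp
    | add s s' hs hs' => simp only [map_add, add_mul, hs, hs']
    | tmul p q =>
      have h2 : G.pairing (β₁ ⊗ₜ β₂) ∘ₗ TensorProduct.mk ℂ A A q = β₁.1 q • β₂.1 := by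
        ext z
        simp [pairing_tmul, mul_comm]
      rw [sliceSnd_mulΔ₁₃, h2, sliceSnd_smul, ← (slicesInAlgebra_coe β₂).mul_rightConv,
        sliceSnd_tmul, smul_mul_assoc]

/-- `∑ (ι ⊗ α₁)Δ(x) (ι ⊗ α₂)Δ(y) = (ι ⊗ ω)Δ((ι ⊗ β₁)Δ(x) (ι ⊗ β₂)Δ(y))` where
`∑ α₁ ⊗ α₂ = Δ̂(ω)(β₁ ⊗ β₂)`. -/
theorem convMul_dualL (hε : IsCounit G.Δ ε) (hS : IsAntipode G.Δ ε S) (ω β₁ β₂ : G.dual)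
    (x y : A) : convMul G x y (dualL hε hS ω (β₁ ⊗ₜ β₂)) =
      G.rightConv ω.1 (G.rightConv β₁.1 x * G.rightConv β₂.1 y) := by
  refine sub_eq_zero.1 ((G.nondegenerate _).2 fun c => ?_)
  have h₁ := slicesInAlgebra_coe β₁
  have h₂ := slicesInAlgebra_coe β₂
  rw [mul_sub, mul_convMul, (slicesInAlgebra_coe ω).mul_rightConv, sub_eq_zero, ← Δ_R_E₃,
    E₃_rightConv _ h₁]
  generalize G.E₃ (x ⊗ₜ c) = s
  induction s with
  | zero => simp
  | add s s' hs hs' => simp only [map_add, hs, hs']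
  | tmul p q =>
    have h3 : G.pairing (dualL hε hS ω (β₁ ⊗ₜ β₂)) ∘ₗ TensorProduct.mk ℂ A A q =
        (ω.1 ∘ₗ LinearMap.mulLeft ℂ (G.rightConv β₁.1 q)) ∘ₗ G.rightConv β₂.1 := by
      ext z
      simp [pairing_dualL]
    rw [sliceSnd_mulΔ₁₃, h3, ← sliceSnd_lTensor, ← sliceSnd_lTensor,
      ← E₃_rightConv _ h₂, LinearMap.lTensor_tmul, ← leg₂_L_E₃, leg₂_L_eq]

/-- `Δ̂` is multiplicative because `Δ` is: `Δ̂(ω)` is dual to the product of `A`. -/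
theorem dualL_mul (hε : IsCounit G.Δ ε) (hS : IsAntipode G.Δ ε S) (ω ω' : G.dual)
    (t : G.dual ⊗[ℂ] G.dual) : dualL hε hS (ω * ω') t = dualL hε hS ω (dualL hε hS ω' t) := by
  induction t with
  | zero => simp
  | add s s' hs hs' => simp only [map_add, hs, hs']
  | tmul β₁ β₂ =>
    refine eq_of_pairing fun x y => ?_
    rw [← apply_convMul hε hS ω, convMul_dualL, pairing_dualL, mul_apply]

end AlgebraicQuantumGroup

theorem Multiplier.ext_L {B : Type*} [NonUnitalRing B] [Module ℂ B] [IsScalarTower ℂ B B]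
    [SMulCommClass ℂ B B] (hB : NondegenerateAlgebra B) {m n : Multiplier B}
    (h : ∀ x, m.L x = n.L x) : m = n :=
  ext' h fun x => sub_eq_zero.1 ((hB _).1 fun y => by
    rw [sub_mul, balanced, balanced, h, sub_self])

namespace AlgebraicQuantumGroup

open RegularMultiplierHopfAlgebra

variable {A : Type*} [NonUnitalRing A] [Module ℂ A] [IsScalarTower ℂ A A] [SMulCommClass ℂ A A]
variable {G : AlgebraicQuantumGroup A} {ε : A →ₙₐ[ℂ] ℂ} {S : A ≃ₗ[ℂ] A}

theorem nondegenerate_dual₂ (G : AlgebraicQuantumGroup A) :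
    NondegenerateAlgebra (G.dual ⊗[ℂ] G.dual) :=
  (nondegenerate_dual G).tensor (nondegenerate_dual G)

theorem dualL_add (hε : IsCounit G.Δ ε) (hS : IsAntipode G.Δ ε S) (ω ω' : G.dual)
    (t : G.dual ⊗[ℂ] G.dual) : dualL hε hS (ω + ω') t = dualL hε hS ω t + dualL hε hS ω' t := by
  induction t with
  | zero => simp
  | add s s' hs hs' => rw [map_add, map_add, map_add, hs, hs', add_add_add_comm]
  | tmul β₁ β₂ =>
    refine eq_of_pairing fun x y => ?_
    rw [map_add, LinearMap.add_apply, pairing_dualL, pairing_dualL, pairing_dualL]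
    rfl

theorem dualL_smul (hε : IsCounit G.Δ ε) (hS : IsAntipode G.Δ ε S) (c : ℂ) (ω : G.dual)
    (t : G.dual ⊗[ℂ] G.dual) : dualL hε hS (c • ω) t = c • dualL hε hS ω t := by
  induction t with
  | zero => simp
  | add s s' hs hs' => rw [map_add, map_add, hs, hs', smul_add]
  | tmul β₁ β₂ =>
    refine eq_of_pairing fun x y => ?_
    rw [map_smul, LinearMap.smul_apply, pairing_dualL, pairing_dualL]
    rfl

/-- The comultiplication `Δ̂` of the dual, as a homomorphism to the multipliers. -/
def dualComul (hε : IsCounit G.Δ ε) (hS : IsAntipode G.Δ ε S) :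
    G.dual →ₙₐ[ℂ] Multiplier (G.dual ⊗[ℂ] G.dual) where
  toFun ω := Multiplier.mk (dualL hε hS ω) (dualR hε hS ω) (dualR_mul hε hS ω)
  map_smul' c ω := Multiplier.ext_L (nondegenerate_dual₂ G) (dualL_smul hε hS c ω)
  map_zero' := Multiplier.ext_L (nondegenerate_dual₂ G) fun t => by
    rw [L_mk, L_zero_apply, ← zero_smul ℂ (0 : G.dual), dualL_smul, zero_smul]
  map_add' ω ω' := Multiplier.ext_L (nondegenerate_dual₂ G) (dualL_add hε hS ω ω')
  map_mul' ω ω' := Multiplier.ext_L (nondegenerate_dual₂ G) (dualL_mul hε hS ω ω')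

theorem dualComul_mul_leg₂ (hε : IsCounit G.Δ ε) (hS : IsAntipode G.Δ ε S) (ω₁ ω₂ : G.dual) :
    incl (dualT₂ hε hS (ω₁ ⊗ₜ ω₂)) = dualComul hε hS ω₁ * leg₂ G.dual G.dual ω₂ := by
  refine Multiplier.ext_L (nondegenerate_dual₂ G) fun t => ?_
  induction t with
  | zero => simp
  | add s s' hs hs' => rw [map_add, map_add, hs, hs']
  | tmul β₁ β₂ =>
    refine eq_of_pairing fun x y => ?_
    have h : (dualComul hε hS ω₁ * leg₂ G.dual G.dual ω₂).L (β₁ ⊗ₜ β₂) =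
        dualL hε hS ω₁ (β₁ ⊗ₜ (ω₂ * β₂)) := rfl
    rw [h, pairing_dualL, L_incl, mul_tmul_eq, pairing_leg₁_R, pairing_leg₂_R,
      pairing_dualT₂_tmul]
    congr 2
    refine G.eq_of_forall_rightTranslate fun η c => ?_
    have hη := isTranslate_rightTranslate η c
    change rightTranslate η c _ = rightTranslate η c _
    rw [apply_rightConv_eq hη (slicesInAlgebra_coe _), apply_rightConv_eq hη
      (slicesInAlgebra_coe _), mul_apply, leftConv_rightConv_comm_of_left _ hη
      (slicesInAlgebra_coe _)]

theorem leg₁_mul_dualComul (hε : IsCounit G.Δ ε) (hS : IsAntipode G.Δ ε S) (ω₁ ω₂ : G.dual) :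
    incl (dualT₃ hε hS (ω₁ ⊗ₜ ω₂)) = leg₁ G.dual G.dual ω₁ * dualComul hε hS ω₂ := by
  have hN := nondegenerate_dual₂ G
  have key : ∀ s, (incl (dualT₃ hε hS (ω₁ ⊗ₜ ω₂)) : Multiplier (G.dual ⊗[ℂ] G.dual)).R s =
      (leg₁ G.dual G.dual ω₁ * dualComul hε hS ω₂).R s := by
    intro s
    induction s with
    | zero => simp
    | add s s' hs hs' => rw [map_add, map_add, hs, hs']
    | tmul α₁ α₂ =>
      refine eq_of_pairing fun x y => ?_
      have h : (leg₁ G.dual G.dual ω₁ * dualComul hε hS ω₂).R (α₁ ⊗ₜ α₂) =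
          dualR hε hS ω₂ ((α₁ * ω₁) ⊗ₜ α₂) := rfl
      rw [h, pairing_dualR, R_incl, tmul_mul_eq, pairing_leg₁_L, pairing_leg₂_L,
        pairing_dualT₃_tmul]
      congr 2
      refine G.eq_of_forall_rightTranslate fun η c => ?_
      have hη := isTranslate_rightTranslate η c
      change rightTranslate η c _ = rightTranslate η c _
      rw [← apply_rightConv_eq' (slicesInAlgebra_coe _) hη, ← apply_rightConv_eq'
        (slicesInAlgebra_coe _) hη, mul_apply', leftConv_rightConv_comm_of_right _ hη
        (slicesInAlgebra_coe _)]
  refine ext' (fun t => ?_) key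
  refine sub_eq_zero.1 ((hN _).2 fun s => ?_)
  rw [mul_sub, ← balanced, ← balanced, key, sub_self]

/-- Products span the dual. -/
theorem exists_mul'_eq (hε : IsCounit G.Δ ε) (hS : IsAntipode G.Δ ε S) (ω : G.dual) :
    ∃ t : G.dual ⊗[ℂ] G.dual, LinearMap.mul' ℂ G.dual t = ω := by
  obtain ⟨x, rfl⟩ := (S.trans (leftEquiv hε hS)).surjective ω
  revert x
  refine G.induction_rightConv_rightTranslate G.φ_ne_zero ⟨0, by simp⟩ ?_ fun c x => ?_
  · rintro x y ⟨s, hs⟩ ⟨t, ht⟩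
    exact ⟨s + t, by rw [map_add, map_add, hs, ht]⟩
  · exact ⟨⟨_, c, rfl⟩ ⊗ₜ leftEquiv hε hS (S x), mul_leftEquiv hε hS ⟨_, c, rfl⟩ x⟩

theorem nondegenerateMap_dualComul (hε : IsCounit G.Δ ε) (hS : IsAntipode G.Δ ε S) :
    NondegenerateMap (dualComul hε hS : G.dual →ₗ[ℂ] Multiplier (G.dual ⊗[ℂ] G.dual)) := by
  constructor
  · rw [eq_top_iff]
    have key : ∀ (β : G.dual) w, (leg₁ G.dual G.dual β).R w ∈ Submodule.span ℂ
        {x | ∃ a b, x = ((dualComul hε hS : G.dual →ₗ[ℂ]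
          Multiplier (G.dual ⊗[ℂ] G.dual)) a).L b} := by
      intro β w
      obtain ⟨u, rfl⟩ := (dualT₂ hε hS).surjective w
      induction u with
      | zero => simp
      | add s s' hs hs' => rw [map_add, map_add]; exact add_mem hs hs'
      | tmul ω₁ ω₂ => exact Submodule.subset_span ⟨ω₁, β ⊗ₜ ω₂, rfl⟩
    rintro t -
    induction t with
    | zero => exact zero_mem _
    | add s s' hs hs' => exact add_mem hs hs'
    | tmul α β =>
      obtain ⟨u, rfl⟩ := exists_mul'_eq hε hS α
      induction u with
      | zero => simp
      | add s s' hs hs' => rw [map_add, TensorProduct.add_tmul]; exact add_mem hs hs'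
      | tmul γ δ => exact key δ (γ ⊗ₜ β)
  · rw [eq_top_iff]
    have key : ∀ (α : G.dual) w, (leg₂ G.dual G.dual α).L w ∈ Submodule.span ℂ
        {x | ∃ a b, x = ((dualComul hε hS : G.dual →ₗ[ℂ]
          Multiplier (G.dual ⊗[ℂ] G.dual)) a).R b} := by
      intro α w
      obtain ⟨u, rfl⟩ := (dualT₃ hε hS).surjective w
      induction u with
      | zero => simp
      | add s s' hs hs' => rw [map_add, map_add]; exact add_mem hs hs'
      | tmul ω₁ ω₂ => exact Submodule.subset_span ⟨ω₂, ω₁ ⊗ₜ α, rfl⟩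
    rintro t -
    induction t with
    | zero => exact zero_mem _
    | add s s' hs hs' => exact add_mem hs hs'
    | tmul α β =>
      obtain ⟨u, rfl⟩ := exists_mul'_eq hε hS β
      induction u with
      | zero => simp
      | add s s' hs hs' => rw [map_add, TensorProduct.tmul_add]; exact add_mem hs hs'
      | tmul γ δ => exact key γ (α ⊗ₜ δ)

theorem isDualComul_dualComul (hε : IsCounit G.Δ ε) (hS : IsAntipode G.Δ ε S) :
    G.IsDualComul (dualComul hε hS) where
  nondegenerate := nondegenerateMap_dualComul hε hS
  mul_leg₂ ω₁ ω₂ := ⟨_, dualComul_mul_leg₂ hε hS ω₁ ω₂, pairing_dualT₂ hε hS _⟩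
  leg₁_mul ω₁ ω₂ := ⟨_, leg₁_mul_dualComul hε hS ω₁ ω₂, pairing_dualT₃ hε hS _⟩

theorem IsDualComul.eq {Δ₁ Δ₂ : G.dual →ₙₐ[ℂ] Multiplier (G.dual ⊗[ℂ] G.dual)}
    (h₁ : G.IsDualComul Δ₁) (h₂ : G.IsDualComul Δ₂) : Δ₁ = Δ₂ := by
  have hN := nondegenerate_dual₂ G
  have h : ∀ ω₁ ω₂, Δ₁ ω₁ * leg₂ G.dual G.dual ω₂ = Δ₂ ω₁ * leg₂ G.dual G.dual ω₂ := by
    intro ω₁ ω₂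
    obtain ⟨t₁, ht₁, e₁⟩ := h₁.mul_leg₂ ω₁ ω₂
    obtain ⟨t₂, ht₂, e₂⟩ := h₂.mul_leg₂ ω₁ ω₂
    rw [← ht₁, ← ht₂, eq_of_pairing fun x y => (e₁ x y).trans (e₂ x y).symm]
  ext ω : 1
  refine Multiplier.ext_L hN fun t => incl_injective hN ?_
  induction t with
  | zero => simp
  | add s s' hs hs' => simp only [map_add, hs, hs']
  | tmul α β =>
    rw [← mul_incl _ _ hN, ← mul_incl _ _ hN, ← leg₂_mul_leg₁, ← mul_assoc, ← mul_assoc, h]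


/-! ### The counit of the dual -/

/-- The counit of the dual, `a φ ↦ φ(a)`. -/
def dualCounit (hε : IsCounit G.Δ ε) (hS : IsAntipode G.Δ ε S) : G.dual →ₙₐ[ℂ] ℂ where
  toFun ω := G.φ ((leftEquiv hε hS).symm ω)
  map_smul' c ω := by simp
  map_zero' := by simp
  map_add' ω ω' := by simp
  map_mul' ω ω' := by
    obtain ⟨a, rfl⟩ := (leftEquiv hε hS).surjective ω
    obtain ⟨x, rfl⟩ := (S.trans (leftEquiv hε hS)).surjective ω'
    rw [LinearEquiv.trans_apply, mul_leftEquiv, LinearEquiv.symm_apply_apply,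
      LinearEquiv.symm_apply_apply, LinearEquiv.symm_apply_apply, coe_leftEquiv,
      ψ_rightConv_leftTranslate hε hS, mul_comm]

@[simp] theorem dualCounit_leftEquiv (hε : IsCounit G.Δ ε) (hS : IsAntipode G.Δ ε S) (a : A) :
    dualCounit hε hS (leftEquiv hε hS a) = G.φ a :=
  congrArg G.φ ((leftEquiv hε hS).symm_apply_apply a)

@[simp] theorem dualCounit_rightEquiv (hε : IsCounit G.Δ ε) (hS : IsAntipode G.Δ ε S) (a : A) :
    dualCounit hε hS (rightEquiv hε hS a) = G.φ (S a) := by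
  obtain ⟨x, hx⟩ := exists_φ_antipode_ne_zero G S
  have h := congrArg (dualCounit hε hS) (mul_leftEquiv hε hS (rightEquiv hε hS a) x)
  rw [map_mul, dualCounit_leftEquiv, dualCounit_leftEquiv, coe_rightEquiv,
    ψ_rightConv_rightTranslate hε hS, mul_comm] at h
  exact mul_left_cancel₀ hx h

theorem dualCounit_ne_zero (hε : IsCounit G.Δ ε) (hS : IsAntipode G.Δ ε S) :
    dualCounit hε hS ≠ 0 := fun h =>
  G.φ_ne_zero (LinearMap.ext fun a => by rw [← dualCounit_leftEquiv hε hS, h]; rfl)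

theorem sliceFst_dualCounit_congr (hε : IsCounit G.Δ ε) (hS : IsAntipode G.Δ ε S)
    (t : A ⊗[ℂ] A) :
    sliceFst (dualCounit hε hS : G.dual →ₗ[ℂ] ℂ)
        (TensorProduct.congr (leftEquiv hε hS) (leftEquiv hε hS) t) =
      leftEquiv hε hS (sliceFst G.φ t) := by
  induction t with
  | zero => simp
  | add s s' hs hs' => simp only [map_add, hs, hs']
  | tmul p q => simp

theorem sliceSnd_dualCounit_congr (hε : IsCounit G.Δ ε) (hS : IsAntipode G.Δ ε S)
    (t : A ⊗[ℂ] A) :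
    sliceSnd (dualCounit hε hS : G.dual →ₗ[ℂ] ℂ)
        (TensorProduct.congr (leftEquiv hε hS) (leftEquiv hε hS) t) =
      leftEquiv hε hS (sliceSnd G.φ t) := by
  induction t with
  | zero => simp
  | add s s' hs hs' => simp only [map_add, hs, hs']
  | tmul p q => simp

theorem sliceSnd_dualCounit_congr_right (hε : IsCounit G.Δ ε) (hS : IsAntipode G.Δ ε S)
    (t : A ⊗[ℂ] A) :
    sliceSnd (dualCounit hε hS : G.dual →ₗ[ℂ] ℂ)
        (TensorProduct.congr (rightEquiv hε hS) (rightEquiv hε hS) t) =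
      rightEquiv hε hS (sliceSnd (G.φ ∘ₗ S.toLinearMap) t) := by
  induction t with
  | zero => simp
  | add s s' hs hs' => simp only [map_add, hs, hs']
  | tmul p q => simp

/-- `(p φ)(q φ)` is the functional `x ↦ (φ ⊗ φ)(Δ(x)(p ⊗ q))`. -/
theorem mul'_congr_leftEquiv_apply (hε : IsCounit G.Δ ε) (hS : IsAntipode G.Δ ε S)
    (t : A ⊗[ℂ] A) (x : A) :
    (LinearMap.mul' ℂ G.dual (TensorProduct.congr (leftEquiv hε hS) (leftEquiv hε hS) t)).1 x =
      G.φ (sliceSnd G.φ ((G.Δ x).L t)) := by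
  induction t with
  | zero => simp
  | add s s' hs hs' => simp only [map_add, Submodule.coe_add, LinearMap.add_apply, hs, hs']
  | tmul p q =>
    rw [TensorProduct.congr_tmul, LinearMap.mul'_apply, mul_apply, coe_leftEquiv, coe_leftEquiv,
      rightConv_leftTranslate, leftTranslate_apply, ← leg₁_R_E₂, sliceSnd_R_leg₁]

/-- `(ε̂ ⊗ ι)(Δ̂(ω₁)(1 ⊗ ω₂)) = ω₁ ω₂`. -/
theorem sliceFst_dualCounit_dualT₂ (hε : IsCounit G.Δ ε) (hS : IsAntipode G.Δ ε S)
    (w : G.dual ⊗[ℂ] G.dual) :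
    sliceFst (dualCounit hε hS : G.dual →ₗ[ℂ] ℂ) (dualT₂ hε hS w) =
      LinearMap.mul' ℂ G.dual w := by
  obtain ⟨t, rfl⟩ := (TensorProduct.congr (leftEquiv hε hS) (leftEquiv hε hS)).surjective w
  obtain ⟨u, rfl⟩ := G.E₁_bijective.2 t
  rw [dualT₂_apply, sliceFst_dualCounit_congr]
  refine Subtype.ext (LinearMap.ext fun x => ?_)
  rw [mul'_congr_leftEquiv_apply]
  induction u with
  | zero => simp
  | add s s' hs hs' => simp only [map_add, Submodule.coe_add, LinearMap.add_apply, hs, hs']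
  | tmul p q => rw [Δ_L_E₁, sliceSnd_φ_E₁]; simp [coe_leftEquiv, mul_comm]

/-- `(ι ⊗ ε̂)(Δ̂(ω₁)(1 ⊗ ω₂)) = ε̂(ω₂) ω₁`. -/
theorem sliceSnd_dualCounit_dualT₂ (hε : IsCounit G.Δ ε) (hS : IsAntipode G.Δ ε S)
    (w : G.dual ⊗[ℂ] G.dual) :
    sliceSnd (dualCounit hε hS : G.dual →ₗ[ℂ] ℂ) (dualT₂ hε hS w) =
      sliceSnd (dualCounit hε hS : G.dual →ₗ[ℂ] ℂ) w := by
  obtain ⟨t, rfl⟩ := (TensorProduct.congr (leftEquiv hε hS) (leftEquiv hε hS)).surjective w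
  obtain ⟨u, rfl⟩ := G.E₁_bijective.2 t
  rw [dualT₂_apply, sliceSnd_dualCounit_congr, sliceSnd_dualCounit_congr]
  congr 1
  induction u with
  | zero => simp
  | add s s' hs hs' => simp only [map_add, hs, hs']
  | tmul p q => rw [sliceSnd_φ_E₁]; simp

theorem isCounit_dualCounit (hε : IsCounit G.Δ ε) (hS : IsAntipode G.Δ ε S) :
    IsCounit (dualComul hε hS) (dualCounit hε hS) :=
  isCounit_of_slices (nondegenerate_dual G) _ _ (dualCounit_ne_zero hε hS) fun ω₁ ω₂ =>
    ⟨_, dualComul_mul_leg₂ hε hS ω₁ ω₂, sliceFst_dualCounit_dualT₂ hε hS _,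
      (sliceSnd_dualCounit_dualT₂ hε hS _).trans (sliceSnd_tmul _ _ _)⟩

/-- If `θ` implements `m`, then `m` multiplies the Fourier transform `S(x) φ` of `x` into
that of `(ι ⊗ θ)Δ(x)`; evaluating the counit gives `ε̂(m)` as the factor in the right invariance
of `φ ∘ S`. -/
theorem extendChar_dualCounit (hε : IsCounit G.Δ ε) (hS : IsAntipode G.Δ ε S)
    (hχ : ∃ e, dualCounit hε hS e = 1) {θ : Module.Dual ℂ A} (hθ : G.SlicesInAlgebra θ)
    {m : Multiplier G.dual} (hm : G.Implements θ m) {c : ℂ}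
    (hc : ∀ x, G.φ (S (G.rightConv θ x)) = G.φ (S x) * c) :
    extendChar (dualCounit hε hS) hχ m = c := by
  obtain ⟨x, hx⟩ := exists_φ_antipode_ne_zero G S
  have h1 : m.L (leftEquiv hε hS (S x)) = leftEquiv hε hS (S (G.rightConv θ x)) :=
    Subtype.ext (LinearMap.ext fun y => by
      rw [(hm _ y).1, apply_rightConv_leftEquiv hε hS hθ])
  have h2 := (extendChar_mul_apply (dualCounit hε hS) hχ m (leftEquiv hε hS (S x))).1
  rw [h1, dualCounit_leftEquiv, dualCounit_leftEquiv, hc, mul_comm] at h2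
  exact (mul_right_cancel₀ hx h2).symm

/-! ### The antipode of the dual -/

theorem comp_antipode_mem_dual (hε : IsCounit G.Δ ε) (hS : IsAntipode G.Δ ε S) (ω : G.dual) :
    ω.1 ∘ₗ S.toLinearMap ∈ G.dual := by
  obtain ⟨_, a, rfl⟩ := ω
  obtain ⟨b, rfl⟩ := S.surjective a
  exact range_leftTranslate_ψ_le hε hS ⟨b, (hS.rightTranslate_comp G.φ b).symm⟩

theorem comp_antipode_symm_mem_dual (hε : IsCounit G.Δ ε) (hS : IsAntipode G.Δ ε S)
    (ω : G.dual) : ω.1 ∘ₗ S.symm.toLinearMap ∈ G.dual := by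
  obtain ⟨b, rfl⟩ := (rightEquiv hε hS).surjective ω
  refine (range_leftTranslate_φ hε hS).le ⟨S b, LinearMap.ext fun x => ?_⟩
  simp [coe_rightEquiv, hS.anti_mul]

/-- The antipode of the dual, `ω ↦ ω ∘ S`. -/
def dualAntipode (hε : IsCounit G.Δ ε) (hS : IsAntipode G.Δ ε S) : G.dual ≃ₗ[ℂ] G.dual where
  toFun ω := ⟨ω.1 ∘ₗ S.toLinearMap, comp_antipode_mem_dual hε hS ω⟩
  invFun ω := ⟨ω.1 ∘ₗ S.symm.toLinearMap, comp_antipode_symm_mem_dual hε hS ω⟩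
  map_add' _ _ := rfl
  map_smul' _ _ := rfl
  left_inv ω := Subtype.ext (LinearMap.ext fun x => by simp)
  right_inv ω := Subtype.ext (LinearMap.ext fun x => by simp)

theorem coe_dualAntipode (hε : IsCounit G.Δ ε) (hS : IsAntipode G.Δ ε S) (ω : G.dual) :
    (dualAntipode hε hS ω).1 = ω.1 ∘ₗ S.toLinearMap := rfl

theorem dualAntipode_anti_mul (hε : IsCounit G.Δ ε) (hS : IsAntipode G.Δ ε S) (ω₁ ω₂ : G.dual) :
    dualAntipode hε hS (ω₁ * ω₂) = dualAntipode hε hS ω₂ * dualAntipode hε hS ω₁ := by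
  refine Subtype.ext (LinearMap.ext fun x => ?_)
  rw [mul_apply, coe_dualAntipode, coe_dualAntipode, coe_dualAntipode, LinearMap.comp_apply,
    LinearMap.comp_apply, LinearEquiv.coe_coe, antipode_rightConv hε hS (isTranslate_coe ω₁),
    mul_apply']

/-- On `w = ∑ a φ ⊗ b φ` with `∑ a ⊗ b = Δ(p)(q ⊗ 1)`, this is strong left invariance. -/
theorem mul'_dualAntipode_dualT₂ (hε : IsCounit G.Δ ε) (hS : IsAntipode G.Δ ε S)
    (w : G.dual ⊗[ℂ] G.dual) :
    LinearMap.mul' ℂ G.dual (TensorProduct.map (dualAntipode hε hS).toLinearMap LinearMap.id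
        (dualT₂ hε hS w)) = sliceFst (dualCounit hε hS : G.dual →ₗ[ℂ] ℂ) w := by
  obtain ⟨t, rfl⟩ := (TensorProduct.congr (leftEquiv hε hS) (leftEquiv hε hS)).surjective w
  obtain ⟨u, rfl⟩ := G.E₁_bijective.2 t
  rw [dualT₂_apply, sliceFst_dualCounit_congr]
  induction u with
  | zero => simp
  | add s s' hs hs' => simp only [map_add, hs, hs']
  | tmul p q =>
    refine Subtype.ext (LinearMap.ext fun x => ?_)
    rw [TensorProduct.comm_tmul, TensorProduct.congr_tmul, TensorProduct.map_tmul,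
      LinearMap.mul'_apply, LinearMap.id_apply, LinearEquiv.coe_coe, mul_apply, coe_dualAntipode,
      LinearMap.comp_apply, LinearEquiv.coe_coe, coe_leftEquiv, coe_leftEquiv, coe_leftEquiv,
      antipode_rightConv_φ hε hS, leftTranslate_apply, leftTranslate_apply,
      (G.slicesInAlgebra_rightTranslate G.φ x).rightConv_mul, apply_sliceSnd, rightTranslate_apply]

/-- On `w = ∑ ψ a ⊗ ψ b` with `∑ a ⊗ b = (1 ⊗ q)Δ(p)`, this is strong right invariance. -/
theorem mul'_dualAntipode_dualT₃ (hε : IsCounit G.Δ ε) (hS : IsAntipode G.Δ ε S)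
    (w : G.dual ⊗[ℂ] G.dual) :
    LinearMap.mul' ℂ G.dual (TensorProduct.map LinearMap.id (dualAntipode hε hS).toLinearMap
        (dualT₃ hε hS w)) = sliceSnd (dualCounit hε hS : G.dual →ₗ[ℂ] ℂ) w := by
  obtain ⟨t, rfl⟩ := (TensorProduct.congr (rightEquiv hε hS) (rightEquiv hε hS)).surjective w
  obtain ⟨u, rfl⟩ := G.E₄_bijective.2 t
  rw [dualT₃_apply, sliceSnd_dualCounit_congr_right]
  induction u with
  | zero => simp
  | add s s' hs hs' => simp only [map_add, hs, hs']
  | tmul p q =>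
    refine Subtype.ext (LinearMap.ext fun x => ?_)
    rw [TensorProduct.congr_tmul, TensorProduct.map_tmul, LinearMap.mul'_apply,
      LinearMap.id_apply, LinearEquiv.coe_coe, mul_apply', coe_dualAntipode,
      LinearMap.comp_apply, LinearEquiv.coe_coe, coe_rightEquiv, coe_rightEquiv, coe_rightEquiv,
      antipode_leftConv_ψ hε hS, rightTranslate_apply, rightTranslate_apply,
      (G.slicesInAlgebra_leftTranslate _ x).mul_leftConv, ← apply_sliceSnd, leftTranslate_apply]

theorem isAntipode_dualAntipode (hε : IsCounit G.Δ ε) (hS : IsAntipode G.Δ ε S) :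
    IsAntipode (dualComul hε hS) (dualCounit hε hS) (dualAntipode hε hS) where
  anti_mul := dualAntipode_anti_mul hε hS
  left ω₁ ω₂ := ⟨_, dualComul_mul_leg₂ hε hS ω₁ ω₂,
    (mul'_dualAntipode_dualT₂ hε hS _).trans (sliceFst_tmul _ _ _)⟩
  right ω₁ ω₂ := ⟨_, leg₁_mul_dualComul hε hS ω₂ ω₁,
    (mul'_dualAntipode_dualT₃ hε hS _).trans (sliceSnd_tmul _ _ _)⟩

theorem eq_dualAntipode {hε : IsCounit G.Δ ε} {hS : IsAntipode G.Δ ε S}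
    {S' : G.dual ≃ₗ[ℂ] G.dual} (h : IsAntipode (dualComul hε hS) (dualCounit hε hS) S') :
    S' = dualAntipode hε hS :=
  IsAntipode.unique (nondegenerate_dual G) (dualT₂ hε hS).toLinearMap (dualT₂ hε hS).surjective
    (dualComul_mul_leg₂ hε hS) h (isAntipode_dualAntipode hε hS)

/-- `Ŝ(m)` is implemented by `θ ∘ S`: `(Ŝ(m) Ŝ(η))(x) = Ŝ(η m)(x) = (η m)(S(x))`, and
`(η ⊗ ι)Δ(S(x)) = S((ι ⊗ ηS)Δ(x))`. -/
theorem eq_comp_antipode_of_implements (hε : IsCounit G.Δ ε) (hS : IsAntipode G.Δ ε S)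
    {θ θ' : Module.Dual ℂ A} {m : Multiplier G.dual} (hm : G.Implements θ m)
    (hm' : G.Implements θ'
      (extendAnti (dualAntipode hε hS) (dualAntipode_anti_mul hε hS) m)) :
    θ' = θ ∘ₗ S.toLinearMap := by
  refine eq_of_apply_rightConv (G := G) fun ω x => ?_
  obtain ⟨η, rfl⟩ := (dualAntipode hε hS).surjective ω
  rw [← (hm' _ x).1, LinearMap.comp_apply, LinearEquiv.coe_coe, coe_dualAntipode,
    antipode_rightConv hε hS (isTranslate_coe η), ← (hm η (S x)).2]
  change (m.R ((dualAntipode hε hS).symm (dualAntipode hε hS η))).1 (S x) = _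
  rw [LinearEquiv.symm_apply_apply]

theorem eq_comp_antipode_symm_of_implements (hε : IsCounit G.Δ ε) (hS : IsAntipode G.Δ ε S)
    {θ θ' : Module.Dual ℂ A} {m : Multiplier G.dual} (hm : G.Implements θ m)
    (hm' : G.Implements θ'
      ((extendAnti (dualAntipode hε hS) (dualAntipode_anti_mul hε hS)).symm m)) :
    θ' = θ ∘ₗ S.symm.toLinearMap := by
  refine eq_of_apply_rightConv (G := G) fun ω x => ?_
  have h := antipode_leftConv hε hS (isTranslate_coe ω) (S.symm x)
  rw [LinearEquiv.apply_symm_apply] at h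
  rw [← (hm' _ x).1, LinearMap.comp_apply, LinearEquiv.coe_coe, ← h,
    LinearEquiv.symm_apply_apply]
  exact (hm (dualAntipode hε hS ω) (S.symm x)).2

end AlgebraicQuantumGroup

end QuantumGroup

end

theorem mainTheorem3 {A : Type*} [NonUnitalRing A] [Module ℂ A] [IsScalarTower ℂ A A]
    [SMulCommClass ℂ A A] (G : AlgebraicQuantumGroup A) :
    -- the counit, the antipode, the dual comultiplication, and the identification of `M(Â)` with
    -- a space of functionals on `A` are well defined
    (∃! ε : A →ₙₐ[ℂ] ℂ, IsCounit G.Δ ε) ∧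
    (∀ ε, IsCounit G.Δ ε → ∃! S : A ≃ₗ[ℂ] A, IsAntipode G.Δ ε S) ∧
    (∃! Δ' : G.dual →ₙₐ[ℂ] Multiplier (G.dual ⊗[ℂ] G.dual), G.IsDualComul Δ') ∧
    (∃! F : G.multiplierFunctionals ≃ₗ[ℂ] Multiplier G.dual, ∀ θ, G.Implements θ.1 (F θ)) ∧
    ∀ ε S, IsCounit G.Δ ε → IsAntipode G.Δ ε S →
    ∀ Δ' : G.dual →ₙₐ[ℂ] Multiplier (G.dual ⊗[ℂ] G.dual), G.IsDualComul Δ' →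
    ∀ F : G.multiplierFunctionals ≃ₗ[ℂ] Multiplier G.dual, (∀ θ, G.Implements θ.1 (F θ)) →
      -- the dual counit, on `M(Â)`
      (∃! ε' : G.dual →ₙₐ[ℂ] ℂ, IsCounit Δ' ε') ∧
      ∀ (ε' : G.dual →ₙₐ[ℂ] ℂ) (hε' : IsCounit Δ' ε'),
        (∀ (ω : Module.Dual ℂ A) (a : A),
          extendChar ε' hε'.exists_eq_one (F (G.rightTranslateMem ω a)) = ω a ∧
          extendChar ε' hε'.exists_eq_one (F (G.leftTranslateMem ω a)) = ω a) ∧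
        -- the dual antipode, on `M(Â)`
        (∃! S' : G.dual ≃ₗ[ℂ] G.dual, IsAntipode Δ' ε' S') ∧
        ∀ (S' : G.dual ≃ₗ[ℂ] G.dual) (hS' : IsAntipode Δ' ε' S') (ω : G.multiplierFunctionals),
          (F.symm (extendAnti S' hS'.anti_mul (F ω)) : Module.Dual ℂ A) =
            (ω : Module.Dual ℂ A) ∘ₗ S.toLinearMap ∧
          (F.symm ((extendAnti S' hS'.anti_mul).symm (F ω)) : Module.Dual ℂ A) =
            (ω : Module.Dual ℂ A) ∘ₗ S.symm.toLinearMap := by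
  have hA := G.nondegenerate
  have hN := AlgebraicQuantumGroup.nondegenerate_dual G
  have := G.nontrivial
  obtain ⟨ε₀, hε₀⟩ := G.exists_counit
  obtain ⟨S₀, hS₀⟩ := G.exists_antipode hε₀
  refine ⟨⟨ε₀, hε₀, fun ε h => h.unique hA hε₀⟩, fun ε hε => ?_,
    ⟨_, AlgebraicQuantumGroup.isDualComul_dualComul hε₀ hS₀, fun Δ' h => h.eq
      (AlgebraicQuantumGroup.isDualComul_dualComul hε₀ hS₀)⟩,
    AlgebraicQuantumGroup.existsUnique_multiplierEquiv hε₀ hS₀,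
    fun ε S hε hS Δ' hΔ' F hF => ?_⟩
  · obtain ⟨S, hS⟩ := G.exists_antipode hε
    exact ⟨S, hS, fun S' h => IsAntipode.unique hA G.E₂ G.E₂_bijective.2
      (fun a b => by rw [G.incl_E₂, T₂_tmul]) h hS⟩
  obtain rfl := hΔ'.eq (AlgebraicQuantumGroup.isDualComul_dualComul hε hS)
  have hcounit := AlgebraicQuantumGroup.isCounit_dualCounit hε hS
  refine ⟨⟨_, hcounit, fun ε' h => h.unique hN hcounit⟩, fun ε' hε' => ?_⟩
  obtain rfl := hε'.unique hN hcounit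
  refine ⟨fun ω a => ⟨?_, ?_⟩, ⟨_, AlgebraicQuantumGroup.isAntipode_dualAntipode hε hS,
    fun S' h => AlgebraicQuantumGroup.eq_dualAntipode h⟩, fun S' hS' θ => ?_⟩
  · exact AlgebraicQuantumGroup.extendChar_dualCounit hε hS _ (G.rightTranslateMem ω a).2 (hF _)
      (AlgebraicQuantumGroup.ψ_rightConv_rightTranslate hε hS ω a)
  · exact AlgebraicQuantumGroup.extendChar_dualCounit hε hS _ (G.leftTranslateMem ω a).2 (hF _)
      (AlgebraicQuantumGroup.ψ_rightConv_leftTranslate hε hS ω a)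
  obtain rfl := AlgebraicQuantumGroup.eq_dualAntipode hS'
  have hF' : ∀ m, G.Implements (F.symm m).1 m := fun m => by
    simpa using hF (F.symm m)
  exact ⟨AlgebraicQuantumGroup.eq_comp_antipode_of_implements hε hS (hF θ) (hF' _),
    AlgebraicQuantumGroup.eq_comp_antipode_symm_of_implements hε hS (hF θ) (hF' _)⟩
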